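/- **Notation.** For $\ell\ge 0$ let $s:\mathrm{Mp}(\ell)\to\mathrm{Sp}(\ell)$ be the metaplectic double cover of the group of real symplectic $2\ell\times 2\ell$ matrices: the elements of $\mathrm{Mp}(\ell)$ are the pairs $(A,f)$ with $A=\begin{pmatrix}a&b\\c&d\end{pmatrix}\in \mathrm{Sp}(\ell)$ and $f$ a continuous function on the Siegel upper half space with $f(\tau)^2=\det(c\tau+d)$; the product is $(A,f)(B,g)=(AB,\ \tau\mapsto f(B\tau)g(\tau))$, and $\mathrm{Mp}(0)=\{\pm1\}$. For $0\le k\le\ell$ let $\mathrm{Sp}_+(k,\ell)\subseteq \mathrm{Sp}(\ell)$ be the subgroup of the matrices $(a_{ij})$ with $a_{ij}=0$ for $j\le k<i$ and $\det(a_{ij})_{i,j\le k}>0$, let $\mathrm{Mp}_+(k,\ell)=s^{-1}(\mathrm{Sp}_+(k,\ell))$, and let $\gamma:\mathrm{Sp}_+(k,\ell)\to\mathrm{Sp}(\ell-k)$ be the natural surjection. It lifts to a surjective homomorphism $\tilde\gamma:\mathrm{Mp}_+(k,\ell)\to \mathrm{Mp}(\ell-k)$, $(A,f)\mapsto(\gamma(A),\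 \tau\mapsto \det(a_{ij})_{i,j\le k}^{1/2}\,f(\mathrm{diag}(\sqrt{-1}\,I_k,\tau)))$, whose kernel $Z$ is the identity component of $s^{-1}(\ker\gamma)$. For a symplectic vector bundle $V$ of rank $2r$ over $N$, let $\mathrm{Bp}(V)\to N$ be the principal $\mathrm{Sp}(r)$-bundle of symplectic frames. A metaplectic structure on $V$ is a principal $\mathrm{Mp}(r)$-bundle $\mathrm{Mp}(V)\to N$ with a continuous map $\mathrm{Mp}(V)\to\mathrm{Bp}(V)$ over $N$ that is equivariant with respect to $s$. Two of them are equivalent if there is an isomorphism of principal $\mathrm{Mp}(r)$-bundles between them that commutes with the maps to $\mathrm{Bp}(V)$. **Proposition.** Let $(E,\Omega)$ be a symplectic vector bundle of rank $2\ell$ over a topological space $N$ (for example a manifold), let $I\subseteq E$ be an oriented isotropic subbundle of rank $k$, and let $N_I=I^{\perp_\Omega}/I$ be its symplectic normal bundle, of rank $2(\ell-k)$. Let $\mathrm{Bp}_+(I,E)\subseteq\mathrm{Bp}(E)$ be the bundle of those symplectic frames $(e_1,\dots,e_\ell,f_1,\dots,f_\ell)$ for which $(e_1,\dots,e_k)$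 is an oriented basis of $I$, with its projection $$\mathrm{Bp}_+(I,E)\to\mathrm{Bp}(N_I),\qquad (e,f)\mapsto([e_{k+1}],\dots,[e_\ell],[f_{k+1}],\dots,[f_\ell]).$$ Then there is a natural bijection between the set of equivalence classes of metaplectic structures on $E$ and the set of equivalence classes of metaplectic structures on $N_I$. It sends the class of $\mathrm{Mp}(E)$ to the class of $\mathrm{Mp}_+(I,E)/Z$, where $\mathrm{Mp}_+(I,E)$ is the preimage of $\mathrm{Bp}_+(I,E)$ in $\mathrm{Mp}(E)$. That is, $[\mathrm{Mp}(E)]$ corresponds to $[\mathrm{Mp}(N_I)]$ if and only if there is a quotient map $\mathrm{Mp}_+(I,E)\to\mathrm{Mp}(N_I)$ over the projection $\mathrm{Bp}_+(I,E)\to\mathrm{Bp}(N_I)$ that is equivariant with respect to $\tilde\gamma$ and whose fibres are the $Z$-orbits. -/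

import Mathlib

open Matrix Topology Bundle

noncomputable section

namespace Metaplectic

section Group

set_option linter.unusedSectionVars false
set_option linter.unusedSimpArgs false

variable {ι : Type*} [Fintype ι] [DecidableEq ι]

/-- The symplectic group `Sp(ℓ)` of real matrices, where `ℓ` is the cardinality of `ι`. -/
abbrev Sp (ι : Type*) [Fintype ι] [DecidableEq ι] : Type _ := Matrix.symplecticGroup ι ℝ

/-- The Siegel upper half space: complex symmetric matrices with positive definite imaginary
part. -/
abbrev Siegel (ι : Type*) [Fintype ι] [DecidableEq ι] : Type _ :=
  {τ : Matrix ι ι ℂ // τᵀ = τ ∧ (τ.map Complex.im).PosDef}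

/-- `a τ + b` for a real matrix with blocks `a, b, c, d`. -/
def num (A : Matrix (ι ⊕ ι) (ι ⊕ ι) ℝ) (τ : Matrix ι ι ℂ) : Matrix ι ι ℂ :=
  A.toBlocks₁₁.map Complex.ofReal * τ + A.toBlocks₁₂.map Complex.ofReal

/-- `c τ + d` for a real matrix with blocks `a, b, c, d`. -/
def den (A : Matrix (ι ⊕ ι) (ι ⊕ ι) ℝ) (τ : Matrix ι ι ℂ) : Matrix ι ι ℂ :=
  A.toBlocks₂₁.map Complex.ofReal * τ + A.toBlocks₂₂.map Complex.ofReal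

open scoped ComplexOrder in
theorem posDef_map_ofReal {Y : Matrix ι ι ℝ} :
    (Y.map Complex.ofReal).PosDef ↔ Y.PosDef := by
  rw [posDef_iff_dotProduct_mulVec, posDef_iff_dotProduct_mulVec]
  have key : ∀ x : ι → ℝ, star (fun i => (x i : ℂ)) ⬝ᵥ
      (Y.map Complex.ofReal *ᵥ (fun i => (x i : ℂ))) = ((star x ⬝ᵥ (Y *ᵥ x) : ℝ) : ℂ) := by
    intro x
    simp [dotProduct, mulVec]
  constructor
  · rintro ⟨h1, h2⟩
    refine ⟨?_, fun x hx => ?_⟩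
    · ext i j
      have := congrFun (congrFun h1 i) j
      simpa using this
    · have h := h2 (x := fun i => (x i : ℂ)) (by
        intro h
        apply hx
        funext i
        simpa using congrFun h i)
      rw [key] at h
      exact_mod_cast h
  · rintro ⟨h1, h2⟩
    have hs : ∀ i j, Y i j = Y j i := fun i j => by
      simpa using (congrFun (congrFun h1 i) j).symm
    refine ⟨?_, fun x hx => ?_⟩
    · ext i j
      simp [hs i j]
    · set a : ι → ℝ := fun i => (x i).re with ha
      set b : ι → ℝ := fun i => (x i).im with hb
      have e : star x ⬝ᵥ (Y.map Complex.ofReal *ᵥ x) =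
          ((star a ⬝ᵥ (Y *ᵥ a) + star b ⬝ᵥ (Y *ᵥ b) : ℝ) : ℂ) := by
        apply Complex.ext
        · simp [dotProduct, mulVec, ha, hb, Finset.mul_sum, ← Finset.sum_add_distrib]
        · simp only [dotProduct, mulVec, Pi.star_apply, map_apply, Finset.mul_sum,
            Complex.im_sum, Complex.ofReal_im]
          have : ∀ i j, (star (x i) * ((Y i j : ℂ) * x j)).im =
              Y i j * (a i * b j) - Y i j * (b i * a j) := by
            intro i j
            simp [ha, hb]; ring
          simp only [this, Finset.sum_sub_distrib]
          rw [sub_eq_zero, Finset.sum_comm]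
          refine Finset.sum_congr rfl fun i _ => Finset.sum_congr rfl fun j _ => ?_
          rw [hs j i]; ring
      rw [e]
      have hab : a ≠ 0 ∨ b ≠ 0 := by
        by_contra! h
        apply hx
        funext i
        exact Complex.ext (congrFun h.1 i) (congrFun h.2 i)
      have hnn : ∀ c : ι → ℝ, 0 ≤ star c ⬝ᵥ (Y *ᵥ c) := by
        intro c
        by_cases hc : c = 0
        · simp [hc]
        · exact (h2 hc).le
      have : 0 < star a ⬝ᵥ (Y *ᵥ a) + star b ⬝ᵥ (Y *ᵥ b) := by
        rcases hab with h | h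
        · exact add_pos_of_pos_of_nonneg (h2 h) (hnn b)
        · exact add_pos_of_nonneg_of_pos (hnn a) (h2 h)
      exact_mod_cast this

theorem den_num_identity (A : Sp ι) {σ τ : Matrix ι ι ℂ} (hσ : σᵀ = σ) :
    (den A.1 σ)ᵀ * num A.1 τ - (num A.1 σ)ᵀ * den A.1 τ = τ - σ := by
  have h := A.2
  rw [← fromBlocks_toBlocks A.1, SymplecticGroup.fromBlocks_mem_iff] at h
  obtain ⟨h1, h2, h3⟩ := h
  have h4 : (A.1.toBlocks₂₂)ᵀ * A.1.toBlocks₁₁ - (A.1.toBlocks₁₂)ᵀ * A.1.toBlocks₂₁ = 1 := by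
    simpa using congrArg transpose h3
  have t : ∀ M M' : Matrix ι ι ℝ, (Mᵀ * M').map Complex.ofReal =
      (M.map Complex.ofReal)ᵀ * M'.map Complex.ofReal := fun M M' =>
    Matrix.map_mul (f := Complex.ofRealHom)
  have one : (1 : Matrix ι ι ℝ).map Complex.ofReal = 1 := by simp
  have sb : ∀ M M' : Matrix ι ι ℝ, (M - M').map Complex.ofReal =
      M.map Complex.ofReal - M'.map Complex.ofReal := fun M M' => by ext; simp
  replace h1 := congrArg (fun M : Matrix ι ι ℝ => M.map Complex.ofReal) h1
  replace h2 := congrArg (fun M : Matrix ι ι ℝ => M.map Complex.ofReal) h2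
  replace h3 := congrArg (fun M : Matrix ι ι ℝ => M.map Complex.ofReal) h3
  replace h4 := congrArg (fun M : Matrix ι ι ℝ => M.map Complex.ofReal) h4
  simp only [t, sb, one] at h1 h2 h3 h4
  simp only [num, den]
  generalize A.1.toBlocks₁₁.map Complex.ofReal = a at *
  generalize A.1.toBlocks₁₂.map Complex.ofReal = b at *
  generalize A.1.toBlocks₂₁.map Complex.ofReal = c at *
  generalize A.1.toBlocks₂₂.map Complex.ofReal = d at *
  have e : (c * σ + d)ᵀ * (a * τ + b) - (a * σ + b)ᵀ * (c * τ + d) =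
      σ * (cᵀ * a - aᵀ * c) * τ - σ * (aᵀ * d - cᵀ * b) + (dᵀ * a - bᵀ * c) * τ
        + (dᵀ * b - bᵀ * d) := by
    simp only [transpose_add, transpose_mul, hσ]
    noncomm_ring
  rw [e, h1, h2, h3, h4]
  simp
  abel

theorem conj_den (A : Sp ι) {τ : Matrix ι ι ℂ} (hτ : τᵀ = τ) :
    (den A.1 τ)ᴴ = (den A.1 τᴴ)ᵀ := by
  have : τᴴ = τ.map star := by rw [conjTranspose, hτ]
  rw [this]
  ext i j
  simp [den, mul_apply]

theorem conj_num (A : Sp ι) {τ : Matrix ι ι ℂ} (hτ : τᵀ = τ) :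
    (num A.1 τ)ᴴ = (num A.1 τᴴ)ᵀ := by
  have : τᴴ = τ.map star := by rw [conjTranspose, hτ]
  rw [this]
  ext i j
  simp [num, mul_apply]

theorem sub_conjTranspose {τ : Matrix ι ι ℂ} (hτ : τᵀ = τ) :
    τ - τᴴ = (2 * Complex.I) • (τ.map Complex.im).map Complex.ofReal := by
  have : τᴴ = τ.map star := by rw [conjTranspose, hτ]
  rw [this]
  ext i j
  apply Complex.ext <;> simp
  ring

theorem conjTranspose_symm {τ : Matrix ι ι ℂ} (hτ : τᵀ = τ) : (τᴴ)ᵀ = τᴴ := by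
  ext i j
  have := congrFun (congrFun hτ i) j
  simp only [transpose_apply] at this
  simp [this]

open scoped ComplexOrder in
theorem isUnit_den (A : Sp ι) (τ : Siegel ι) : IsUnit (den A.1 τ.1) := by
  rw [← Matrix.mulVec_injective_iff_isUnit]
  have hinj : Function.Injective (den A.1 τ.1).mulVecLin := by
    rw [← LinearMap.ker_eq_bot, LinearMap.ker_eq_bot']
    intro v hv
    have hv' : den A.1 τ.1 *ᵥ v = 0 := hv
    have hs := conjTranspose_symm τ.2.1
    have h := den_num_identity A (σ := (τ.1)ᴴ) (τ := τ.1) hs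
    rw [← conj_den A τ.2.1, ← conj_num A τ.2.1, sub_conjTranspose τ.2.1] at h
    have h' := congrArg (fun M : Matrix ι ι ℂ => star v ⬝ᵥ (M *ᵥ v)) h
    simp only [sub_mulVec, ← mulVec_mulVec, hv', mulVec_zero, sub_zero] at h'
    rw [dotProduct_mulVec, ← star_mulVec, hv'] at h'
    simp only [star_zero, zero_dotProduct, smul_mulVec, dotProduct_smul, smul_eq_mul] at h'
    by_contra hne
    have hp := (posDef_iff_dotProduct_mulVec.1 (posDef_map_ofReal.2 τ.2.2)).2 hne
    rcases mul_eq_zero.1 h'.symm with h0 | h0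
    · simp at h0
    · rw [h0] at hp
      exact lt_irrefl _ hp
  exact hinj

theorem isUnit_det_den (A : Sp ι) (τ : Siegel ι) : IsUnit (den A.1 τ.1).det :=
  (Matrix.isUnit_iff_isUnit_det _).1 (isUnit_den A τ)

open scoped ComplexOrder in
theorem moebius_mem (A : Sp ι) (τ : Siegel ι) :
    (num A.1 τ.1 * (den A.1 τ.1)⁻¹)ᵀ = num A.1 τ.1 * (den A.1 τ.1)⁻¹ ∧
      ((num A.1 τ.1 * (den A.1 τ.1)⁻¹).map Complex.im).PosDef := by
  have hu := isUnit_det_den A τ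
  set q := den A.1 τ.1 with hq
  set p := num A.1 τ.1 with hp
  have hs := conjTranspose_symm τ.2.1
  have h1 := den_num_identity A (σ := τ.1) (τ := τ.1) τ.2.1
  have h2 := den_num_identity A (σ := (τ.1)ᴴ) (τ := τ.1) hs
  rw [← conj_den A τ.2.1, ← conj_num A τ.2.1, sub_conjTranspose τ.2.1] at h2
  rw [← hq, ← hp] at h1 h2
  rw [sub_self, sub_eq_zero] at h1
  obtain ⟨t, ht⟩ : ∃ t, t = p * q⁻¹ := ⟨_, rfl⟩
  rw [← ht]
  have htq : t * q = p := by rw [ht, nonsing_inv_mul_cancel_right _ _ hu]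
  clear_value p
  have huT : IsUnit qᵀ.det := by rwa [det_transpose]
  have hsym : tᵀ = t := by
    have : qᵀ * (tᵀ * q) = qᵀ * (t * q) := by
      rw [htq, h1, ← htq, transpose_mul, Matrix.mul_assoc]
    have := congrArg (fun M => qᵀ⁻¹ * M * q⁻¹) this
    simpa [nonsing_inv_mul_cancel_left _ _ huT, mul_nonsing_inv_cancel_right _ _ hu] using this
  refine ⟨hsym, ?_⟩
  have h3 : qᴴ * (t.map Complex.im).map Complex.ofReal * q =
      (τ.1.map Complex.im).map Complex.ofReal := by
    have : qᴴ * (t - tᴴ) * q = qᴴ * p - pᴴ * q := by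
      rw [← htq, conjTranspose_mul]; noncomm_ring
    rw [h2, sub_conjTranspose hsym, Matrix.mul_smul, Matrix.smul_mul] at this
    exact smul_right_injective _ (by simp : (2 * Complex.I) ≠ 0) this
  have huH : IsUnit qᴴ.det := by rw [det_conjTranspose]; exact hu.star
  rw [← posDef_map_ofReal]
  have h4 : (t.map Complex.im).map Complex.ofReal =
      (q⁻¹)ᴴ * (τ.1.map Complex.im).map Complex.ofReal * q⁻¹ := by
    rw [← h3, conjTranspose_nonsing_inv, ← Matrix.mul_assoc, mul_nonsing_inv_cancel_right _ _ hu,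
      nonsing_inv_mul_cancel_left _ _ huH]
  rw [h4]
  refine (posDef_map_ofReal.2 τ.2.2).conjTranspose_mul_mul_same ?_
  rw [Matrix.mulVec_injective_iff_isUnit, Matrix.isUnit_nonsing_inv_iff]
  exact isUnit_den A τ

/-- The action `τ ↦ (a τ + b) (c τ + d)⁻¹` of the symplectic group on the Siegel space. -/
def moebius (A : Sp ι) (τ : Siegel ι) : Siegel ι :=
  ⟨num A.1 τ.1 * (den A.1 τ.1)⁻¹, moebius_mem A τ⟩

theorem moebius_mul_den (A : Sp ι) (τ : Siegel ι) :
    (moebius A τ).1 * den A.1 τ.1 = num A.1 τ.1 :=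
  nonsing_inv_mul_cancel_right _ _ (isUnit_det_den A τ)

theorem num_den_mul (A B : Sp ι) (τ : Siegel ι) :
    num (A * B).1 τ.1 = num A.1 (moebius B τ).1 * den B.1 τ.1 ∧
      den (A * B).1 τ.1 = den A.1 (moebius B τ).1 * den B.1 τ.1 := by
  have h := moebius_mul_den B τ
  have t : ∀ M M' : Matrix ι ι ℝ, (M * M').map Complex.ofReal =
      M.map Complex.ofReal * M'.map Complex.ofReal := fun M M' =>
    Matrix.map_mul (f := Complex.ofRealHom)
  have ad : ∀ M M' : Matrix ι ι ℝ, (M + M').map Complex.ofReal =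
      M.map Complex.ofReal + M'.map Complex.ofReal := fun M M' => by ext; simp
  have hb := fromBlocks_multiply A.1.toBlocks₁₁ A.1.toBlocks₁₂ A.1.toBlocks₂₁ A.1.toBlocks₂₂
    B.1.toBlocks₁₁ B.1.toBlocks₁₂ B.1.toBlocks₂₁ B.1.toBlocks₂₂
  rw [fromBlocks_toBlocks, fromBlocks_toBlocks, ← Submonoid.coe_mul] at hb
  generalize moebius B τ = m at h
  constructor
  · have : num A.1 m.1 * den B.1 τ.1 = A.1.toBlocks₁₁.map Complex.ofReal * num B.1 τ.1 +
        A.1.toBlocks₁₂.map Complex.ofReal * den B.1 τ.1 := by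
      rw [← h, num]; noncomm_ring
    rw [this, hb]
    simp only [num, den, toBlocks_fromBlocks₁₁, toBlocks_fromBlocks₁₂, t, ad]
    noncomm_ring
  · have : den A.1 m.1 * den B.1 τ.1 = A.1.toBlocks₂₁.map Complex.ofReal * num B.1 τ.1 +
        A.1.toBlocks₂₂.map Complex.ofReal * den B.1 τ.1 := by
      rw [← h, den]; noncomm_ring
    rw [this, hb]
    simp only [num, den, toBlocks_fromBlocks₂₁, toBlocks_fromBlocks₂₂, t, ad]
    noncomm_ring

theorem moebius_mul (A B : Sp ι) (τ : Siegel ι) :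
    moebius (A * B) τ = moebius A (moebius B τ) := by
  apply Subtype.ext
  obtain ⟨h1, h2⟩ := num_den_mul A B τ
  change num (A * B).1 τ.1 * (den (A * B).1 τ.1)⁻¹ = num A.1 _ * (den A.1 _)⁻¹
  rw [h1, h2, Matrix.mul_inv_rev, ← Matrix.mul_assoc,
    mul_nonsing_inv_cancel_right _ _ (isUnit_det_den B τ)]

theorem den_one (τ : Matrix ι ι ℂ) : den (1 : Sp ι).1 τ = 1 := by
  simp [den, ← fromBlocks_one]

theorem num_one (τ : Matrix ι ι ℂ) : num (1 : Sp ι).1 τ = τ := by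
  simp [num, ← fromBlocks_one]

theorem moebius_one (τ : Siegel ι) : moebius (1 : Sp ι) τ = τ :=
  Subtype.ext (by
    change num (1 : Sp ι).1 τ.1 * (den (1 : Sp ι).1 τ.1)⁻¹ = τ.1
    rw [den_one, num_one, inv_one, Matrix.mul_one])

theorem continuous_num (A : Sp ι) : Continuous fun τ : Siegel ι => num A.1 τ.1 := by
  unfold num; fun_prop

theorem continuous_den (A : Sp ι) : Continuous fun τ : Siegel ι => den A.1 τ.1 := by
  unfold den; fun_prop

theorem continuous_moebius (A : Sp ι) : Continuous (moebius A) := by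
  refine Continuous.subtype_mk ((continuous_num A).matrix_mul ?_) _
  simp only [Matrix.inv_def, Ring.inverse_eq_inv']
  exact ((continuous_den A).matrix_det.inv₀ fun τ => (isUnit_det_den A τ).ne_zero).smul
    (continuous_den A).matrix_adjugate

/-- The metaplectic group `Mp(ℓ)`: symplectic matrices together with a continuous choice of
a square root of `det (c τ + d)` on the Siegel upper half space. It is the connected double cover
of `Sp(ℓ)` for `ℓ ≥ 1`, and the group of order two for `ℓ = 0`. -/
@[ext]
structure Mp (ι : Type*) [Fintype ι] [DecidableEq ι] where
  /-- the underlying symplectic matrix; this is the covering map onto `Sp(ℓ)` -/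
  mat : Sp ι
  /-- the square root of the automorphy factor -/
  root : C(Siegel ι, ℂ)
  root_sq : ∀ τ, root τ ^ 2 = (den mat.1 τ.1).det

theorem Mp.root_ne_zero (g : Mp ι) (τ : Siegel ι) : g.root τ ≠ 0 := by
  intro h
  have := g.root_sq τ
  rw [h] at this
  exact (isUnit_det_den g.mat τ).ne_zero (by rw [← this]; simp)

/-- The group law `(A, f) (B, g) = (A B, τ ↦ f (B τ) g τ)`. -/
instance : Mul (Mp ι) where
  mul g h :=
    { mat := g.mat * h.mat
      root := ⟨fun τ => g.root (moebius h.mat τ) * h.root τ,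
        (g.root.continuous.comp (continuous_moebius h.mat)).mul h.root.continuous⟩
      root_sq := fun τ => by
        change (g.root (moebius h.mat τ) * h.root τ) ^ 2 = _
        rw [mul_pow, g.root_sq, h.root_sq, (num_den_mul g.mat h.mat τ).2, det_mul] }

instance : One (Mp ι) where
  one :=
    { mat := 1
      root := ContinuousMap.const _ 1
      root_sq := fun τ => by rw [den_one]; simp }

instance : Inv (Mp ι) where
  inv g :=
    { mat := g.mat⁻¹
      root := ⟨fun τ => (g.root (moebius g.mat⁻¹ τ))⁻¹,
        (g.root.continuous.comp (continuous_moebius _)).inv₀ fun _ => g.root_ne_zero _⟩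
      root_sq := fun τ => by
        change (g.root (moebius g.mat⁻¹ τ))⁻¹ ^ 2 = _
        have h := (num_den_mul g.mat g.mat⁻¹ τ).2
        rw [mul_inv_cancel, den_one] at h
        have h' := congrArg det h
        rw [det_one, det_mul] at h'
        rw [inv_pow, g.root_sq]
        exact inv_eq_of_mul_eq_one_right h'.symm }

theorem Mp.mul_mat (g h : Mp ι) : (g * h).mat = g.mat * h.mat := rfl

theorem Mp.mul_root (g h : Mp ι) (τ : Siegel ι) :
    (g * h).root τ = g.root (moebius h.mat τ) * h.root τ := rfl

theorem Mp.one_mat : (1 : Mp ι).mat = 1 := rfl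

theorem Mp.one_root (τ : Siegel ι) : (1 : Mp ι).root τ = 1 := rfl

theorem Mp.inv_mat (g : Mp ι) : (g⁻¹).mat = g.mat⁻¹ := rfl

theorem Mp.inv_root (g : Mp ι) (τ : Siegel ι) :
    (g⁻¹).root τ = (g.root (moebius g.mat⁻¹ τ))⁻¹ := rfl

instance : Group (Mp ι) where
  mul_assoc g h k := by
    refine Mp.ext (mul_assoc _ _ _) (ContinuousMap.ext fun τ => ?_)
    simp only [Mp.mul_root, Mp.mul_mat, moebius_mul, mul_assoc]
  one_mul g := by
    refine Mp.ext (one_mul _) (ContinuousMap.ext fun τ => ?_)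
    simp only [Mp.mul_root, Mp.one_root, one_mul]
  mul_one g := by
    refine Mp.ext (mul_one _) (ContinuousMap.ext fun τ => ?_)
    simp only [Mp.mul_root, Mp.one_root, Mp.one_mat, moebius_one, mul_one]
  inv_mul_cancel g := by
    refine Mp.ext (inv_mul_cancel _) (ContinuousMap.ext fun τ => ?_)
    rw [Mp.mul_root, Mp.inv_root, ← moebius_mul, inv_mul_cancel, moebius_one, Mp.one_root]
    exact inv_mul_cancel₀ (g.root_ne_zero τ)

end Group

section Normal

set_option linter.unusedSimpArgs false

variable {κ ι : Type*} [Fintype κ] [DecidableEq κ] [Fintype ι] [DecidableEq ι]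

/-- The point `i · 1` of the Siegel upper half space. -/
def baseSiegel (ι : Type*) [Fintype ι] [DecidableEq ι] : Siegel ι :=
  ⟨Complex.I • (1 : Matrix ι ι ℂ), by simp, by
    have : (Complex.I • (1 : Matrix ι ι ℂ)).map Complex.im = 1 := by
      ext i j
      by_cases h : i = j <;> simp [one_apply, h]
    rw [this]
    exact PosDef.one⟩

/-- The covering space topology: `Mp(ℓ)` is identified with the pairs `(A, z)` with
`z ^ 2 = det (c i + d)` by `(A, f) ↦ (A, f (i · 1))`; note that the Siegel space is connected. -/
instance : TopologicalSpace (Mp ι) :=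
  TopologicalSpace.induced (fun g => (g.mat, g.root (baseSiegel ι))) inferInstance

/-- The embedding `τ ↦ diag (i · 1, τ)` of Siegel upper half spaces. -/
def extendSiegel (κ : Type*) [Fintype κ] [DecidableEq κ] (τ : Siegel ι) : Siegel (κ ⊕ ι) :=
  ⟨fromBlocks (baseSiegel κ).1 0 0 τ.1, by
    rw [fromBlocks_transpose, (baseSiegel κ).2.1, τ.2.1]; simp, by
    have h1 := (baseSiegel κ).2.2
    have h2 := τ.2.2
    rw [fromBlocks_map, Matrix.map_zero _ (by simp), Matrix.map_zero _ (by simp)]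
    rw [posDef_iff_dotProduct_mulVec] at h1 h2 ⊢
    refine ⟨IsHermitian.fromBlocks h1.1 (by simp) h2.1, fun x hx => ?_⟩
    obtain ⟨u, v, rfl⟩ : ∃ u v, x = Sum.elim u v := ⟨_, _, (Sum.elim_comp_inl_inr x).symm⟩
    have e : star (Sum.elim u v) = Sum.elim (star u) (star v) := by
      funext i; cases i <;> rfl
    rw [e, fromBlocks_mulVec, sumElim_dotProduct_sumElim]
    simp only [Sum.elim_comp_inl, Sum.elim_comp_inr, zero_mulVec, add_zero, zero_add]
    have n1 : 0 ≤ star u ⬝ᵥ ((baseSiegel κ).1.map Complex.im *ᵥ u) := by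
      by_cases h : u = 0
      · simp [h]
      · exact (h1.2 h).le
    have n2 : 0 ≤ star v ⬝ᵥ (τ.1.map Complex.im *ᵥ v) := by
      by_cases h : v = 0
      · simp [h]
      · exact (h2.2 h).le
    by_cases h : u = 0
    · have hv : v ≠ 0 := by
        rintro rfl
        apply hx
        rw [h]
        funext i; cases i <;> rfl
      exact add_pos_of_nonneg_of_pos n1 (h2.2 hv)
    · exact add_pos_of_pos_of_nonneg (h1.2 h) n2⟩

/-- Membership in the subgroup `Sp₊(k, ℓ)`: the symplectic matrices whose first `k` columns vanish below the
`k`-th row and whose upper left `k × k` minor is positive. The index set of size `ℓ` is `κ ⊕ ι`,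
with `κ` of size `k`. -/
def IsSpPlus (A : Sp (κ ⊕ ι)) : Prop :=
  A.1.toBlocks₁₁.toBlocks₂₁ = 0 ∧ A.1.toBlocks₂₁.toBlocks₁₁ = 0 ∧
    A.1.toBlocks₂₁.toBlocks₂₁ = 0 ∧ 0 < A.1.toBlocks₁₁.toBlocks₁₁.det

theorem IsSpPlus.blocks {A : Sp (κ ⊕ ι)} (h : IsSpPlus A) :
    A.1.toBlocks₂₁.toBlocks₁₂ = 0 ∧ A.1.toBlocks₂₂.toBlocks₁₂ = 0 ∧
    A.1.toBlocks₁₁.toBlocks₁₁.det * A.1.toBlocks₂₂.toBlocks₁₁.det = 1 ∧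
    fromBlocks A.1.toBlocks₁₁.toBlocks₂₂ A.1.toBlocks₁₂.toBlocks₂₂
      A.1.toBlocks₂₁.toBlocks₂₂ A.1.toBlocks₂₂.toBlocks₂₂ ∈ Matrix.symplecticGroup ι ℝ := by
  obtain ⟨ha, hc1, hc2, hdet⟩ := h
  have hA := A.2
  rw [← fromBlocks_toBlocks A.1, SymplecticGroup.fromBlocks_mem_iff,
    ← fromBlocks_toBlocks A.1.toBlocks₁₁, ← fromBlocks_toBlocks A.1.toBlocks₁₂,
    ← fromBlocks_toBlocks A.1.toBlocks₂₁, ← fromBlocks_toBlocks A.1.toBlocks₂₂, ha, hc1, hc2] at hA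
  generalize A.1.toBlocks₁₁.toBlocks₁₁ = a11 at *
  generalize A.1.toBlocks₁₁.toBlocks₁₂ = a12 at *
  generalize A.1.toBlocks₁₁.toBlocks₂₂ = a22 at *
  generalize A.1.toBlocks₂₁.toBlocks₁₂ = c12 at *
  generalize A.1.toBlocks₂₁.toBlocks₂₂ = c22 at *
  generalize A.1.toBlocks₁₂.toBlocks₁₁ = b11 at *
  generalize A.1.toBlocks₁₂.toBlocks₁₂ = b12 at *
  generalize A.1.toBlocks₁₂.toBlocks₂₁ = b21 at *
  generalize A.1.toBlocks₁₂.toBlocks₂₂ = b22 at *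
  generalize A.1.toBlocks₂₂.toBlocks₁₁ = d11 at *
  generalize A.1.toBlocks₂₂.toBlocks₁₂ = d12 at *
  generalize A.1.toBlocks₂₂.toBlocks₂₁ = d21 at *
  generalize A.1.toBlocks₂₂.toBlocks₂₂ = d22 at *
  simp only [fromBlocks_transpose, fromBlocks_multiply, ← fromBlocks_one, fromBlocks_inj,
    sub_eq_add_neg, fromBlocks_neg, fromBlocks_add, transpose_zero, Matrix.zero_mul,
    Matrix.mul_zero, add_zero, zero_add, neg_zero] at hA
  obtain ⟨⟨-, p1, -, p2⟩, ⟨-, -, -, p3⟩, p4, p5, -, p6⟩ := hA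
  have hu : IsUnit a11ᵀ.det := by
    rw [det_transpose]; exact hdet.ne'.isUnit
  have z : ∀ M : Matrix κ ι ℝ, a11ᵀ * M = 0 → M = 0 := fun M hM => by
    rw [← nonsing_inv_mul_cancel_left a11ᵀ M hu, hM, Matrix.mul_zero]
  have hc : c12 = 0 := z _ p1
  subst hc
  simp only [transpose_zero, Matrix.zero_mul, Matrix.mul_zero, add_zero, zero_add, neg_zero] at *
  have hd : d12 = 0 := z _ p5
  subst hd
  simp only [transpose_zero, Matrix.zero_mul, Matrix.mul_zero, add_zero, zero_add, neg_zero] at *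
  refine ⟨trivial, trivial, ?_, ?_⟩
  · have := congrArg det p4
    rwa [det_mul, det_transpose, det_one] at this
  · rw [SymplecticGroup.fromBlocks_mem_iff]
    exact ⟨p2, p3, by rw [sub_eq_add_neg]; exact p6⟩

/-- The surjection `γ : Sp₊(k, ℓ) → Sp(ℓ - k)`. -/
def IsSpPlus.normalMat {A : Sp (κ ⊕ ι)} (h : IsSpPlus A) : Sp ι :=
  ⟨fromBlocks A.1.toBlocks₁₁.toBlocks₂₂ A.1.toBlocks₁₂.toBlocks₂₂
    A.1.toBlocks₂₁.toBlocks₂₂ A.1.toBlocks₂₂.toBlocks₂₂, h.blocks.2.2.2⟩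

theorem continuous_extendSiegel : Continuous (extendSiegel κ : Siegel ι → Siegel (κ ⊕ ι)) :=
  Continuous.subtype_mk (continuous_const.matrix_fromBlocks continuous_const continuous_const
    continuous_subtype_val) _

theorem IsSpPlus.det_den {A : Sp (κ ⊕ ι)} (h : IsSpPlus A) (τ : Siegel ι) :
    (A.1.toBlocks₁₁.toBlocks₁₁.det : ℂ) * (den A.1 (extendSiegel κ τ).1).det =
      (den h.normalMat.1 τ.1).det := by
  obtain ⟨hc, hd, hdet, -⟩ := h.blocks
  have e : den A.1 (extendSiegel κ τ).1 =
      fromBlocks (A.1.toBlocks₂₂.toBlocks₁₁.map Complex.ofReal) 0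
        (A.1.toBlocks₂₂.toBlocks₂₁.map Complex.ofReal) (den h.normalMat.1 τ.1) := by
    rw [den, ← fromBlocks_toBlocks A.1.toBlocks₂₁, ← fromBlocks_toBlocks A.1.toBlocks₂₂,
      h.2.1, h.2.2.1, hc, hd]
    simp [extendSiegel, den, normalMat, fromBlocks_map, fromBlocks_multiply, fromBlocks_add]
  have e2 : (A.1.toBlocks₂₂.toBlocks₁₁.map Complex.ofReal).det =
      (A.1.toBlocks₂₂.toBlocks₁₁.det : ℂ) := (RingHom.map_det Complex.ofRealHom _).symm
  rw [e, det_fromBlocks_zero₁₂, e2, ← mul_assoc, ← Complex.ofReal_mul, hdet]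
  simp

/-- The surjection `Mp₊(k, ℓ) → Mp₊(k, ℓ) / Z ≅ Mp(ℓ - k)` lifting `γ`. Here `Mp₊(k, ℓ)` is the
preimage of `Sp₊(k, ℓ)`, and `Z`, the kernel, consists of the `(A, f)` with `γ A = 1` and `f`
the positive constant `(det A₁₁) ^ (-1/2)`. For `(A, f)` in `Mp₊(k, ℓ)` the number `f τ` depends
only on the lower right block of `τ`, so evaluating at `diag (i · 1, τ)` involves no choice. -/
def Mp.normalPart (g : Mp (κ ⊕ ι)) (h : IsSpPlus g.mat) : Mp ι where
  mat := h.normalMat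
  root := ⟨fun τ => (Real.sqrt g.mat.1.toBlocks₁₁.toBlocks₁₁.det : ℂ) * g.root (extendSiegel κ τ),
    continuous_const.mul (g.root.continuous.comp continuous_extendSiegel)⟩
  root_sq τ := by
    change ((Real.sqrt g.mat.1.toBlocks₁₁.toBlocks₁₁.det : ℂ) * g.root (extendSiegel κ τ)) ^ 2 = _
    rw [mul_pow, g.root_sq, ← Complex.ofReal_pow, Real.sq_sqrt h.2.2.2.le, h.det_den]

end Normal
section Frames

/-- A symplectic frame `(e, f)` of a vector space with a bilinear form `B`: a basis with
`B (e i) (e j) = 0`, `B (f i) (f j) = 0`, `B (e i) (f j) = δ i j` and `B (f i) (e j) = -δ i j`. -/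
structure SymplecticFrame (ι : Type*) [DecidableEq ι] {V : Type*} [AddCommGroup V] [Module ℝ V]
    (B : LinearMap.BilinForm ℝ V) where
  /-- the vectors `e i`, with index `Sum.inl i`, and `f i`, with index `Sum.inr i` -/
  basis : Module.Basis (ι ⊕ ι) ℝ V
  rel : ∀ i j, B (basis i) (basis j) = -Matrix.J ι ℝ i j

section Single

set_option linter.unusedSectionVars false

variable {κ ι : Type*} [Fintype κ] [DecidableEq κ] [Fintype ι] [DecidableEq ι]
  {V : Type*} [AddCommGroup V] [Module ℝ V] {B : LinearMap.BilinForm ℝ V}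

theorem basis_toLinearEquiv_apply (b : Module.Basis (ι ⊕ ι) ℝ V) (A : Sp ι) (j : ι ⊕ ι) :
    (b.map (Matrix.toLinearEquiv b A.1 (SymplecticGroup.symplectic_det A.2))) j =
      ∑ i, A.1 i j • b i := by
  rw [Module.Basis.map_apply]
  exact Matrix.toLin_self b b A.1 j

/-- The right action of `Sp(ℓ)` on symplectic frames: `(b A) j = ∑ i, A i j • b i`. -/
def SymplecticFrame.act (b : SymplecticFrame ι B) (A : Sp ι) : SymplecticFrame ι B where
  basis := b.basis.map (Matrix.toLinearEquiv b.basis A.1 (SymplecticGroup.symplectic_det A.2))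
  rel j l := by
    rw [basis_toLinearEquiv_apply, basis_toLinearEquiv_apply]
    have h := congrFun (congrFun (SymplecticGroup.mem_iff'.1 A.2) j) l
    simp only [map_sum, LinearMap.sum_apply, map_smul, LinearMap.smul_apply, b.rel, smul_eq_mul]
    rw [← h]
    simp only [mul_apply, transpose_apply, Finset.sum_mul, Finset.mul_sum, ← Finset.sum_neg_distrib]
    refine Finset.sum_congr rfl fun i _ => Finset.sum_congr rfl fun i' _ => ?_
    ring

theorem linearIndependent_of_rel {w : ι ⊕ ι → V}
    (h : ∀ i j, B (w i) (w j) = -Matrix.J ι ℝ i j) : LinearIndependent ℝ w := by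
  rw [Fintype.linearIndependent_iff]
  intro a ha
  have h1 : Matrix.J ι ℝ *ᵥ a = 0 := by
    funext i
    have := congrArg (B (w i)) ha
    simp only [map_sum, map_smul, h, smul_eq_mul, map_zero] at this
    simp only [mulVec, dotProduct, Pi.zero_apply]
    rw [← neg_eq_zero, ← this, ← Finset.sum_neg_distrib]
    exact Finset.sum_congr rfl fun j _ => by ring
  have h2 := congrArg (fun x => Matrix.J ι ℝ *ᵥ x) h1
  simp only [mulVec_mulVec, J_squared, mulVec_zero, neg_mulVec, one_mulVec, neg_eq_zero] at h2
  exact congrFun h2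

/-- The symplectic normal space `I^⊥ / I`, where `I^⊥` is the annihilator of `I` under `B`. -/
abbrev NormalSpace (B : LinearMap.BilinForm ℝ V) (I : Submodule ℝ V) : Type _ :=
  ↥(B.orthogonal I) ⧸ I.submoduleOf (B.orthogonal I)

/-- The form induced by `B` on `I^⊥ / I`. -/
def normalSpaceForm (hB : B.IsAlt) (I : Submodule ℝ V) :
    LinearMap.BilinForm ℝ (NormalSpace B I) :=
  ((I.submoduleOf (B.orthogonal I)).liftQ
    ((I.submoduleOf (B.orthogonal I)).liftQ
      (B.domRestrict₁₂ (B.orthogonal I) (B.orthogonal I)) (by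
        intro u hu
        ext w
        exact w.2 u.1 hu)).flip (by
    intro u hu
    ext w
    exact hB.isRefl _ _ (w.2 u.1 hu))).flip

theorem normalSpaceForm_mk (hB : B.IsAlt) (I : Submodule ℝ V) (v w : B.orthogonal I) :
    normalSpaceForm hB I (Submodule.Quotient.mk v) (Submodule.Quotient.mk w) = B v.1 w.1 := rfl

theorem frame_mem_orthogonal (b : SymplecticFrame (κ ⊕ ι) B) {I : Submodule ℝ V}
    (c : Module.Basis κ ℝ I) (hc : ∀ i, (c i : V) = b.basis (Sum.inl (Sum.inl i))) (j : ι ⊕ ι) :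
    b.basis (Sum.map Sum.inr Sum.inr j) ∈ B.orthogonal I := by
  intro w hw
  have h := congrArg Subtype.val (c.sum_repr ⟨w, hw⟩)
  simp only [Submodule.coe_sum, Submodule.coe_smul, hc] at h
  change B w _ = 0
  rw [← h]
  simp only [map_sum, LinearMap.sum_apply, map_smul, LinearMap.smul_apply, b.rel]
  refine Finset.sum_eq_zero fun i _ => ?_
  cases j <;> simp [Matrix.J]

/-- If the first `k` vectors of a symplectic frame `(e, f)` form a basis of `I`, then the classes
of `e i, f i`, `i > k`, are a symplectic frame of `I^⊥ / I`. -/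
def SymplecticFrame.normal (hB : B.IsAlt) (b : SymplecticFrame (κ ⊕ ι) B) {I : Submodule ℝ V}
    (h : ∃ c : Module.Basis κ ℝ I, ∀ i, (c i : V) = b.basis (Sum.inl (Sum.inl i))) :
    SymplecticFrame ι (normalSpaceForm hB I) :=
  have mem : ∀ j, b.basis (Sum.map Sum.inr Sum.inr j) ∈ B.orthogonal I :=
    fun j => h.elim fun c hc => frame_mem_orthogonal b c hc j
  have rel : ∀ i j : ι ⊕ ι,
      normalSpaceForm hB I (Submodule.Quotient.mk ⟨_, mem i⟩) (Submodule.Quotient.mk ⟨_, mem j⟩) =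
        -Matrix.J ι ℝ i j := by
    intro i j
    rw [normalSpaceForm_mk]
    change B (b.basis _) (b.basis _) = _
    rw [b.rel]
    cases i <;> cases j <;> simp [Matrix.J, one_apply]
  { basis := Module.Basis.mk
      (v := fun j : ι ⊕ ι =>
        (Submodule.Quotient.mk ⟨b.basis (Sum.map Sum.inr Sum.inr j), mem j⟩ : NormalSpace B I))
      (linearIndependent_of_rel rel) (by
        obtain ⟨c, hc⟩ := h
        rintro x -
        obtain ⟨v, rfl⟩ := Submodule.Quotient.mk_surjective _ x
        have hv := b.basis.sum_repr v.1
        generalize b.basis.repr v.1 = a at hv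
        have hf : ∀ i : κ, a (Sum.inr (Sum.inl i)) = 0 := by
          intro i
          have h1 := v.2 (b.basis (Sum.inl (Sum.inl i))) (by rw [← hc]; exact (c i).2)
          change B _ v.1 = 0 at h1
          rw [← hv] at h1
          simp only [map_add, map_sum, map_smul, b.rel, Fintype.sum_sum_type] at h1
          simpa [Matrix.J, one_apply] using h1
        have key : (Submodule.Quotient.mk v : NormalSpace B I) =
            ∑ j : ι ⊕ ι, a (Sum.map Sum.inr Sum.inr j) •
              (Submodule.Quotient.mk ⟨_, mem j⟩ : NormalSpace B I) := by
          have : ∑ j : ι ⊕ ι, a (Sum.map Sum.inr Sum.inr j) •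
              (Submodule.Quotient.mk ⟨_, mem j⟩ : NormalSpace B I) =
              (I.submoduleOf (B.orthogonal I)).mkQ
                (∑ j : ι ⊕ ι, a (Sum.map Sum.inr Sum.inr j) •
                  (⟨_, mem j⟩ : B.orthogonal I)) := by
            simp only [map_sum, map_smul]; rfl
          rw [this]
          refine (Submodule.Quotient.eq _).2 ?_
          change (v.1 - _ : V) ∈ I
          have e : (v.1 - ((∑ j : ι ⊕ ι, a (Sum.map Sum.inr Sum.inr j) •
                  (⟨_, mem j⟩ : B.orthogonal I) : B.orthogonal I) : V)) =
              ∑ i : κ, a (Sum.inl (Sum.inl i)) • (c i : V) := by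
            rw [sub_eq_iff_eq_add]
            rw [← hv]
            simp [Fintype.sum_sum_type, hf, hc]
            abel
          rw [e]
          exact I.sum_mem fun i _ => I.smul_mem _ (c i).2
        rw [key]
        exact Submodule.sum_mem _ fun j _ => Submodule.smul_mem _ _
          (Submodule.subset_span ⟨j, rfl⟩))
    rel := fun i j => by
      rw [Module.Basis.mk_apply, Module.Basis.mk_apply]
      exact rel i j }

theorem SymplecticFrame.normal_basis (hB : B.IsAlt) (b : SymplecticFrame (κ ⊕ ι) B)
    {I : Submodule ℝ V}
    (h : ∃ c : Module.Basis κ ℝ I, ∀ i, (c i : V) = b.basis (Sum.inl (Sum.inl i))) (j : ι ⊕ ι) :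
    (b.normal hB h).basis j = Submodule.Quotient.mk
      ⟨b.basis (Sum.map Sum.inr Sum.inr j),
        h.elim fun c hc => frame_mem_orthogonal b c hc j⟩ := by
  dsimp only [SymplecticFrame.normal]
  rw [Module.Basis.mk_apply]

end Single

end Frames

section Bundles

universe u v

variable {N : Type u}

/-- The bundle `Bp(V)` of symplectic frames of a family of vector spaces `V x` with bilinear
forms `B x`. The parameter `F` only records the topology of the total space of `V`. -/
structure FrameBundle (F : Type*) (V : N → Type v) [∀ x, AddCommGroup (V x)]
    [∀ x, Module ℝ (V x)] (B : ∀ x, LinearMap.BilinForm ℝ (V x)) (ι : Type*) [DecidableEq ι] where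
  /-- the base point -/
  base : N
  /-- the frame of the fibre over the base point -/
  frame : SymplecticFrame ι (B base)

/-- A frame is a base point together with points of the total space; `Bp(V)` has the topology
induced from them (the base point is listed for the case of rank `0`). -/
instance [TopologicalSpace N] (F : Type*) (V : N → Type v) [∀ x, AddCommGroup (V x)]
    [∀ x, Module ℝ (V x)] [TopologicalSpace (TotalSpace F V)]
    (B : ∀ x, LinearMap.BilinForm ℝ (V x)) (ι : Type*) [DecidableEq ι] :
    TopologicalSpace (FrameBundle F V B ι) :=
  TopologicalSpace.induced
    (fun b => (b.base, fun i => (⟨b.base, b.frame.basis i⟩ : TotalSpace F V))) inferInstance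

/-- `P → N` is a (topological) principal `G`-bundle, for the given right action of `G` on `P`. -/
structure IsPrincipalBundle (G : Type*) [Group G] [TopologicalSpace G] {P : Type*}
    [TopologicalSpace P] [MulAction Gᵐᵒᵖ P] [TopologicalSpace N] (proj : P → N) : Prop where
  continuous : Continuous proj
  locallyTrivial : ∀ x : N, ∃ U : Set N, IsOpen U ∧ x ∈ U ∧ ∃ φ : U × G ≃ₜ proj ⁻¹' U,
    (∀ u g, proj (φ (u, g)).1 = u) ∧
      ∀ u g h, (φ (u, g * h)).1 = MulOpposite.op h • (φ (u, g)).1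

/-- A metaplectic structure on the family `V` of vector spaces with the forms `B`: a principal
`Mp(ℓ)`-bundle over `N` together with a continuous map to `Bp(V)` over `N` which is equivariant
for the double cover `Mp(ℓ) → Sp(ℓ)`. -/
structure MetaplecticStructure [TopologicalSpace N] (F : Type*) (V : N → Type v)
    [∀ x, AddCommGroup (V x)] [∀ x, Module ℝ (V x)] [TopologicalSpace (TotalSpace F V)]
    (B : ∀ x, LinearMap.BilinForm ℝ (V x)) (ι : Type) [Fintype ι] [DecidableEq ι] where
  /-- the total space of the `Mp(ℓ)`-bundle -/
  carrier : Type (max u v)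
  [topology : TopologicalSpace carrier]
  [action : MulAction (Mp ι)ᵐᵒᵖ carrier]
  /-- the map to the bundle of symplectic frames -/
  toFrame : carrier → FrameBundle F V B ι
  continuous_toFrame : Continuous toFrame
  toFrame_smul : ∀ (g : Mp ι) (p : carrier), toFrame (MulOpposite.op g • p) =
    ⟨(toFrame p).base, (toFrame p).frame.act g.mat⟩
  principal : IsPrincipalBundle (Mp ι) fun p => (toFrame p).base

attribute [instance] MetaplecticStructure.topology MetaplecticStructure.action

/-- Equivalence of metaplectic structures: an isomorphism of the `Mp(ℓ)`-bundles over `Bp(V)`. -/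
instance MetaplecticStructure.setoid [TopologicalSpace N] (F : Type*) (V : N → Type v)
    [∀ x, AddCommGroup (V x)] [∀ x, Module ℝ (V x)] [TopologicalSpace (TotalSpace F V)]
    (B : ∀ x, LinearMap.BilinForm ℝ (V x)) (ι : Type) [Fintype ι] [DecidableEq ι] :
    Setoid (MetaplecticStructure F V B ι) where
  r P Q := ∃ e : P.carrier ≃ₜ Q.carrier, (∀ p, Q.toFrame (e p) = P.toFrame p) ∧
    ∀ (g : Mp ι) (p : P.carrier), e (MulOpposite.op g • p) = MulOpposite.op g • e p
  iseqv :=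
    { refl := fun P => ⟨Homeomorph.refl _, fun _ => rfl, fun _ _ => rfl⟩
      symm := by
        rintro P Q ⟨e, h1, h2⟩
        refine ⟨e.symm, fun p => ?_, fun g p => ?_⟩
        · rw [← h1, e.apply_symm_apply]
        · rw [e.symm_apply_eq, h2, e.apply_symm_apply]
      trans := by
        rintro P Q R ⟨e, h1, h2⟩ ⟨e', h1', h2'⟩
        refine ⟨e.trans e', fun p => ?_, fun g p => ?_⟩
        · rw [Homeomorph.trans_apply, h1', h1]
        · simp only [Homeomorph.trans_apply, h2, h2'] }

/-- The set of equivalence classes of metaplectic structures. -/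
abbrev MetaplecticClass [TopologicalSpace N] (F : Type*) (V : N → Type v)
    [∀ x, AddCommGroup (V x)] [∀ x, Module ℝ (V x)] [TopologicalSpace (TotalSpace F V)]
    (B : ∀ x, LinearMap.BilinForm ℝ (V x)) (ι : Type) [Fintype ι] [DecidableEq ι] :=
  Quotient (MetaplecticStructure.setoid F V B ι)

/-- A symplectic form on a vector bundle: alternating, fibrewise nondegenerate and continuous. -/
structure SymplecticForm [TopologicalSpace N] (F : Type*) [NormedAddCommGroup F]
    [NormedSpace ℝ F] (E : N → Type v) [TopologicalSpace (TotalSpace F E)]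
    [∀ x, TopologicalSpace (E x)] [∀ x, AddCommGroup (E x)] [∀ x, Module ℝ (E x)]
    [∀ x, IsTopologicalAddGroup (E x)] [∀ x, ContinuousConstSMul ℝ (E x)]
    [FiberBundle F E] [VectorBundle ℝ F E] where
  /-- the form on each fibre -/
  form : ∀ x, E x →L[ℝ] E x →L[ℝ] ℝ
  alt : ∀ x v, form x v v = 0
  nondegenerate : ∀ x v, (∀ w, form x v w = 0) → v = 0
  continuous : Continuous fun x => TotalSpace.mk' (F →L[ℝ] F →L[ℝ] ℝ) x (form x)

section Normal

variable [TopologicalSpace N] {F : Type*} [NormedAddCommGroup F] [NormedSpace ℝ F]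
  {E : N → Type v} [TopologicalSpace (TotalSpace F E)]
  [∀ x, TopologicalSpace (E x)] [∀ x, AddCommGroup (E x)] [∀ x, Module ℝ (E x)]
  [∀ x, IsTopologicalAddGroup (E x)] [∀ x, ContinuousConstSMul ℝ (E x)]
  [FiberBundle F E] [VectorBundle ℝ F E]

/-- The bilinear forms underlying a symplectic form. -/
def SymplecticForm.bilin (Ω : SymplecticForm F E) (x : N) : LinearMap.BilinForm ℝ (E x) :=
  (Ω.form x).toLinearMap₁₂

theorem SymplecticForm.bilin_isAlt (Ω : SymplecticForm F E) (x : N) : (Ω.bilin x).IsAlt :=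
  Ω.alt x

/-- The fibres `I x` with the orientations `o x` form an oriented subbundle of rank `#κ`: locally
there are continuous sections which form an oriented basis of each fibre. -/
def IsOrientedSubbundle (F : Type*) {E : N → Type v} [TopologicalSpace (TotalSpace F E)]
    [∀ x, AddCommGroup (E x)] [∀ x, Module ℝ (E x)] {κ : Type*} [Fintype κ] [DecidableEq κ]
    (I : ∀ x, Submodule ℝ (E x)) (o : ∀ x, Orientation ℝ (I x) κ) : Prop :=
  ∀ x₀ : N, ∃ U : Set N, IsOpen U ∧ x₀ ∈ U ∧ ∃ s : κ → ∀ x, E x,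
    (∀ i, ContinuousOn (fun x => (⟨x, s i x⟩ : TotalSpace F E)) U) ∧
      ∀ x ∈ U, ∃ c : Module.Basis κ ℝ (I x), (∀ i, (c i : E x) = s i x) ∧ c.orientation = o x

/-- The fibres `N_I x = (I x)^⊥ / I x` of the symplectic normal bundle. -/
def NormalBundle (Ω : SymplecticForm F E) (I : ∀ x, Submodule ℝ (E x)) (x : N) : Type v :=
  NormalSpace (Ω.bilin x) (I x)

instance (Ω : SymplecticForm F E) (I : ∀ x, Submodule ℝ (E x)) (x : N) :
    AddCommGroup (NormalBundle Ω I x) :=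
  inferInstanceAs (AddCommGroup (NormalSpace (Ω.bilin x) (I x)))

instance (Ω : SymplecticForm F E) (I : ∀ x, Submodule ℝ (E x)) (x : N) :
    Module ℝ (NormalBundle Ω I x) :=
  inferInstanceAs (Module ℝ (NormalSpace (Ω.bilin x) (I x)))

/-- The topology of the normal bundle: the quotient topology of the subspace `I^⊥` of `E`. -/
instance (Ω : SymplecticForm F E) (I : ∀ x, Submodule ℝ (E x)) (F' : Type*) :
    TopologicalSpace (TotalSpace F' (NormalBundle Ω I)) :=
  TopologicalSpace.coinduced
    (fun p : {p : TotalSpace F E // p.2 ∈ (Ω.bilin p.1).orthogonal (I p.1)} =>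
      (⟨p.1.1, (Submodule.Quotient.mk ⟨p.1.2, p.2⟩ : NormalSpace (Ω.bilin p.1.1) (I p.1.1))⟩ :
        TotalSpace F' (NormalBundle Ω I)))
    inferInstance

/-- The symplectic form of the normal bundle. -/
def normalForm (Ω : SymplecticForm F E) (I : ∀ x, Submodule ℝ (E x)) (x : N) :
    LinearMap.BilinForm ℝ (NormalBundle Ω I x) :=
  normalSpaceForm (Ω.bilin_isAlt x) (I x)

variable {Ω : SymplecticForm F E} {κ ι : Type} [Fintype κ] [DecidableEq κ] [Fintype ι]
  [DecidableEq ι]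

/-- The subbundle `Bp₊(I, E)` of `Bp(E)`: the first `k` vectors of the frame are an oriented basis
of `I`. -/
def IsAdapted (I : ∀ x, Submodule ℝ (E x)) (o : ∀ x, Orientation ℝ (I x) κ)
    (b : FrameBundle F E Ω.bilin (κ ⊕ ι)) : Prop :=
  ∃ c : Module.Basis κ ℝ (I b.base),
    (∀ i, (c i : E b.base) = b.frame.basis (Sum.inl (Sum.inl i))) ∧ c.orientation = o b.base

/-- The projection `Bp₊(I, E) → Bp(N_I)`, `(e, f) ↦ ([e i], [f i])` with `i > k`. -/
def IsAdapted.normal {I : ∀ x, Submodule ℝ (E x)} {o : ∀ x, Orientation ℝ (I x) κ}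
    {b : FrameBundle F E Ω.bilin (κ ⊕ ι)} (h : IsAdapted I o b) (F' : Type*) :
    FrameBundle F' (NormalBundle Ω I) (normalForm Ω I) ι :=
  ⟨b.base, b.frame.normal (Ω.bilin_isAlt b.base) (h.imp fun _ hc => hc.1)⟩

/-- `Q` is the metaplectic structure `Mp₊(I, E) / Z` on `N_I`, where `Mp₊(I, E)` is the preimage of
`Bp₊(I, E)` in the metaplectic structure `P` of `E`: there is a quotient map from `Mp₊(I, E)` onto
`Q` over the projection `Bp₊(I, E) → Bp(N_I)`, which is equivariant for the homomorphism
`Mp₊(k, ℓ) → Mp(ℓ - k)` and whose fibres are the orbits of the kernel `Z` of this homomorphism. -/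
def IsNormalReduction {F' : Type*} (I : ∀ x, Submodule ℝ (E x)) (o : ∀ x, Orientation ℝ (I x) κ)
    (P : MetaplecticStructure F E Ω.bilin (κ ⊕ ι))
    (Q : MetaplecticStructure F' (NormalBundle Ω I) (normalForm Ω I) ι) : Prop :=
  ∃ R : {p : P.carrier // IsAdapted I o (P.toFrame p)} → Q.carrier,
    IsQuotientMap R ∧ (∀ p, Q.toFrame (R p) = p.2.normal F') ∧
    (∀ p p' (g : Mp (κ ⊕ ι)) (hg : IsSpPlus g.mat), p'.1 = MulOpposite.op g • p.1 →
      R p' = MulOpposite.op (g.normalPart hg) • R p) ∧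
    ∀ p p', R p = R p' ↔ ∃ (g : Mp (κ ⊕ ι)) (hg : IsSpPlus g.mat),
      g.normalPart hg = 1 ∧ p'.1 = MulOpposite.op g • p.1

end Normal

end Bundles

end Metaplectic
end

/-! The group `Mp₊(k, ℓ)` is the fibre product of `Sp₊(k, ℓ)` and `Mp(ℓ - k)` over `Sp(ℓ - k)`, as a
topological group. For `A` in `Sp₊(k, ℓ)` the matrix `c τ + d` is block triangular, and `det (c τ +
d)` is the automorphy factor of `γ A` at the lower right corner of `τ`, up to the positive constant
`(det A₁₁)⁻¹`. A positive constant has a preferred square root, so a square root of one factor is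
the same as a square root of the other. This is where the orientation of `I` is needed. The lemmas
are `normalHom_ext`, `MpPlus.exists_of` and `MpPlus.continuous_of`.

On the side of bundles, `Bp₊(I, E)` is a reduction of `Bp(E)` to `Sp₊(k, ℓ)`, because adapted frames
exist locally (`exists_local_adapted_frame`). For a metaplectic structure `P` of `E`, the quotient
`Q = Mp₊(I, E) / Z` is therefore a metaplectic structure of `N_I`, and `Mp₊(I, E)` is recovered from
it as the fibre product of `Bp₊(I, E)` and `Q` over `Bp(N_I)`. Conversely, for any `Q` this fibre
product is a principal `Mp₊(k, ℓ)`-bundle, and extending its structure group to `Mp(ℓ)` gives a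
metaplectic structure `Q.associated` of `E` with reduction `Q`. A `P` with reduction `Q` is
equivalent to `Q.associated` by `[m, g] ↦ p(m) g`, where `p(m)` is the point of `Mp₊(I, E)`
corresponding to `m`. So reduction is injective and surjective on classes.

Two points need care with topologies. The topology of `Mp(ℓ)` only records the root at `i · 1`, so
continuity of the product requires roots that are jointly continuous in the matrix and in `τ`; they
come from the contractibility of the Siegel space. The normal bundle only carries a quotient
topology, so its changes of frame are computed by pairing with local adapted frames of `E` instead
of using trivializations. -/

noncomputable section

namespace Metaplectic

/-! ### The metaplectic group as a topological group and as a cover -/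

section MetaplecticGroup

variable {ι : Type*} [Fintype ι] [DecidableEq ι]

/-- The segment from the base point of the Siegel space to `τ`. -/
def siegelSegment (t : unitInterval) (τ : Siegel ι) : Siegel ι :=
  ⟨((1 - t : ℝ) : ℂ) • (baseSiegel ι).1 + ((t : ℝ) : ℂ) • τ.1, by
    rw [transpose_add, transpose_smul, transpose_smul, (baseSiegel ι).2.1, τ.2.1], by
    have e : (((1 - t : ℝ) : ℂ) • (baseSiegel ι).1 + ((t : ℝ) : ℂ) • τ.1).map Complex.im =
        (1 - t : ℝ) • (baseSiegel ι).1.map Complex.im + (t : ℝ) • τ.1.map Complex.im := by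
      ext i j
      simp [-Complex.ofReal_sub]
    rw [e]
    rcases eq_or_lt_of_le t.2.1 with h | h
    · rw [← h]; simpa using (baseSiegel ι).2.2
    · exact PosDef.posSemidef_add ((baseSiegel ι).2.2.posSemidef.smul (sub_nonneg.2 t.2.2))
        (τ.2.2.smul h)⟩

theorem siegelSegment_zero (τ : Siegel ι) : siegelSegment 0 τ = baseSiegel ι :=
  Subtype.ext (by simp [siegelSegment])

theorem siegelSegment_one (τ : Siegel ι) : siegelSegment 1 τ = τ :=
  Subtype.ext (by simp [siegelSegment])

theorem continuous_siegelSegment :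
    Continuous fun p : unitInterval × Siegel ι => siegelSegment p.1 p.2 := by
  unfold siegelSegment
  fun_prop

instance : PreconnectedSpace (Siegel ι) where
  isPreconnected_univ := by
    refine isPreconnected_of_forall (baseSiegel ι) fun τ _ =>
      ⟨Set.range fun t => siegelSegment t τ, Set.subset_univ _, ⟨0, siegelSegment_zero τ⟩,
        ⟨1, siegelSegment_one τ⟩, isPreconnected_range ?_⟩
    exact continuous_siegelSegment.comp (by fun_prop : Continuous fun t => (t, τ))

/-- Two continuous square roots of the same nowhere vanishing function on a connected space agree
once they agree at one point. Identities in `Mp(ℓ)` are thereby checked at `i · 1`. -/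
theorem Mp.ext_base {g h : Mp ι} (hm : g.mat = h.mat)
    (hr : g.root (baseSiegel ι) = h.root (baseSiegel ι)) : g = h := by
  refine Mp.ext hm (ContinuousMap.ext fun τ => ?_)
  refine isPreconnected_univ.eq_of_sq_eq g.root.continuous.continuousOn
    h.root.continuous.continuousOn ?_ (fun {τ} _ => h.root_ne_zero τ) (Set.mem_univ _) hr
    (Set.mem_univ τ)
  intro τ _
  simp only [Pi.pow_apply, g.root_sq, h.root_sq, hm]

theorem continuous_den_prod : Continuous fun p : Sp ι × Siegel ι => den p.1.1 p.2.1 := by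
  have h : ∀ i j, Continuous fun p : Sp ι × Siegel ι => ((p.1.1 i j : ℝ) : ℂ) := fun i j =>
    Complex.continuous_ofReal.comp
      ((continuous_fst : Continuous (Prod.fst : Sp ι × Siegel ι → Sp ι)).subtype_val.matrix_elem i j)
  refine Continuous.add (Continuous.matrix_mul (continuous_matrix fun i j => h _ _) (by fun_prop))
    (continuous_matrix fun i j => h _ _)

theorem continuous_num_prod : Continuous fun p : Sp ι × Siegel ι => num p.1.1 p.2.1 := by
  have h : ∀ i j, Continuous fun p : Sp ι × Siegel ι => ((p.1.1 i j : ℝ) : ℂ) := fun i j =>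
    Complex.continuous_ofReal.comp
      ((continuous_fst : Continuous (Prod.fst : Sp ι × Siegel ι → Sp ι)).subtype_val.matrix_elem i j)
  refine Continuous.add (Continuous.matrix_mul (continuous_matrix fun i j => h _ _) (by fun_prop))
    (continuous_matrix fun i j => h _ _)

theorem continuous_moebius_prod : Continuous fun p : Sp ι × Siegel ι => moebius p.1 p.2 := by
  refine Continuous.subtype_mk (continuous_num_prod.matrix_mul ?_) _
  simp only [Matrix.inv_def, Ring.inverse_eq_inv']
  exact (continuous_den_prod.matrix_det.inv₀ fun p => (isUnit_det_den p.1 p.2).ne_zero).smul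
    continuous_den_prod.matrix_adjugate

/-- The automorphy factor `det (c τ + d)`, normalized at the base point. -/
def denRatio : C(Sp ι × Siegel ι, {z : ℂ // z ≠ 0}) where
  toFun p := ⟨(den p.1.1 p.2.1).det / (den p.1.1 (baseSiegel ι).1).det,
    div_ne_zero (isUnit_det_den _ _).ne_zero (isUnit_det_den _ _).ne_zero⟩
  continuous_toFun := by
    refine Continuous.subtype_mk (Continuous.div continuous_den_prod.matrix_det ?_
      fun p => (isUnit_det_den _ _).ne_zero) _
    have h : Continuous fun p : Sp ι × Siegel ι => (p.1, baseSiegel ι) := by fun_prop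
    exact (continuous_den_prod.comp h).matrix_det

/-- The homotopy from a constant to `denRatio` given by the contraction of the Siegel space. -/
def denRatioHomotopy : C(unitInterval × (Sp ι × Siegel ι), {z : ℂ // z ≠ 0}) :=
  denRatio.comp ⟨fun p => (p.2.1, siegelSegment p.1 p.2.2), by
    have h : Continuous fun p : unitInterval × (Sp ι × Siegel ι) => (p.1, p.2.2) := by fun_prop
    exact (continuous_fst.comp continuous_snd).prodMk (continuous_siegelSegment.comp h)⟩

theorem denRatioHomotopy_zero (p : Sp ι × Siegel ι) : (denRatioHomotopy (0, p)).1 = 1 := by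
  change (den p.1.1 (siegelSegment 0 p.2).1).det / _ = 1
  rw [siegelSegment_zero]
  exact div_self (isUnit_det_den p.1 _).ne_zero

theorem denRatioHomotopy_one (p : Sp ι × Siegel ι) : denRatioHomotopy (1, p) = denRatio p := by
  change denRatio (p.1, siegelSegment 1 p.2) = _
  rw [siegelSegment_one]

/-- Contracting the Siegel space deforms the normalized factor to the constant `1`, and squaring is
a covering of the punctured plane. Lifting the homotopy from the constant root `1` gives a root
depending continuously on both variables. The normalization makes the start constant, so the
topology of `Sp(ℓ)` plays no role. -/
theorem exists_sqrt_denRatio (ι : Type*) [Fintype ι] [DecidableEq ι] :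
    ∃ L : C(Sp ι × Siegel ι, ℂ), ∀ p, L p ^ 2 = (denRatio p).1 := by
  have cov := isCoveringMap_npow (𝕜 := ℂ) 2 (by norm_num)
  have H0 : ∀ p : Sp ι × Siegel ι, denRatioHomotopy (0, p) =
      (fun x : {z : ℂ // z ≠ 0} => (⟨x ^ 2, pow_ne_zero 2 x.2⟩ : {z : ℂ // z ≠ 0}))
        (ContinuousMap.const (Sp ι × Siegel ι) (⟨1, one_ne_zero⟩ : {z : ℂ // z ≠ 0}) p) := by
    intro p
    apply Subtype.ext
    rw [denRatioHomotopy_zero]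
    simp
  refine ⟨⟨fun p => (cov.liftHomotopy denRatioHomotopy _ H0 (1, p)).1, by fun_prop⟩,
    fun p => ?_⟩
  rw [← denRatioHomotopy_one]
  exact congrArg Subtype.val (congrFun (cov.liftHomotopy_lifts denRatioHomotopy _ H0) (1, p))

/-- The square roots of `det (c τ + d) / det (c i + d)` which are `1` at the base point can be
chosen continuously in both variables. -/
theorem exists_rootRatio (ι : Type*) [Fintype ι] [DecidableEq ι] :
    ∃ ρ : Sp ι × Siegel ι → ℂ, Continuous ρ ∧ (∀ A, ρ (A, baseSiegel ι) = 1) ∧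
      ∀ A τ, ρ (A, τ) ^ 2 * (den A.1 (baseSiegel ι).1).det = (den A.1 τ.1).det := by
  obtain ⟨L, hL⟩ := exists_sqrt_denRatio ι
  have ne : ∀ p, L p ≠ 0 := fun p h => (denRatio p).2 (by rw [← hL, h]; simp)
  have h : Continuous fun p : Sp ι × Siegel ι => (p.1, baseSiegel ι) := by fun_prop
  -- At the base point `L` is a square root of `1`; dividing by this value does not change the
  -- square and makes the value there exactly `1`.
  refine ⟨fun p => L p / L (p.1, baseSiegel ι), L.continuous.div (L.continuous.comp h)
    fun p => ne _, fun A => div_self (ne _), fun A τ => ?_⟩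
  have hd : (den A.1 (baseSiegel ι).1).det ≠ 0 := (isUnit_det_den A _).ne_zero
  change (L (A, τ) / L (A, baseSiegel ι)) ^ 2 * _ = _
  rw [div_pow, hL, hL]
  change (_ / _) / (_ / _) * _ = _
  rw [div_self hd, div_one, div_mul_cancel₀ _ hd]

/-- The continuous square root of `det (c τ + d) / det (c i + d)` with value `1` at the base
point. -/
def rootRatio (p : Sp ι × Siegel ι) : ℂ := (exists_rootRatio ι).choose p

theorem continuous_rootRatio : Continuous (rootRatio : Sp ι × Siegel ι → ℂ) :=
  (exists_rootRatio ι).choose_spec.1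

theorem rootRatio_base (A : Sp ι) : rootRatio (A, baseSiegel ι) = 1 :=
  (exists_rootRatio ι).choose_spec.2.1 A

theorem rootRatio_sq (A : Sp ι) (τ : Siegel ι) :
    rootRatio (A, τ) ^ 2 * (den A.1 (baseSiegel ι).1).det = (den A.1 τ.1).det :=
  (exists_rootRatio ι).choose_spec.2.2 A τ

/-- The element `(A, f)` of the metaplectic group with `f (i · 1) = z`. -/
def Mp.mk' (A : Sp ι) (z : ℂ) (h : z ^ 2 = (den A.1 (baseSiegel ι).1).det) : Mp ι where
  mat := A
  root := ⟨fun τ => rootRatio (A, τ) * z,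
    (continuous_rootRatio.comp (by fun_prop : Continuous fun τ : Siegel ι => (A, τ))).mul
      continuous_const⟩
  root_sq τ := by
    change (rootRatio (A, τ) * z) ^ 2 = _
    rw [mul_pow, h, rootRatio_sq]

theorem Mp.mk'_root_base (A : Sp ι) (z : ℂ) (h : z ^ 2 = (den A.1 (baseSiegel ι).1).det) :
    (Mp.mk' A z h).root (baseSiegel ι) = z := by
  change rootRatio (A, _) * z = z
  rw [rootRatio_base, one_mul]

/-- This separates the variables: a function continuous in the matrix and `τ`, times the only value
that the topology of `Mp(ℓ)` sees. Joint continuity of `(g, τ) ↦ g.root τ` follows, which the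
product needs because it evaluates roots at moving points. -/
theorem Mp.root_eq (g : Mp ι) (τ : Siegel ι) :
    g.root τ = rootRatio (g.mat, τ) * g.root (baseSiegel ι) := by
  have h : g = Mp.mk' g.mat (g.root (baseSiegel ι)) (g.root_sq _) :=
    Mp.ext_base rfl (Mp.mk'_root_base _ _ _).symm
  exact congrArg (fun g : Mp ι => g.root τ) h

theorem Mp.isInducing : IsInducing fun g : Mp ι => (g.mat, g.root (baseSiegel ι)) := ⟨rfl⟩

theorem Mp.continuous_mat : Continuous (Mp.mat : Mp ι → Sp ι) :=
  continuous_fst.comp Mp.isInducing.continuous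

theorem Mp.continuous_root_base : Continuous fun g : Mp ι => g.root (baseSiegel ι) :=
  continuous_snd.comp Mp.isInducing.continuous

theorem Mp.continuous_root : Continuous fun p : Mp ι × Siegel ι => p.1.root p.2 := by
  simp_rw [fun p : Mp ι × Siegel ι => p.1.root_eq p.2]
  exact (continuous_rootRatio.comp (Mp.continuous_mat.prodMap continuous_id)).mul
    (Mp.continuous_root_base.comp continuous_fst)

theorem Mp.continuousOn_iff {X : Type*} [TopologicalSpace X] {f : X → Mp ι} {s : Set X} :
    ContinuousOn f s ↔ ContinuousOn (fun x => (f x).mat) s ∧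
      ContinuousOn (fun x => (f x).root (baseSiegel ι)) s := by
  rw [Mp.isInducing.continuousOn_iff]
  exact ⟨fun h => ⟨continuous_fst.comp_continuousOn h, continuous_snd.comp_continuousOn h⟩,
    fun h => h.1.prodMk h.2⟩

theorem Mp.continuous_iff {X : Type*} [TopologicalSpace X] {f : X → Mp ι} :
    Continuous f ↔ Continuous (fun x => (f x).mat) ∧
      Continuous (fun x => (f x).root (baseSiegel ι)) := by
  simp only [← continuousOn_univ, Mp.continuousOn_iff]

instance : IsTopologicalGroup (Sp ι) where
  continuous_inv := by
    refine Continuous.subtype_mk (f := fun A : Sp ι => (-J ι ℝ) * A.1ᵀ * J ι ℝ) ?_ _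
    fun_prop

theorem Mp.continuous_root_moebius {X : Type*} [TopologicalSpace X] {g : X → Mp ι} {A : X → Sp ι}
    (hg : Continuous g) (hA : Continuous A) :
    Continuous fun x => (g x).root (moebius (A x) (baseSiegel ι)) := by
  have h1 : Continuous fun x => (A x, baseSiegel ι) := hA.prodMk continuous_const
  have h2 := continuous_moebius_prod.comp h1
  exact Mp.continuous_root.comp (hg.prodMk h2)

instance : ContinuousMul (Mp ι) where
  continuous_mul := by
    have h1 : Continuous fun p : Mp ι × Mp ι => p.1.mat := Mp.continuous_mat.comp continuous_fst
    have h2 : Continuous fun p : Mp ι × Mp ι => p.2.mat := Mp.continuous_mat.comp continuous_snd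
    have h3 : Continuous fun p : Mp ι × Mp ι => p.2.root (baseSiegel ι) :=
      Mp.continuous_root_base.comp continuous_snd
    have h4 := (Mp.continuous_root_moebius continuous_fst h2).mul h3
    refine Mp.continuous_iff.2 ⟨?_, ?_⟩
    · simp only [Mp.mul_mat]
      exact h1.mul h2
    · simp only [Mp.mul_root]
      exact h4

instance : IsTopologicalGroup (Mp ι) where
  continuous_inv := Mp.continuous_iff.2 ⟨Mp.continuous_mat.inv,
    (Mp.continuous_root_moebius continuous_id Mp.continuous_mat.inv).inv₀
      fun g => g.root_ne_zero _⟩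

/-- The double cover `Mp(ℓ) → Sp(ℓ)` is surjective and has continuous local sections. -/
theorem Mp.exists_local_section (A₀ : Sp ι) : ∃ W : Set (Sp ι), IsOpen W ∧ A₀ ∈ W ∧
    ∃ l : Sp ι → Mp ι, (∀ A, (l A).mat = A) ∧ ContinuousOn l W := by
  have ne : ∀ A : Sp ι, (den A.1 (baseSiegel ι).1).det ≠ 0 :=
    fun A => (isUnit_det_den A _).ne_zero
  have hc : Continuous fun A : Sp ι => (den A.1 (baseSiegel ι).1).det / (den A₀.1 (baseSiegel ι).1).det :=
    ((continuous_den_prod.comp (by fun_prop : Continuous fun A : Sp ι =>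
      (A, baseSiegel ι))).matrix_det).div_const _
  -- On this neighbourhood of `A₀` the quotient of determinants avoids the cut, so its principal
  -- square root is continuous. Multiplied by a root `z` of the determinant at `A₀`, it becomes a
  -- root of the determinant at `A`.
  refine ⟨{A | (den A.1 (baseSiegel ι).1).det / (den A₀.1 (baseSiegel ι).1).det ∈
    Complex.slitPlane}, Complex.isOpen_slitPlane.preimage hc, ?_, ?_⟩
  · simp [div_self (ne A₀)]
  obtain ⟨z, hz⟩ := IsAlgClosed.exists_pow_nat_eq (den A₀.1 (baseSiegel ι).1).det two_pos
  refine ⟨fun A => Mp.mk' A (((den A.1 (baseSiegel ι).1).det /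
    (den A₀.1 (baseSiegel ι).1).det) ^ (1 / 2 : ℂ) * z) ?_, fun A => rfl, ?_⟩
  · rw [mul_pow, hz, ← Complex.cpow_nat_mul]
    simp [div_mul_cancel₀ _ (ne A₀)]
  · refine Mp.continuousOn_iff.2 ⟨continuousOn_id, ?_⟩
    simp_rw [Mp.mk'_root_base]
    exact (hc.continuousOn.cpow_const fun A hA => hA).mul continuousOn_const

end MetaplecticGroup

/-! ### The group `Mp₊(k, ℓ)` as a fibre product over `Sp(ℓ - k)` -/

section PlusGroup

variable {κ ι : Type*} [Fintype κ] [DecidableEq κ] [Fintype ι] [DecidableEq ι]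

theorem extendSiegel_base : extendSiegel κ (baseSiegel ι) = baseSiegel (κ ⊕ ι) :=
  Subtype.ext (by simp [extendSiegel, baseSiegel, ← fromBlocks_one, fromBlocks_smul])

/-- The lower right block of a point of the Siegel space. -/
def siegelCorner (τ : Siegel (κ ⊕ ι)) : Siegel ι :=
  ⟨τ.1.toBlocks₂₂, by
    have h := congrArg toBlocks₂₂ τ.2.1
    exact h, τ.2.2.submatrix Sum.inr_injective⟩

theorem siegelCorner_extendSiegel (τ : Siegel ι) : siegelCorner (extendSiegel κ τ) = τ :=
  Subtype.ext (by simp [siegelCorner, extendSiegel])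

theorem siegelCorner_base : siegelCorner (baseSiegel (κ ⊕ ι)) = baseSiegel ι := by
  rw [← extendSiegel_base, siegelCorner_extendSiegel]

theorem continuous_siegelCorner : Continuous (siegelCorner : Siegel (κ ⊕ ι) → Siegel ι) :=
  Continuous.subtype_mk (continuous_matrix fun _ _ =>
    (continuous_subtype_val : Continuous (Subtype.val : Siegel (κ ⊕ ι) → _)).matrix_elem _ _) _

theorem IsSpPlus.eq_fromBlocks {A : Sp (κ ⊕ ι)} (h : IsSpPlus A) : A.1 =
    fromBlocks (fromBlocks A.1.toBlocks₁₁.toBlocks₁₁ A.1.toBlocks₁₁.toBlocks₁₂ 0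
        A.1.toBlocks₁₁.toBlocks₂₂) A.1.toBlocks₁₂
      (fromBlocks 0 0 0 A.1.toBlocks₂₁.toBlocks₂₂)
      (fromBlocks A.1.toBlocks₂₂.toBlocks₁₁ 0 A.1.toBlocks₂₂.toBlocks₂₁
        A.1.toBlocks₂₂.toBlocks₂₂) := by
  conv_lhs => rw [← fromBlocks_toBlocks A.1, ← fromBlocks_toBlocks A.1.toBlocks₁₁,
    ← fromBlocks_toBlocks A.1.toBlocks₂₁, ← fromBlocks_toBlocks A.1.toBlocks₂₂,
    h.1, h.2.1, h.2.2.1, h.blocks.1, h.blocks.2.1]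

theorem isSpPlus_one : IsSpPlus (1 : Sp (κ ⊕ ι)) := by
  have h : (1 : Sp (κ ⊕ ι)).1 = fromBlocks (fromBlocks 1 0 0 1) 0 0 (fromBlocks 1 0 0 1) := by
    simp
  rw [IsSpPlus, h]
  refine ⟨?_, ?_, ?_, ?_⟩
  · simp only [toBlocks_fromBlocks₁₁, toBlocks_fromBlocks₂₁]
  · rfl
  · rfl
  · simp only [toBlocks_fromBlocks₁₁, det_one, zero_lt_one]

/-- Elements of `Sp₊(k, ℓ)` are block triangular for the flag `I ⊆ I^⊥ ⊆ E`, so their diagonal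
blocks multiply. The five existentially quantified blocks are never needed. -/
theorem IsSpPlus.mul_blocks {A B : Sp (κ ⊕ ι)} (hA : IsSpPlus A) (hB : IsSpPlus B) :
    ∃ a12 b11 b12 b21 d21, (A * B).1 = fromBlocks
      (fromBlocks (A.1.toBlocks₁₁.toBlocks₁₁ * B.1.toBlocks₁₁.toBlocks₁₁) a12 0
        (hA.normalMat * hB.normalMat).1.toBlocks₁₁)
      (fromBlocks b11 b12 b21 (hA.normalMat * hB.normalMat).1.toBlocks₁₂)
      (fromBlocks 0 0 0 (hA.normalMat * hB.normalMat).1.toBlocks₂₁)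
      (fromBlocks (A.1.toBlocks₂₂.toBlocks₁₁ * B.1.toBlocks₂₂.toBlocks₁₁) 0 d21
        (hA.normalMat * hB.normalMat).1.toBlocks₂₂) := by
  rw [Submonoid.coe_mul, Submonoid.coe_mul, hA.eq_fromBlocks, hB.eq_fromBlocks,
    ← fromBlocks_toBlocks A.1.toBlocks₁₂, ← fromBlocks_toBlocks B.1.toBlocks₁₂]
  simp only [normalMat, fromBlocks_multiply, fromBlocks_add, toBlocks_fromBlocks₁₁,
    toBlocks_fromBlocks₁₂, toBlocks_fromBlocks₂₁, toBlocks_fromBlocks₂₂, Matrix.zero_mul,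
    Matrix.mul_zero, add_zero, zero_add]
  exact ⟨_, _, _, _, _, rfl⟩

theorem IsSpPlus.mul {A B : Sp (κ ⊕ ι)} (hA : IsSpPlus A) (hB : IsSpPlus B) :
    IsSpPlus (A * B) := by
  obtain ⟨a12, b11, b12, b21, d21, h⟩ := hA.mul_blocks hB
  rw [IsSpPlus, h]
  simp only [toBlocks_fromBlocks₁₁, toBlocks_fromBlocks₂₁, det_mul, true_and]
  exact mul_pos hA.2.2.2 hB.2.2.2

theorem IsSpPlus.normalMat_mul {A B : Sp (κ ⊕ ι)} (hA : IsSpPlus A) (hB : IsSpPlus B) :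
    (hA.mul hB).normalMat = hA.normalMat * hB.normalMat := by
  apply Subtype.ext
  obtain ⟨a12, b11, b12, b21, d21, h⟩ := hA.mul_blocks hB
  simp only [normalMat] at h ⊢
  simp only [h, toBlocks_fromBlocks₁₁, toBlocks_fromBlocks₁₂, toBlocks_fromBlocks₂₁,
    toBlocks_fromBlocks₂₂, fromBlocks_toBlocks]

theorem IsSpPlus.det_mul {A B : Sp (κ ⊕ ι)} (hA : IsSpPlus A) (hB : IsSpPlus B) :
    (A * B).1.toBlocks₁₁.toBlocks₁₁.det =
      A.1.toBlocks₁₁.toBlocks₁₁.det * B.1.toBlocks₁₁.toBlocks₁₁.det := by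
  obtain ⟨a12, b11, b12, b21, d21, h⟩ := hA.mul_blocks hB
  rw [h]
  simp only [toBlocks_fromBlocks₁₁, Matrix.det_mul]

/-- The inverse has blocks `dᵀ, -bᵀ, -cᵀ, aᵀ`. Its required zeros are transposes of zero blocks of
`A`, two of which come from the symplectic relations in `IsSpPlus.blocks`, and positivity follows
from `det a₁₁ * det d₁₁ = 1`. -/
theorem IsSpPlus.inv {A : Sp (κ ⊕ ι)} (hA : IsSpPlus A) : IsSpPlus A⁻¹ := by
  obtain ⟨hc, hd, hdet, -⟩ := hA.blocks
  have e : (A⁻¹).1 = fromBlocks A.1.toBlocks₂₂ᵀ (-A.1.toBlocks₁₂ᵀ) (-A.1.toBlocks₂₁ᵀ)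
      A.1.toBlocks₁₁ᵀ := by
    rw [SymplecticGroup.coe_inv]
    conv_lhs => rw [← fromBlocks_toBlocks A.1]
    simp [J, fromBlocks_transpose, fromBlocks_multiply, fromBlocks_neg]
  rw [IsSpPlus, e]
  simp only [toBlocks_fromBlocks₁₁, toBlocks_fromBlocks₂₁]
  refine ⟨congrArg transpose hd, ?_, ?_, ?_⟩
  · exact (congrArg (fun M => -Mᵀ) hA.2.1).trans (by simp)
  · exact (congrArg (fun M => -Mᵀ) hc).trans (by simp)
  · have h : A.1.toBlocks₂₂ᵀ.toBlocks₁₁.det = A.1.toBlocks₂₂.toBlocks₁₁.det :=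
      det_transpose A.1.toBlocks₂₂.toBlocks₁₁
    rw [h]
    exact (pos_iff_pos_of_mul_pos (hdet ▸ zero_lt_one)).1 hA.2.2.2

/-- The block `c` has only its lower right corner and `d₁₂ = 0`, so `τ` enters the diagonal blocks
of `c τ + d` only through its own corner. Consequently the determinant, and with it the root,
depends on the corner alone at every point of the Siegel space, not only at the points `diag (i · 1,
τ)`. -/
theorem IsSpPlus.den_eq {A : Sp (κ ⊕ ι)} (h : IsSpPlus A) (τ : Siegel (κ ⊕ ι)) :
    ∃ d21, den A.1 τ.1 = fromBlocks (A.1.toBlocks₂₂.toBlocks₁₁.map Complex.ofReal) 0 d21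
      (den h.normalMat.1 (siegelCorner τ).1) := by
  refine ⟨A.1.toBlocks₂₁.toBlocks₂₂.map Complex.ofReal * τ.1.toBlocks₂₁ +
    A.1.toBlocks₂₂.toBlocks₂₁.map Complex.ofReal, ?_⟩
  rw [den]
  conv_lhs => rw [h.eq_fromBlocks, ← fromBlocks_toBlocks τ.1]
  simp only [toBlocks_fromBlocks₂₁, toBlocks_fromBlocks₂₂, fromBlocks_map, fromBlocks_multiply,
    fromBlocks_add, den, normalMat, siegelCorner, Matrix.map_zero _ Complex.ofReal_zero,
    Matrix.zero_mul, add_zero, zero_add]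

theorem IsSpPlus.det_mul_det_den {A : Sp (κ ⊕ ι)} (h : IsSpPlus A) (τ : Siegel (κ ⊕ ι)) :
    (A.1.toBlocks₁₁.toBlocks₁₁.det : ℂ) * (den A.1 τ.1).det =
      (den h.normalMat.1 (siegelCorner τ).1).det := by
  obtain ⟨d21, e⟩ := h.den_eq τ
  have e2 : (A.1.toBlocks₂₂.toBlocks₁₁.map Complex.ofReal).det =
      (A.1.toBlocks₂₂.toBlocks₁₁.det : ℂ) := (RingHom.map_det Complex.ofRealHom _).symm
  rw [e, det_fromBlocks_zero₁₂, e2, ← mul_assoc, ← Complex.ofReal_mul, h.blocks.2.2.1]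
  simp

/-- Compare the lower right blocks in `(A τ) (c τ + d) = a τ + b`. Since `c τ + d` is block lower
triangular, only the corner of `A τ` survives on the left. -/
theorem IsSpPlus.corner_moebius {A : Sp (κ ⊕ ι)} (h : IsSpPlus A) (τ : Siegel (κ ⊕ ι)) :
    siegelCorner (moebius A τ) = moebius h.normalMat (siegelCorner τ) := by
  apply Subtype.ext
  have hu := isUnit_det_den h.normalMat (siegelCorner τ)
  have e1 := moebius_mul_den A τ
  obtain ⟨d21, e⟩ := h.den_eq τ
  rw [e, ← fromBlocks_toBlocks (moebius A τ).1, fromBlocks_multiply, num,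
    h.eq_fromBlocks] at e1
  replace e1 := congrArg toBlocks₂₂ e1
  rw [← fromBlocks_toBlocks τ.1, ← fromBlocks_toBlocks A.1.toBlocks₁₂] at e1
  simp only [toBlocks_fromBlocks₂₂, toBlocks_fromBlocks₁₁, toBlocks_fromBlocks₁₂, fromBlocks_map,
    fromBlocks_multiply, fromBlocks_add, Matrix.map_zero _ Complex.ofReal_zero,
    Matrix.zero_mul, Matrix.mul_zero, zero_add] at e1
  have e2 : (moebius A τ).1.toBlocks₂₂ * den h.normalMat.1 (siegelCorner τ).1 =
      num h.normalMat.1 (siegelCorner τ).1 := e1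
  change (moebius A τ).1.toBlocks₂₂ = num h.normalMat.1 _ * (den h.normalMat.1 _)⁻¹
  rw [← e2, mul_nonsing_inv_cancel_right _ _ hu]

/-- The element of `Mp₊(k, ℓ)` with given images in `Sp₊(k, ℓ)` and `Mp(ℓ - k)`. -/
def Mp.ofNormal {A : Sp (κ ⊕ ι)} (hA : IsSpPlus A) (h : Mp ι) (hm : h.mat = hA.normalMat) :
    Mp (κ ⊕ ι) where
  mat := A
  root := ⟨fun τ => (Real.sqrt A.1.toBlocks₁₁.toBlocks₁₁.det : ℂ)⁻¹ * h.root (siegelCorner τ),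
    continuous_const.mul (h.root.continuous.comp continuous_siegelCorner)⟩
  root_sq τ := by
    change ((Real.sqrt A.1.toBlocks₁₁.toBlocks₁₁.det : ℂ)⁻¹ * h.root (siegelCorner τ)) ^ 2 = _
    have h0 : (A.1.toBlocks₁₁.toBlocks₁₁.det : ℂ) ≠ 0 := by exact_mod_cast hA.2.2.2.ne'
    rw [mul_pow, h.root_sq, inv_pow, ← Complex.ofReal_pow, Real.sq_sqrt hA.2.2.2.le, hm,
      ← hA.det_mul_det_den, inv_mul_cancel_left₀ h0]

theorem Mp.normalPart_ofNormal {A : Sp (κ ⊕ ι)} (hA : IsSpPlus A) (h : Mp ι)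
    (hm : h.mat = hA.normalMat) : (Mp.ofNormal hA h hm).normalPart hA = h := by
  refine Mp.ext hm.symm (ContinuousMap.ext fun τ => ?_)
  change (Real.sqrt A.1.toBlocks₁₁.toBlocks₁₁.det : ℂ) *
    ((Real.sqrt A.1.toBlocks₁₁.toBlocks₁₁.det : ℂ)⁻¹ * h.root (siegelCorner _)) = _
  have h0 : (Real.sqrt A.1.toBlocks₁₁.toBlocks₁₁.det : ℂ) ≠ 0 := by
    exact_mod_cast (Real.sqrt_pos.2 hA.2.2.2).ne'
  rw [mul_inv_cancel_left₀ h0, siegelCorner_extendSiegel]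

theorem Mp.normalPart_root_base (g : Mp (κ ⊕ ι)) (hg : IsSpPlus g.mat) :
    (g.normalPart hg).root (baseSiegel ι) =
      (Real.sqrt g.mat.1.toBlocks₁₁.toBlocks₁₁.det : ℂ) * g.root (baseSiegel (κ ⊕ ι)) := by
  change _ * g.root (extendSiegel κ (baseSiegel ι)) = _
  rw [extendSiegel_base]

theorem Mp.ofReal_sqrt_det_ne_zero {A : Sp (κ ⊕ ι)} (hA : IsSpPlus A) :
    (Real.sqrt A.1.toBlocks₁₁.toBlocks₁₁.det : ℂ) ≠ 0 := by
  exact_mod_cast (Real.sqrt_pos.2 hA.2.2.2).ne'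

/-- At the base point the root of the normal part is the root of `g` times a nonzero factor that
depends only on the matrix. -/
theorem Mp.ext_normalPart {g g' : Mp (κ ⊕ ι)} (hg : IsSpPlus g.mat) (hg' : IsSpPlus g'.mat)
    (hm : g.mat = g'.mat) (hn : g.normalPart hg = g'.normalPart hg') : g = g' := by
  refine Mp.ext_base hm ?_
  have h := congrArg (fun n : Mp ι => n.root (baseSiegel ι)) hn
  simp only [Mp.normalPart_root_base, hm] at h
  exact mul_left_cancel₀ (ofReal_sqrt_det_ne_zero hg') h

/-- The definition of the normal part evaluates the root only on the slice `diag (i · 1, τ)`. By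
uniqueness `g` is the element `Mp.ofNormal` built from its normal part, whose root is known
everywhere. -/
theorem Mp.root_eq_normalPart (g : Mp (κ ⊕ ι)) (hg : IsSpPlus g.mat) (τ : Siegel (κ ⊕ ι)) :
    (Real.sqrt g.mat.1.toBlocks₁₁.toBlocks₁₁.det : ℂ) * g.root τ =
      (g.normalPart hg).root (siegelCorner τ) := by
  have h : g = Mp.ofNormal hg (g.normalPart hg) rfl :=
    Mp.ext_normalPart hg hg rfl (Mp.normalPart_ofNormal hg _ rfl).symm
  have h' := congrArg (fun g' : Mp (κ ⊕ ι) =>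
    (Real.sqrt g.mat.1.toBlocks₁₁.toBlocks₁₁.det : ℂ) * g'.root τ) h
  exact h'.trans (mul_inv_cancel_left₀ (ofReal_sqrt_det_ne_zero hg) _)

theorem Mp.normalPart_mul {g g' : Mp (κ ⊕ ι)} (hg : IsSpPlus g.mat) (hg' : IsSpPlus g'.mat) :
    (g * g').normalPart (hg.mul hg') = g.normalPart hg * g'.normalPart hg' := by
  refine Mp.ext_base (hg.normalMat_mul hg') ?_
  have h : Real.sqrt (g.mat * g'.mat).1.toBlocks₁₁.toBlocks₁₁.det =
      Real.sqrt g.mat.1.toBlocks₁₁.toBlocks₁₁.det *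
        Real.sqrt g'.mat.1.toBlocks₁₁.toBlocks₁₁.det := by
    rw [hg.det_mul hg', Real.sqrt_mul hg.2.2.2.le]
  rw [Mp.normalPart_root_base, Mp.mul_root, Mp.mul_root, Mp.normalPart_root_base g' hg', Mp.mul_mat,
    h]
  -- The base point moved by `g'` need not lie on the slice `diag (i · 1, τ)`; its corner is the
  -- base point moved by the normal part of `g'`.
  have e := g.root_eq_normalPart hg (moebius g'.mat (baseSiegel (κ ⊕ ι)))
  rw [hg'.corner_moebius, siegelCorner_base] at e
  have e' : (g'.normalPart hg').mat = hg'.normalMat := rfl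
  rw [e', ← e, Complex.ofReal_mul]
  ring

variable (κ ι) in
/-- The group `Mp₊(k, ℓ)`. -/
def MpPlus : Subgroup (Mp (κ ⊕ ι)) where
  carrier := {g | IsSpPlus g.mat}
  mul_mem' := IsSpPlus.mul
  one_mem' := isSpPlus_one
  inv_mem' := IsSpPlus.inv

/-- The homomorphism `Mp₊(k, ℓ) → Mp(ℓ - k)`. -/
def normalHom : MpPlus κ ι →* Mp ι :=
  MonoidHom.mk' (fun g => g.1.normalPart g.2) fun g g' => Mp.normalPart_mul g.2 g'.2

theorem normalHom_root_base (g : MpPlus κ ι) : (normalHom g).root (baseSiegel ι) =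
    (Real.sqrt g.1.mat.1.toBlocks₁₁.toBlocks₁₁.det : ℂ) * g.1.root (baseSiegel (κ ⊕ ι)) :=
  Mp.normalPart_root_base g.1 g.2

theorem normalHom_ext {g g' : MpPlus κ ι} (hm : g.1.mat = g'.1.mat)
    (hn : normalHom g = normalHom g') : g = g' :=
  Subtype.ext (Mp.ext_normalPart g.2 g'.2 hm hn)

theorem continuous_det_block : Continuous fun g : MpPlus κ ι =>
    (Real.sqrt g.1.mat.1.toBlocks₁₁.toBlocks₁₁.det : ℂ) := by
  have h : Continuous fun g : MpPlus κ ι => g.1.mat :=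
    Mp.continuous_mat.comp continuous_subtype_val
  refine Complex.continuous_ofReal.comp (Real.continuous_sqrt.comp (Continuous.matrix_det ?_))
  exact continuous_matrix fun _ _ => h.subtype_val.matrix_elem _ _

theorem continuous_normalHom : Continuous (normalHom : MpPlus κ ι → Mp ι) := by
  have h : Continuous fun g : MpPlus κ ι => g.1.mat :=
    Mp.continuous_mat.comp continuous_subtype_val
  refine Mp.continuous_iff.2 ⟨?_, ?_⟩
  · refine Continuous.subtype_mk (Continuous.matrix_fromBlocks ?_ ?_ ?_ ?_) _ <;>
    exact continuous_matrix fun _ _ => h.subtype_val.matrix_elem _ _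
  · simp only [normalHom_root_base]
    exact continuous_det_block.mul (Mp.continuous_root_base.comp continuous_subtype_val)

/-- The topology of `Mp₊(k, ℓ)` is induced from `Sp(ℓ)` and `Mp(ℓ - k)`. -/
theorem MpPlus.continuous_of {X : Type*} [TopologicalSpace X] {f : X → MpPlus κ ι}
    (hm : Continuous fun x => (f x).1.mat) (hn : Continuous fun x => normalHom (f x)) :
    Continuous f := by
  refine Continuous.subtype_mk (f := fun x => (f x).1) (Mp.continuous_iff.2 ⟨hm, ?_⟩) _
  -- The missing coordinate of the topology of `Mp(ℓ)` is recovered from the normal part by dividing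
  -- by `√(det A₁₁)`, which is continuous and nonzero.
  have e : ∀ x, (f x).1.root (baseSiegel (κ ⊕ ι)) =
      (Real.sqrt (f x).1.mat.1.toBlocks₁₁.toBlocks₁₁.det : ℂ)⁻¹ *
        (normalHom (f x)).root (baseSiegel ι) := by
    intro x
    rw [normalHom_root_base, inv_mul_cancel_left₀ (Mp.ofReal_sqrt_det_ne_zero (f x).2)]
  simp only [e]
  refine Continuous.mul (Continuous.inv₀ ?_ fun x => Mp.ofReal_sqrt_det_ne_zero (f x).2)
    (Mp.continuous_root_base.comp hn)
  refine Complex.continuous_ofReal.comp (Real.continuous_sqrt.comp (Continuous.matrix_det ?_))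
  exact continuous_matrix fun _ _ => hm.subtype_val.matrix_elem _ _

/-- Together with `normalHom_ext` and `MpPlus.continuous_of`, this identifies `Mp₊(k, ℓ)`
topologically with the fibre product of `Sp₊(k, ℓ)` and `Mp(ℓ - k)` over `Sp(ℓ - k)`. -/
theorem MpPlus.exists_of {A : Sp (κ ⊕ ι)} (hA : IsSpPlus A) (h : Mp ι)
    (hm : h.mat = hA.normalMat) : ∃ g : MpPlus κ ι, g.1.mat = A ∧ normalHom g = h :=
  ⟨⟨Mp.ofNormal hA h hm, hA⟩, rfl, Mp.normalPart_ofNormal hA h hm⟩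

variable (κ) in
/-- The embedding `B ↦ diag (1, B)` of `Sp(ℓ - k)` into `Sp(ℓ)`. -/
def spEmbed (B : Sp ι) : Sp (κ ⊕ ι) :=
  ⟨fromBlocks (fromBlocks 1 0 0 B.1.toBlocks₁₁) (fromBlocks 0 0 0 B.1.toBlocks₁₂)
    (fromBlocks 0 0 0 B.1.toBlocks₂₁) (fromBlocks 1 0 0 B.1.toBlocks₂₂), by
    have h := B.2
    rw [← fromBlocks_toBlocks B.1, SymplecticGroup.fromBlocks_mem_iff] at h
    rw [SymplecticGroup.fromBlocks_mem_iff]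
    simp only [fromBlocks_transpose, fromBlocks_multiply, transpose_zero, transpose_one,
      Matrix.zero_mul, Matrix.mul_zero, add_zero, zero_add, Matrix.one_mul, fromBlocks_inj,
      sub_eq_add_neg, fromBlocks_neg, fromBlocks_add, neg_zero, true_and, ← fromBlocks_one]
    simpa only [sub_eq_add_neg] using h⟩

theorem spEmbed_isSpPlus (B : Sp ι) : IsSpPlus (spEmbed κ B) := by
  simp only [IsSpPlus, spEmbed, toBlocks_fromBlocks₁₁, toBlocks_fromBlocks₂₁, det_one,
    zero_lt_one, true_and]

theorem spEmbed_normalMat (B : Sp ι) : (spEmbed_isSpPlus (κ := κ) B).normalMat = B := by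
  apply Subtype.ext
  simp only [IsSpPlus.normalMat, spEmbed, toBlocks_fromBlocks₁₁, toBlocks_fromBlocks₁₂,
    toBlocks_fromBlocks₂₁, toBlocks_fromBlocks₂₂, fromBlocks_toBlocks]

theorem continuous_spEmbed : Continuous (spEmbed κ : Sp ι → Sp (κ ⊕ ι)) := by
  refine Continuous.subtype_mk ?_ _
  refine Continuous.matrix_fromBlocks ?_ ?_ ?_ ?_ <;>
    refine Continuous.matrix_fromBlocks (by fun_prop) (by fun_prop) (by fun_prop) ?_ <;>
    exact continuous_matrix fun _ _ =>
      (continuous_subtype_val : Continuous (Subtype.val : Sp ι → _)).matrix_elem _ _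

variable (κ) in
/-- The lift of `B ↦ diag (1, B)` to the metaplectic groups. -/
def mpEmbed (h : Mp ι) : MpPlus κ ι :=
  ⟨Mp.ofNormal (spEmbed_isSpPlus h.mat) h (spEmbed_normalMat h.mat).symm, spEmbed_isSpPlus h.mat⟩

/-- A continuous global section of `normalHom`. It serves to lift continuous maps and to define
actions on quotients; that it is multiplicative is never used. -/
theorem normalHom_mpEmbed (h : Mp ι) : normalHom (mpEmbed κ h) = h :=
  Mp.normalPart_ofNormal _ h (spEmbed_normalMat h.mat).symm

theorem continuous_mpEmbed : Continuous (mpEmbed κ : Mp ι → MpPlus κ ι) := by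
  refine MpPlus.continuous_of ?_ ?_
  · exact continuous_spEmbed.comp Mp.continuous_mat
  · simp only [normalHom_mpEmbed]
    exact continuous_id

end PlusGroup

/-! ### Principal bundles: sections, action and division -/

section Principal

theorem continuous_of_local {X Y : Type*} [TopologicalSpace X] [TopologicalSpace Y] {f : X → Y}
    (h : ∀ x, ∃ U : Set X, IsOpen U ∧ x ∈ U ∧ Continuous fun u : U => f u) : Continuous f := by
  refine continuous_iff_continuousAt.2 fun x => ?_
  obtain ⟨U, hU, hx, hc⟩ := h x
  exact (continuousOn_iff_continuous_domRestrict.2 hc).continuousAt (hU.mem_nhds hx)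

variable {N G P X : Type*} [TopologicalSpace N] [Group G] [TopologicalSpace G]
  [TopologicalSpace P] [MulAction Gᵐᵒᵖ P] {proj : P → N}
  [TopologicalSpace X]

open MulOpposite

namespace IsPrincipalBundle

theorem proj_smul (h : IsPrincipalBundle G proj) (g : G) (p : P) :
    proj (op g • p) = proj p := by
  obtain ⟨U, -, hx, φ, h1, h2⟩ := h.locallyTrivial (proj p)
  obtain ⟨⟨u, k⟩, hu⟩ := φ.surjective ⟨p, hx⟩
  have hp : (φ (u, k)).1 = p := congrArg Subtype.val hu
  rw [← hp, ← h2, h1, h1]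

theorem eq_one_of_smul_eq (h : IsPrincipalBundle G proj) {g : G} {p : P} (hg : op g • p = p) :
    g = 1 := by
  obtain ⟨U, -, hx, φ, h1, h2⟩ := h.locallyTrivial (proj p)
  obtain ⟨⟨u, k⟩, hu⟩ := φ.surjective ⟨p, hx⟩
  have hp : (φ (u, k)).1 = p := congrArg Subtype.val hu
  rw [← hp, ← h2] at hg
  have := congrArg Prod.snd (φ.injective (Subtype.ext hg))
  exact mul_eq_left.1 this

theorem smul_left_cancel (h : IsPrincipalBundle G proj) {g g' : G} {p : P}
    (hg : op g • p = op g' • p) : g = g' := by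
  have : op (g * g'⁻¹) • p = p := by
    rw [op_mul, mul_smul, hg, ← mul_smul, ← op_mul, mul_inv_cancel, op_one, one_smul]
  exact mul_inv_eq_one.1 (h.eq_one_of_smul_eq this)

theorem exists_smul (h : IsPrincipalBundle G proj) {p p' : P} (hp : proj p = proj p') :
    ∃ g : G, p' = op g • p := by
  obtain ⟨U, -, hx, φ, h1, h2⟩ := h.locallyTrivial (proj p)
  obtain ⟨⟨u, k⟩, hu⟩ := φ.surjective ⟨p, hx⟩
  obtain ⟨⟨u', k'⟩, hu'⟩ := φ.surjective ⟨p', by rw [Set.mem_preimage, ← hp]; exact hx⟩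
  have e : (φ (u, k)).1 = p := congrArg Subtype.val hu
  have e' : (φ (u', k')).1 = p' := congrArg Subtype.val hu'
  have huu : u = u' := Subtype.ext (by rw [← h1 u k, ← h1 u' k', e, e', hp])
  subst huu
  exact ⟨k⁻¹ * k', by rw [← e, ← e', ← h2, mul_inv_cancel_left]⟩

theorem exists_local_section (h : IsPrincipalBundle G proj) (x₀ : N) :
    ∃ U : Set N, IsOpen U ∧ x₀ ∈ U ∧ ∃ σ : N → P, (∀ x, proj (σ x) = x) ∧ ContinuousOn σ U := by
  have hs : ∀ x, ∃ p, proj p = x := fun x => by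
    obtain ⟨U, -, hx, φ, h1, -⟩ := h.locallyTrivial x
    exact ⟨_, h1 ⟨x, hx⟩ 1⟩
  obtain ⟨U, hU, hx, φ, h1, h2⟩ := h.locallyTrivial x₀
  classical
  -- Outside `U` arbitrary points of the fibres are chosen. The section is then defined over all of
  -- the base, and continuity is claimed on `U` only.
  refine ⟨U, hU, hx, fun x => if hx : x ∈ U then (φ (⟨x, hx⟩, 1)).1 else (hs x).choose,
    fun x => ?_, continuousOn_iff_continuous_domRestrict.2 ?_⟩
  · by_cases hx : x ∈ U
    · simp only [hx, dif_pos, h1]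
    · simp only [hx, dif_neg, not_false_iff, (hs x).choose_spec]
  · have : Continuous fun x : U => (φ (x, 1)).1 := by fun_prop
    refine this.congr fun x => ?_
    simp [Set.domRestrict]

/-- The trivialization is `(u, g) ↦ σ(u) g` with inverse `p ↦ (proj p, d p)`. Continuity of the
action is required only along the section, so for a quotient space no product of a quotient map with
the group has to be considered. -/
theorem of_local_sections (hproj : Continuous proj) (hsmul : ∀ (g : G) p, proj (op g • p) = proj p)
    (hfree : ∀ (g : G) (p : P), op g • p = p → g = 1)
    (hloc : ∀ x₀, ∃ U : Set N, IsOpen U ∧ x₀ ∈ U ∧ ∃ (σ : N → P) (d : P → G),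
      (∀ x, proj (σ x) = x) ∧ (∀ p, p = op (d p) • σ (proj p)) ∧ ContinuousOn d (proj ⁻¹' U) ∧
        Continuous fun q : U × G => op q.2 • σ q.1) :
    IsPrincipalBundle G proj where
  continuous := hproj
  locallyTrivial x₀ := by
    obtain ⟨U, hU, hx, σ, d, h1, h2, hd, hc⟩ := hloc x₀
    have hm : ∀ q : U × G, op q.2 • σ q.1 ∈ proj ⁻¹' U := fun q => by
      rw [Set.mem_preimage, hsmul, h1]
      exact q.1.2
    refine ⟨U, hU, hx, ⟨⟨fun q => ⟨op q.2 • σ q.1, hm q⟩, fun p => (⟨proj p, p.2⟩, d p), ?_, ?_⟩,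
      hc.subtype_mk _, ?_⟩, fun u g => ?_, fun u g k => ?_⟩
    · rintro ⟨u, g⟩
      have hp : proj (op g • σ u) = u := by rw [hsmul, h1]
      refine Prod.ext (Subtype.ext hp) ?_
      have e := h2 (op g • σ u)
      rw [hp] at e
      have : op (g * (d (op g • σ u))⁻¹) • σ u = σ u := by
        rw [op_mul, mul_smul, e]
        simp only [← mul_smul, ← op_mul]
        rw [← e, mul_inv_cancel, op_one, one_smul]
      exact (mul_inv_eq_one.1 (hfree _ _ this)).symm
    · rintro ⟨p, hp⟩
      exact Subtype.ext (h2 p).symm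
    · exact ((hproj.comp continuous_subtype_val).subtype_mk _).prodMk
        (continuousOn_iff_continuous_domRestrict.1 hd)
    · exact (hsmul _ _).trans (h1 _)
    · change op (g * k) • σ u = op k • op g • σ u
      rw [op_mul, mul_smul]

variable [IsTopologicalGroup G]

/-- Continuity of the action is not part of the definition of a principal bundle; a local
trivialization turns the action into right multiplication in `G`. -/
theorem continuous_smul (h : IsPrincipalBundle G proj) {f : X → P} {g : X → G}
    (hf : Continuous f) (hg : Continuous g) : Continuous fun x => op (g x) • f x := by
  refine continuous_of_local fun x => ?_
  obtain ⟨U, hU, hx, φ, h1, h2⟩ := h.locallyTrivial (proj (f x))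
  refine ⟨(proj ∘ f) ⁻¹' U, hU.preimage (h.continuous.comp hf), hx, ?_⟩
  have hc : Continuous fun v : ↥((proj ∘ f) ⁻¹' U) => φ.symm ⟨f v, v.2⟩ :=
    φ.symm.continuous.comp ((hf.comp continuous_subtype_val).subtype_mk _)
  have hc2 : Continuous fun v : ↥((proj ∘ f) ⁻¹' U) =>
      (φ ((φ.symm ⟨f v, v.2⟩).1, (φ.symm ⟨f v, v.2⟩).2 * g v)).1 :=
    continuous_subtype_val.comp (φ.continuous.comp (hc.fst.prodMk
      (hc.snd.mul (hg.comp continuous_subtype_val))))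
  refine hc2.congr fun v => ?_
  rw [h2]
  simp only [Prod.mk.eta, Homeomorph.apply_symm_apply]

/-- If `f` and `f'` have group coordinates `a` and `a'` in a local trivialization, then `g = a⁻¹
a'`. -/
theorem continuous_div (h : IsPrincipalBundle G proj) {f f' : X → P} {g : X → G}
    (hf : Continuous f) (hf' : Continuous f') (he : ∀ x, f' x = op (g x) • f x) :
    Continuous g := by
  refine continuous_of_local fun x => ?_
  obtain ⟨U, hU, hx, φ, h1, h2⟩ := h.locallyTrivial (proj (f x))
  refine ⟨(proj ∘ f) ⁻¹' U, hU.preimage (h.continuous.comp hf), hx, ?_⟩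
  have hm : ∀ v : ↥((proj ∘ f) ⁻¹' U), f' v ∈ proj ⁻¹' U := fun v => by
    rw [he, Set.mem_preimage, h.proj_smul]
    exact v.2
  have hc : Continuous fun v : ↥((proj ∘ f) ⁻¹' U) => φ.symm ⟨f v, v.2⟩ :=
    φ.symm.continuous.comp ((hf.comp continuous_subtype_val).subtype_mk _)
  have hc' : Continuous fun v : ↥((proj ∘ f) ⁻¹' U) => φ.symm ⟨f' v, hm v⟩ :=
    φ.symm.continuous.comp ((hf'.comp continuous_subtype_val).subtype_mk _)
  refine (hc.snd.inv.mul hc'.snd).congr fun v => ?_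
  change (φ.symm ⟨f v, v.2⟩).2⁻¹ * (φ.symm ⟨f' v, hm v⟩).2 = g v
  have e : φ.symm ⟨f' v, hm v⟩ = ((φ.symm ⟨f v, v.2⟩).1, (φ.symm ⟨f v, v.2⟩).2 * g v) := by
    rw [Homeomorph.symm_apply_eq]
    apply Subtype.ext
    rw [h2]
    simp only [Prod.mk.eta, Homeomorph.apply_symm_apply, he]
  rw [e, inv_mul_cancel_left]

end IsPrincipalBundle

end Principal

/-! ### The torsor of symplectic frames of one vector space -/

section SymplecticFrames

set_option linter.unusedSectionVars false

variable {κ ι : Type*} [Fintype κ] [DecidableEq κ] [Fintype ι] [DecidableEq ι]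
  {V : Type*} [AddCommGroup V] [Module ℝ V] {B : LinearMap.BilinForm ℝ V}

namespace SymplecticFrame

theorem ext_basis {b b' : SymplecticFrame ι B} (h : ∀ j, b.basis j = b'.basis j) : b = b' := by
  obtain ⟨b, hb⟩ := b
  obtain ⟨b', hb'⟩ := b'
  obtain rfl : b = b' := Module.Basis.eq_of_apply_eq h
  rfl

theorem act_basis (b : SymplecticFrame ι B) (A : Sp ι) (j : ι ⊕ ι) :
    (b.act A).basis j = ∑ i, A.1 i j • b.basis i :=
  basis_toLinearEquiv_apply b.basis A j

theorem act_one (b : SymplecticFrame ι B) : b.act 1 = b :=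
  ext_basis fun j => by simp [act_basis, one_apply]

theorem act_mul (b : SymplecticFrame ι B) (A A' : Sp ι) : b.act (A * A') = (b.act A).act A' :=
  ext_basis fun j => by
    simp only [act_basis, Submonoid.coe_mul, mul_apply, Finset.sum_smul, Finset.smul_sum, smul_smul]
    rw [Finset.sum_comm]
    refine Finset.sum_congr rfl fun i _ => Finset.sum_congr rfl fun i' _ => ?_
    rw [mul_comm]

/-- The Gram matrix of a frame against its translate is `-J A`, and `J² = -1`. Continuity of a
change of frame thus reduces to continuity of the form, which also works where no local
trivialization is at hand. -/
theorem coe_eq_mul_gram (b : SymplecticFrame ι B) (A : Sp ι) :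
    A.1 = J ι ℝ * Matrix.of fun i j => B (b.basis i) ((b.act A).basis j) := by
  have h : (Matrix.of fun i j => B (b.basis i) ((b.act A).basis j)) = -(J ι ℝ * A.1) := by
    ext i j
    rw [Matrix.neg_apply, mul_apply, ← Finset.sum_neg_distrib]
    simp only [of_apply, act_basis, map_sum, map_smul, b.rel, smul_eq_mul]
    exact Finset.sum_congr rfl fun k _ => by ring
  rw [h, Matrix.mul_neg, ← Matrix.mul_assoc, J_squared]
  simp

theorem act_injective (b : SymplecticFrame ι B) {A A' : Sp ι} (h : b.act A = b.act A') :
    A = A' :=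
  Subtype.ext (by rw [b.coe_eq_mul_gram A, b.coe_eq_mul_gram A', h])

theorem exists_act (b b' : SymplecticFrame ι B) : ∃ A : Sp ι, b' = b.act A := by
  have hj : ∀ j, b'.basis j = ∑ i, b.basis.repr (b'.basis j) i • b.basis i :=
    fun j => (b.basis.sum_repr _).symm
  -- The coordinates of `b'` with respect to `b` form a symplectic matrix because both frames have
  -- Gram matrix `-J`.
  refine ⟨⟨Matrix.of fun i j => b.basis.repr (b'.basis j) i, ?_⟩, ext_basis fun j => ?_⟩
  · rw [SymplecticGroup.mem_iff']
    ext j l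
    have h := b'.rel j l
    rw [hj j, hj l] at h
    simp only [map_sum, LinearMap.sum_apply, map_smul, LinearMap.smul_apply, b.rel,
      smul_eq_mul] at h
    rw [← neg_inj, ← h]
    simp only [mul_apply, transpose_apply, of_apply, Finset.sum_mul, Finset.mul_sum,
      ← Finset.sum_neg_distrib]
    refine Finset.sum_congr rfl fun i _ => Finset.sum_congr rfl fun i' _ => ?_
    ring
  · rw [act_basis]
    exact hj j

end SymplecticFrame

end SymplecticFrames

/-! ### The action of `Sp(ℓ)` on the bundle of symplectic frames -/

section FrameBundles

set_option linter.unusedSectionVars false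

universe u v

variable {N : Type u} {F : Type*} {V : N → Type v} [∀ x, AddCommGroup (V x)]
  [∀ x, Module ℝ (V x)] {B : ∀ x, LinearMap.BilinForm ℝ (V x)} {ι : Type*} [Fintype ι]
  [DecidableEq ι]

namespace FrameBundle

/-- The action of the symplectic group on the frame bundle. -/
def act (b : FrameBundle F V B ι) (A : Sp ι) : FrameBundle F V B ι := ⟨b.base, b.frame.act A⟩

theorem act_base (b : FrameBundle F V B ι) (A : Sp ι) : (b.act A).base = b.base := rfl

theorem act_one (b : FrameBundle F V B ι) : b.act 1 = b := by
  rw [act, SymplecticFrame.act_one]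

theorem act_mul (b : FrameBundle F V B ι) (A A' : Sp ι) : b.act (A * A') = (b.act A).act A' := by
  rw [act, SymplecticFrame.act_mul]; rfl

theorem act_injective (b : FrameBundle F V B ι) {A A' : Sp ι} (h : b.act A = b.act A') :
    A = A' := by
  obtain ⟨x, b⟩ := b
  exact b.act_injective (eq_of_heq (FrameBundle.mk.inj h).2)

theorem exists_act {b b' : FrameBundle F V B ι} (h : b.base = b'.base) :
    ∃ A : Sp ι, b' = b.act A := by
  obtain ⟨x, b⟩ := b
  obtain ⟨x', b'⟩ := b'
  obtain rfl : x = x' := h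
  obtain ⟨A, rfl⟩ := b.exists_act b'
  exact ⟨A, rfl⟩

variable [TopologicalSpace N] [TopologicalSpace (TotalSpace F V)] {X : Type*} [TopologicalSpace X]

theorem continuous_iff {b : X → FrameBundle F V B ι} :
    Continuous b ↔ Continuous (fun x => (b x).base) ∧
      ∀ i, Continuous fun x => (⟨(b x).base, (b x).frame.basis i⟩ : TotalSpace F V) := by
  rw [continuous_induced_rng]
  refine ⟨fun h => ⟨h.fst, fun i => ?_⟩, fun h => h.1.prodMk (continuous_pi h.2)⟩
  exact (continuous_apply i).comp h.snd

theorem continuous_base : Continuous (base : FrameBundle F V B ι → N) :=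
  (continuous_iff.1 continuous_id).1

theorem continuous_div_of_form {b : X → FrameBundle F V B ι} {A : X → Sp ι}
    (h : ∀ i j, Continuous fun x => B (b x).base ((b x).frame.basis i)
      (((b x).frame.act (A x)).basis j)) : Continuous A := by
  refine continuous_induced_rng.2 ?_
  have e : ∀ x, (A x).1 = _ := fun x => (b x).frame.coe_eq_mul_gram (A x)
  change Continuous fun x => (A x).1
  simp only [e]
  exact continuous_const.matrix_mul (continuous_matrix h)

end FrameBundle

end FrameBundles

/-! ### Continuity of linear combinations and of the form in a vector bundle -/

section VectorBundles

universe u v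

variable {N : Type u} [TopologicalSpace N] {F : Type*} [NormedAddCommGroup F] [NormedSpace ℝ F]
  {E : N → Type v} [TopologicalSpace (TotalSpace F E)]
  [∀ x, TopologicalSpace (E x)] [∀ x, AddCommGroup (E x)] [∀ x, Module ℝ (E x)]
  [FiberBundle F E] [VectorBundle ℝ F E] {X : Type*} [TopologicalSpace X]

theorem continuous_totalSpace_sum_smul {f : X → N} (hf : Continuous f) {α : Type*} (s : Finset α)
    {a : α → X → ℝ} {v : α → ∀ x, E (f x)} (ha : ∀ i ∈ s, Continuous (a i))
    (hv : ∀ i ∈ s, Continuous fun x => (⟨f x, v i x⟩ : TotalSpace F E)) :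
    Continuous fun x => (⟨f x, ∑ i ∈ s, a i x • v i x⟩ : TotalSpace F E) := by
  refine continuous_iff_continuousAt.2 fun x₀ => ?_
  rw [FiberBundle.continuousAt_totalSpace]
  refine ⟨hf.continuousAt, ?_⟩
  set e := trivializationAt F E (f x₀)
  have h : ContinuousAt (fun x => ∑ i ∈ s, a i x • (e ⟨f x, v i x⟩).2) x₀ := by
    refine tendsto_finsetSum _ fun i hi => ?_
    exact (ha i hi).continuousAt.smul
      ((FiberBundle.continuousAt_totalSpace F _).1 (hv i hi).continuousAt).2
  refine h.congr ?_
  filter_upwards [hf.continuousAt.preimage_mem_nhds (e.open_baseSet.mem_nhds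
    (FiberBundle.mem_baseSet_trivializationAt' (f x₀)))] with x hx
  -- Over its base set the trivialization is linear on fibres, so it commutes with the linear
  -- combination.
  have hl := fun w => e.linearMapAt_apply (R := ℝ) (b := f x) w
  simp only [if_pos (show f x ∈ e.baseSet from hx)] at hl
  simp only [← hl, map_sum, map_smul]

variable [∀ x, IsTopologicalAddGroup (E x)] [∀ x, ContinuousConstSMul ℝ (E x)]

theorem SymplecticForm.continuous_apply (Ω : SymplecticForm F E) {f : X → N}
    {v w : ∀ x, E (f x)} (hv : Continuous fun x => (⟨f x, v x⟩ : TotalSpace F E))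
    (hw : Continuous fun x => (⟨f x, w x⟩ : TotalSpace F E)) :
    Continuous fun x => Ω.form (f x) (v x) (w x) := by
  have hf : Continuous f := (FiberBundle.continuous_proj F E).comp hv
  have h := Continuous.clm_bundle_apply₂ (F₁ := F) (F₂ := F) (F₃ := ℝ) (E₃ := Bundle.Trivial N ℝ)
    (b := f) (Ω.continuous.comp hf) hv hw
  refine continuous_iff_continuousAt.2 fun x₀ => ?_
  exact ((FiberBundle.continuousAt_totalSpace ℝ _).1 h.continuousAt).2

variable {Ω : SymplecticForm F E} {ι : Type*} [Fintype ι] [DecidableEq ι]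

namespace FrameBundle

theorem continuous_act {b : X → FrameBundle F E Ω.bilin ι} {A : X → Sp ι} (hb : Continuous b)
    (hA : Continuous A) : Continuous fun x => (b x).act (A x) := by
  rw [continuous_iff] at hb ⊢
  refine ⟨hb.1, fun j => ?_⟩
  refine (continuous_totalSpace_sum_smul hb.1 Finset.univ
    (fun i _ => hA.subtype_val.matrix_elem i j) fun i _ => hb.2 i).congr fun x => ?_
  exact congrArg (TotalSpace.mk (b x).base) ((b x).frame.act_basis (A x) j).symm

theorem continuous_div {b : X → FrameBundle F E Ω.bilin ι} {A : X → Sp ι} (hb : Continuous b)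
    (hA : Continuous fun x => (b x).act (A x)) : Continuous A :=
  continuous_div_of_form (b := b) fun i j =>
    Ω.continuous_apply ((continuous_iff.1 hb).2 i) ((continuous_iff.1 hA).2 j)

end FrameBundle

end VectorBundles

/-! ### Symplectic linear algebra: partial frames and their completion -/

section PartialFrames

set_option linter.unusedSectionVars false

variable {V : Type*} [AddCommGroup V] [Module ℝ V] {B : LinearMap.BilinForm ℝ V}
  {α : Type*} [DecidableEq α]

/-- The vectors `(e, f)` satisfy the relations of a symplectic frame, but need not span. -/
structure IsPartialFrame (B : LinearMap.BilinForm ℝ V) (e f : α → V) : Prop where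
  left : ∀ i j, B (e i) (e j) = 0
  right : ∀ i j, B (f i) (f j) = 0
  pair : ∀ i j, B (e i) (f j) = if i = j then 1 else 0

theorem IsPartialFrame.comp {e f : α → V} (h : IsPartialFrame B e f) {β : Type*} [DecidableEq β]
    {g : β → α} (hg : Function.Injective g) : IsPartialFrame B (e ∘ g) (f ∘ g) where
  left _ _ := h.left _ _
  right _ _ := h.right _ _
  pair i j := by simp only [Function.comp_apply, h.pair, hg.eq_iff]

theorem IsPartialFrame.pair' (hB : B.IsAlt) {e f : α → V} (h : IsPartialFrame B e f) (i j : α) :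
    B (f i) (e j) = if i = j then -1 else 0 := by
  rw [← hB.neg_eq, h.pair]
  by_cases hij : i = j
  · simp [hij]
  · simp [hij, Ne.symm hij]

theorem IsPartialFrame.option (hB : B.IsAlt) {e f : α → V} (h : IsPartialFrame B e f) {u w : V}
    (hu : ∀ i, B (e i) u = 0 ∧ B (f i) u = 0) (hw : ∀ i, B (e i) w = 0 ∧ B (f i) w = 0)
    (huw : B u w = 1) :
    IsPartialFrame B (fun i : Option α => i.elim u e) (fun i : Option α => i.elim w f) where
  left i j := by
    cases i <;> cases j <;> simp [h.left, hu, hB.self_eq_zero]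
    rw [← hB.neg_eq, (hu _).1, neg_zero]
  right i j := by
    cases i <;> cases j <;> simp [h.right, hw, hB.self_eq_zero]
    rw [← hB.neg_eq, (hw _).2, neg_zero]
  pair i j := by
    cases i <;> cases j <;> simp [h.pair, hw, huw]
    rw [← hB.neg_eq, (hu _).2, neg_zero]

variable [Fintype α]

/-- The projection of `w` to the orthogonal complement of the partial frame `(e, f)`. -/
def orthogonalPart (B : LinearMap.BilinForm ℝ V) (e f : α → V) (w : V) : V :=
  w - ∑ i : α ⊕ α, Sum.elim (fun i => B w (f i)) (fun i => -B w (e i)) i • Sum.elim e f i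

theorem IsPartialFrame.orthogonalPart_left (hB : B.IsAlt) {e f : α → V}
    (h : IsPartialFrame B e f) (w : V) (i : α) : B (e i) (orthogonalPart B e f w) = 0 := by
  simp only [orthogonalPart, Fintype.sum_sum_type, Sum.elim_inl, Sum.elim_inr, map_sub, map_add,
    map_sum, map_smul, h.left, h.pair, smul_eq_mul, mul_zero, Finset.sum_const_zero, zero_add,
    mul_ite, mul_one, Finset.sum_ite_eq, Finset.mem_univ, if_true]
  rw [hB.neg_eq, sub_self]

theorem IsPartialFrame.orthogonalPart_right (hB : B.IsAlt) {e f : α → V}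
    (h : IsPartialFrame B e f) (w : V) (i : α) : B (f i) (orthogonalPart B e f w) = 0 := by
  simp only [orthogonalPart, Fintype.sum_sum_type, Sum.elim_inl, Sum.elim_inr, map_sub, map_add,
    map_sum, map_smul, h.right, h.pair' hB, smul_eq_mul, mul_zero, Finset.sum_const_zero, add_zero,
    mul_ite, mul_neg, mul_one, Finset.sum_ite_eq, Finset.mem_univ, if_true]
  rw [← hB.neg_eq w, sub_self]

theorem orthogonalPart_eq_self (hB : B.IsAlt) {e f : α → V} {w : V}
    (hw : ∀ i, B (e i) w = 0 ∧ B (f i) w = 0) : orthogonalPart B e f w = w := by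
  have h1 : ∀ i, B w (e i) = 0 := fun i => by rw [← hB.neg_eq, (hw i).1, neg_zero]
  have h2 : ∀ i, B w (f i) = 0 := fun i => by rw [← hB.neg_eq, (hw i).2, neg_zero]
  simp [orthogonalPart, h1, h2]

/-- A step of the symplectic Gram-Schmidt process. A vector outside the span has a nonzero
projection `u` to the orthogonal complement, and `u` pairs nontrivially with some `z`. Replacing `z`
by its projection does not change the pairing, since `u` is orthogonal to the span; rescaling makes
it `1`. -/
theorem IsPartialFrame.exists_orthogonal_pair (hB : B.IsAlt)
    (hnd : ∀ v, (∀ w, B v w = 0) → v = 0) {e f : α → V} (h : IsPartialFrame B e f)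
    (hcard : 2 * Fintype.card α < Module.finrank ℝ V) :
    ∃ u w, (∀ i, B (e i) u = 0 ∧ B (f i) u = 0) ∧ (∀ i, B (e i) w = 0 ∧ B (f i) w = 0) ∧
      B u w = 1 := by
  have hspan : Submodule.span ℝ (Set.range (Sum.elim e f)) ≠ ⊤ := by
    intro ht
    have h1 := finrank_range_le_card (R := ℝ) (Sum.elim e f)
    rw [Set.finrank, ht, finrank_top, Fintype.card_sum] at h1
    omega
  obtain ⟨v, -, hv⟩ := SetLike.exists_of_lt (lt_top_iff_ne_top.2 hspan)
  have hou : ∀ w, ∀ i, B (e i) (orthogonalPart B e f w) = 0 ∧ B (f i) (orthogonalPart B e f w) = 0 :=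
    fun w i => ⟨h.orthogonalPart_left hB w i, h.orthogonalPart_right hB w i⟩
  have hu0 : orthogonalPart B e f v ≠ 0 := by
    intro h0
    apply hv
    rw [sub_eq_zero.1 h0]
    exact Submodule.sum_mem _ fun i _ => Submodule.smul_mem _ _ (Submodule.subset_span ⟨i, rfl⟩)
  obtain ⟨z, hz⟩ : ∃ z, B (orthogonalPart B e f v) z ≠ 0 := by
    by_contra! hc
    exact hu0 (hnd _ hc)
  have h1 : ∀ i, B (orthogonalPart B e f v) (e i) = 0 := fun i => by
    rw [← hB.neg_eq, (hou v i).1, neg_zero]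
  have h2 : ∀ i, B (orthogonalPart B e f v) (f i) = 0 := fun i => by
    rw [← hB.neg_eq, (hou v i).2, neg_zero]
  have hz' : B (orthogonalPart B e f v) (orthogonalPart B e f z) =
      B (orthogonalPart B e f v) z := by
    conv_lhs => rw [orthogonalPart.eq_def B e f z]
    simp [h1, h2]
  refine ⟨_, (B (orthogonalPart B e f v) z)⁻¹ • orthogonalPart B e f z, hou v, fun i => ?_, ?_⟩
  · simp [hou z i]
  · rw [map_smul, hz', smul_eq_mul, inv_mul_cancel₀ hz]

/-- The claim is that `v ↦ (B (s i) v)ᵢ` is onto. A functional that vanishes on its range is a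
linear combination of the `s i` lying in the radical of `B`; nondegeneracy and linear independence
force its coefficients to vanish. -/
theorem exists_dual_family (hnd : ∀ v, (∀ w, B v w = 0) → v = 0) {s : α → V}
    (hs : LinearIndependent ℝ s) : ∃ f : α → V, ∀ i j, B (s i) (f j) = if i = j then 1 else 0 := by
  let L : V →ₗ[ℝ] (α → ℝ) := LinearMap.pi fun i => B (s i)
  have hL : LinearMap.range L = ⊤ := by
    by_contra hne
    obtain ⟨φ, hφ0, hφ⟩ := Submodule.exists_le_ker_of_lt_top _ (lt_top_iff_ne_top.2 hne)
    have h1 : ∑ i, φ (Pi.single i 1) • s i = 0 := by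
      refine hnd _ fun w => ?_
      have h2 : φ (L w) = 0 := hφ ⟨w, rfl⟩
      rw [LinearMap.pi_apply_eq_sum_univ φ] at h2
      simp only [map_sum, LinearMap.sum_apply, map_smul, LinearMap.smul_apply, smul_eq_mul]
      rw [← h2]
      refine Finset.sum_congr rfl fun i _ => ?_
      rw [smul_eq_mul, mul_comm]
      congr 2
      funext j
      simp [Pi.single_apply, eq_comm]
    have h3 := Fintype.linearIndependent_iff.1 hs _ h1
    apply hφ0
    refine LinearMap.pi_ext fun i x => ?_
    have : (Pi.single i x : α → ℝ) = x • Pi.single i 1 := by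
      rw [← Pi.single_smul]; simp
    rw [this, map_smul, h3 i]
    simp
  have hf : ∀ j, ∃ v, L v = Pi.single j 1 := fun j => LinearMap.range_eq_top.1 hL _
  choose f hf using hf
  refine ⟨f, fun i j => ?_⟩
  have := congrFun (hf j) i
  rw [Pi.single_apply] at this
  exact this

/-- A partial frame with enough vectors is a symplectic frame. -/
def IsPartialFrame.toFrame (hB : B.IsAlt) [FiniteDimensional ℝ V] {e f : α → V}
    (h : IsPartialFrame B e f) (hcard : Module.finrank ℝ V = 2 * Fintype.card α) :
    SymplecticFrame α B :=
  have rel : ∀ i j, B (Sum.elim e f i) (Sum.elim e f j) = -Matrix.J α ℝ i j := by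
    rintro (i | i) (j | j) <;>
      simp [Matrix.J, one_apply, h.left, h.right, h.pair, h.pair' hB, apply_ite]
  { basis := Module.Basis.mk (v := Sum.elim e f) (linearIndependent_of_rel rel)
      ((linearIndependent_of_rel rel).span_eq_top_of_card_eq_finrank' (by
        rw [hcard, Fintype.card_sum, two_mul])).ge
    rel := fun i j => by
      rw [Module.Basis.mk_apply, Module.Basis.mk_apply]
      exact rel i j }

theorem IsPartialFrame.toFrame_basis (hB : B.IsAlt) [FiniteDimensional ℝ V] {e f : α → V}
    (h : IsPartialFrame B e f) (hcard : Module.finrank ℝ V = 2 * Fintype.card α) (j : α ⊕ α) :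
    (h.toFrame hB hcard).basis j = Sum.elim e f j := by
  dsimp only [IsPartialFrame.toFrame]
  rw [Module.Basis.mk_apply]

end PartialFrames

/-! ### Local existence of adapted symplectic frames -/

section LocalFrames

set_option linter.unusedSectionVars false

universe u v

/-- Extends a section over `U` to the whole base by arbitrary choices, so that the pointwise
conditions hold everywhere and continuity is kept on `U`. This avoids frames defined on subtypes
later on. -/
theorem exists_section_of_local {N Y : Type*} [TopologicalSpace N] [TopologicalSpace Y]
    {q : Y → N} {p : Y → Prop}
    (h : ∀ x₀, ∃ U : Set N, IsOpen U ∧ x₀ ∈ U ∧ ∃ σ : U → Y, Continuous σ ∧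
      ∀ u, q (σ u) = u ∧ p (σ u)) (x₀ : N) :
    ∃ U : Set N, IsOpen U ∧ x₀ ∈ U ∧ ∃ σ : N → Y, ContinuousOn σ U ∧
      ∀ x, q (σ x) = x ∧ p (σ x) := by
  have hs : ∀ x, ∃ y, q y = x ∧ p y := fun x => by
    obtain ⟨U, -, hx, σ, -, h1⟩ := h x
    exact ⟨_, h1 ⟨x, hx⟩⟩
  obtain ⟨U, hU, hx, σ, hc, h1⟩ := h x₀
  classical
  refine ⟨U, hU, hx, fun x => if hx : x ∈ U then σ ⟨x, hx⟩ else (hs x).choose,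
    continuousOn_iff_continuous_domRestrict.2 ?_, fun x => ?_⟩
  · refine hc.congr fun x => ?_
    simp [Set.domRestrict]
  · by_cases hx : x ∈ U
    · simpa only [hx, dif_pos] using h1 ⟨x, hx⟩
    · simpa only [hx, dif_neg, not_false_iff] using (hs x).choose_spec

variable {N : Type u} [TopologicalSpace N] {F : Type*} [NormedAddCommGroup F] [NormedSpace ℝ F]
  {E : N → Type v} [TopologicalSpace (TotalSpace F E)]
  [∀ x, TopologicalSpace (E x)] [∀ x, AddCommGroup (E x)] [∀ x, Module ℝ (E x)]
  [FiberBundle F E] [VectorBundle ℝ F E]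

theorem continuousOn_sum_smul {U : Set N} {α : Type*} (s : Finset α)
    {a : α → N → ℝ} {v : α → ∀ x, E x} (ha : ∀ i ∈ s, ContinuousOn (a i) U)
    (hv : ∀ i ∈ s, ContinuousOn (fun x => (⟨x, v i x⟩ : TotalSpace F E)) U) :
    ContinuousOn (fun x => (⟨x, ∑ i ∈ s, a i x • v i x⟩ : TotalSpace F E)) U :=
  continuousOn_iff_continuous_domRestrict.2 <|
    continuous_totalSpace_sum_smul (f := fun x : U => x.1) (v := fun i x => v i x.1)
      continuous_subtype_val s
      (fun i hi => continuousOn_iff_continuous_domRestrict.1 (ha i hi))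
      fun i hi => continuousOn_iff_continuous_domRestrict.1 (hv i hi)

theorem continuousOn_smul {U : Set N} {a : N → ℝ} {v : ∀ x, E x} (ha : ContinuousOn a U)
    (hv : ContinuousOn (fun x => (⟨x, v x⟩ : TotalSpace F E)) U) :
    ContinuousOn (fun x => (⟨x, a x • v x⟩ : TotalSpace F E)) U := by
  have h := continuousOn_sum_smul (F := F) (E := E) (U := U) {()} (a := fun _ => a)
    (v := fun _ => v) (fun _ _ => ha) fun _ _ => hv
  simpa only [Finset.sum_singleton] using h

theorem continuousOn_sub {U : Set N} {v w : ∀ x, E x}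
    (hv : ContinuousOn (fun x => (⟨x, v x⟩ : TotalSpace F E)) U)
    (hw : ContinuousOn (fun x => (⟨x, w x⟩ : TotalSpace F E)) U) :
    ContinuousOn (fun x => (⟨x, v x - w x⟩ : TotalSpace F E)) U := by
  have h := continuousOn_sum_smul (F := F) (E := E) (U := U) Finset.univ
    (a := fun i _ => ![1, -1] i) (v := fun i x => ![v x, w x] i) (fun _ _ => continuousOn_const)
    (by
      intro i _
      fin_cases i
      exacts [hv, hw])
  simpa [Fin.sum_univ_two, ← sub_eq_add_neg] using h

theorem exists_section_through (x₀ : N) (w : E x₀) : ∃ U : Set N, IsOpen U ∧ x₀ ∈ U ∧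
    ∃ s : ∀ x, E x, s x₀ = w ∧ ContinuousOn (fun x => (⟨x, s x⟩ : TotalSpace F E)) U := by
  set e := trivializationAt F E x₀
  have hx : x₀ ∈ e.baseSet := FiberBundle.mem_baseSet_trivializationAt' x₀
  refine ⟨e.baseSet, e.open_baseSet, hx, fun x => e.symm x (e ⟨x₀, w⟩).2,
    e.symm_apply_apply_mk hx w, ?_⟩
  have h : ContinuousOn (fun x : N => (x, (e ⟨x₀, w⟩).2)) e.baseSet := by fun_prop
  exact e.continuousOn_symm.comp h fun x hx => ⟨hx, Set.mem_univ _⟩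

theorem exists_sections_through {α : Type*} [Finite α] (x₀ : N) (w : α → E x₀) :
    ∃ U : Set N, IsOpen U ∧ x₀ ∈ U ∧ ∃ s : α → ∀ x, E x, (∀ i, s i x₀ = w i) ∧
      ∀ i, ContinuousOn (fun x => (⟨x, s i x⟩ : TotalSpace F E)) U := by
  choose U hU hx s hs hc using fun i => exists_section_through (F := F) x₀ (w i)
  exact ⟨⋂ i, U i, isOpen_iInter_of_finite hU, Set.mem_iInter.2 hx, s, hs,
    fun i => (hc i).mono (Set.iInter_subset U i)⟩

theorem finrank_fiber (x : N) : Module.finrank ℝ (E x) = Module.finrank ℝ F :=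
  ((trivializationAt F E x).continuousLinearEquivAt ℝ x
    (FiberBundle.mem_baseSet_trivializationAt' x)).toLinearEquiv.finrank_eq

theorem finiteDimensional_fiber [FiniteDimensional ℝ F] (x : N) : FiniteDimensional ℝ (E x) :=
  ((trivializationAt F E x).continuousLinearEquivAt ℝ x
    (FiberBundle.mem_baseSet_trivializationAt' x)).symm.toLinearEquiv.finiteDimensional

variable [∀ x, IsTopologicalAddGroup (E x)] [∀ x, ContinuousConstSMul ℝ (E x)]
  {Ω : SymplecticForm F E}

theorem SymplecticForm.bilin_nondegenerate (Ω : SymplecticForm F E) (x : N) (v : E x)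
    (h : ∀ w, Ω.bilin x v w = 0) : v = 0 :=
  Ω.nondegenerate x v h

theorem SymplecticForm.continuousOn_bilin (Ω : SymplecticForm F E) {U : Set N} {v w : ∀ x, E x}
    (hv : ContinuousOn (fun x => (⟨x, v x⟩ : TotalSpace F E)) U)
    (hw : ContinuousOn (fun x => (⟨x, w x⟩ : TotalSpace F E)) U) :
    ContinuousOn (fun x => Ω.bilin x (v x) (w x)) U :=
  continuousOn_iff_continuous_domRestrict.2 <|
    Ω.continuous_apply (f := fun x : U => x.1) (v := fun x => v x.1) (w := fun x => w x.1)
      (continuousOn_iff_continuous_domRestrict.1 hv)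
      (continuousOn_iff_continuous_domRestrict.1 hw)

/-- Continuous sections over `U` form a partial symplectic frame of each fibre. -/
structure IsLocalPartialFrame (Ω : SymplecticForm F E) {α : Type*} [DecidableEq α] (U : Set N)
    (e f : α → ∀ x, E x) : Prop where
  continuousOn_left : ∀ i, ContinuousOn (fun x => (⟨x, e i x⟩ : TotalSpace F E)) U
  continuousOn_right : ∀ i, ContinuousOn (fun x => (⟨x, f i x⟩ : TotalSpace F E)) U
  isPartialFrame : ∀ x ∈ U, IsPartialFrame (Ω.bilin x) (fun i => e i x) fun i => f i x

variable {α : Type*} [DecidableEq α] [Fintype α]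

/-- A continuous family of isotropic frames can locally be completed to a partial frame. -/
theorem exists_isLocalPartialFrame {U : Set N} (hU : IsOpen U) {x₀ : N} (hx : x₀ ∈ U)
    {e : α → ∀ x, E x} (hc : ∀ i, ContinuousOn (fun x => (⟨x, e i x⟩ : TotalSpace F E)) U)
    (hli : LinearIndependent ℝ fun i => e i x₀)
    (hiso : ∀ x ∈ U, ∀ i j, Ω.bilin x (e i x) (e j x) = 0) :
    ∃ U' ⊆ U, IsOpen U' ∧ x₀ ∈ U' ∧ ∃ f : α → ∀ x, E x, IsLocalPartialFrame Ω U' e f := by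
  obtain ⟨w, hw⟩ := exists_dual_family (Ω.bilin_nondegenerate x₀) hli
  obtain ⟨W, hW, hxW, f, hf, hfc⟩ := exists_sections_through (F := F) x₀ w
  -- At `x₀` the sections `f` are dual to `e`, so this matrix of pairings is `1` there and
  -- invertible nearby. Multiplying `f` by its inverse gives a family `f'` dual to `e` on a
  -- neighbourhood.
  let M : N → Matrix α α ℝ := fun x => Matrix.of fun i j => Ω.bilin x (e i x) (f j x)
  have hM : ContinuousOn M (U ∩ W) := continuousOn_pi.2 fun i => continuousOn_pi.2 fun j =>
    Ω.continuousOn_bilin ((hc i).mono Set.inter_subset_left) ((hfc j).mono Set.inter_subset_right)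
  have hdet : ContinuousOn (fun x => (M x).det) (U ∩ W) :=
    (continuous_id.matrix_det).comp_continuousOn hM
  let U' : Set N := (U ∩ W) ∩ (fun x => (M x).det) ⁻¹' {0}ᶜ
  have hU' : IsOpen U' := hdet.isOpen_inter_preimage (hU.inter hW) isOpen_compl_singleton
  have h0 : M x₀ = 1 := by
    ext i j
    simp only [M, of_apply, hf, hw, one_apply]
  have hxU' : x₀ ∈ U' := ⟨⟨hx, hxW⟩, by simp [h0]⟩
  have hsub : U' ⊆ U ∩ W := Set.inter_subset_left
  have hdet0 : ∀ x ∈ U', (M x).det ≠ 0 := fun x hx => hx.2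
  have hinv : ContinuousOn (fun x => (M x)⁻¹) U' := by
    simp only [Matrix.inv_def, Ring.inverse_eq_inv']
    exact ((hdet.mono hsub).inv₀ hdet0).smul
      (continuous_id.matrix_adjugate.comp_continuousOn (hM.mono hsub))
  let f' : α → ∀ x, E x := fun j x => ∑ l, (M x)⁻¹ l j • f l x
  have hf'c : ∀ j, ContinuousOn (fun x => (⟨x, f' j x⟩ : TotalSpace F E)) U' := fun j =>
    continuousOn_sum_smul _ (fun l _ => continuousOn_pi.1 (continuousOn_pi.1 hinv l) j)
      fun l _ => (hfc l).mono (hsub.trans Set.inter_subset_right)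
  have hec : ∀ j, ContinuousOn (fun x => (⟨x, e j x⟩ : TotalSpace F E)) U' := fun j =>
    (hc j).mono (hsub.trans Set.inter_subset_left)
  have hef' : ∀ x ∈ U', ∀ i j, Ω.bilin x (e i x) (f' j x) = if i = j then 1 else 0 := by
    intro x hx i j
    have h := congrFun (congrFun (mul_nonsing_inv (M x) (hdet0 x hx).isUnit) i) j
    rw [one_apply] at h
    rw [← h, mul_apply]
    simp only [f', map_sum, map_smul, smul_eq_mul, M, of_apply]
    exact Finset.sum_congr rfl fun l _ => mul_comm _ _
  have hfe' : ∀ x ∈ U', ∀ i j, Ω.bilin x (f' i x) (e j x) = if i = j then -1 else 0 := by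
    intro x hx i j
    rw [← (Ω.bilin_isAlt x).neg_eq, hef' x hx]
    by_cases hij : i = j
    · simp [hij]
    · simp [hij, Ne.symm hij]
  -- Subtracting multiples of the isotropic `e l` keeps the duality. In the pairing of two corrected
  -- vectors each of the two corrections removes half of the pairing of `f' i` with `f' j`, which
  -- explains the factor `1 / 2`.
  refine ⟨U', hsub.trans Set.inter_subset_left, hU', hxU',
    fun j x => f' j x - ∑ l, (Ω.bilin x (f' j x) (f' l x) / 2) • e l x,
    ⟨hec, fun j => continuousOn_sub (hf'c j) (continuousOn_sum_smul _
      (fun l _ => (Ω.continuousOn_bilin (hf'c j) (hf'c l)).div_const 2) fun l _ => hec l),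
      fun x hx => ⟨hiso x (hsub hx).1, fun i j => ?_, fun i j => ?_⟩⟩⟩
  · simp only [map_sub, map_sum, map_smul, LinearMap.sub_apply, LinearMap.sum_apply,
      LinearMap.smul_apply, hef' x hx, hfe' x hx, hiso x (hsub hx).1, smul_eq_mul]
    simp
    rw [← (Ω.bilin_isAlt x).neg_eq]
    ring
  · simp only [map_sub, map_sum, map_smul, hef' x hx, hiso x (hsub hx).1, smul_eq_mul]
    simp

theorem continuousOn_orthogonalPart {U : Set N} {e f : α → ∀ x, E x}
    (h : IsLocalPartialFrame Ω U e f) {w : ∀ x, E x}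
    (hw : ContinuousOn (fun x => (⟨x, w x⟩ : TotalSpace F E)) U) :
    ContinuousOn (fun x => (⟨x, orthogonalPart (Ω.bilin x) (fun i => e i x) (fun i => f i x) (w x)⟩ :
      TotalSpace F E)) U := by
  refine continuousOn_sub hw ?_
  have h1 := continuousOn_sum_smul (F := F) (E := E) (U := U) (Finset.univ : Finset (α ⊕ α))
    (a := fun i x => Sum.elim (fun i => Ω.bilin x (w x) (f i x))
      (fun i => -Ω.bilin x (w x) (e i x)) i) (v := fun i x => Sum.elim (fun i => e i x)
      (fun i => f i x) i) (by
      rintro (i | i) -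
      · exact Ω.continuousOn_bilin hw (h.continuousOn_right i)
      · exact (Ω.continuousOn_bilin hw (h.continuousOn_left i)).neg) (by
      rintro (i | i) -
      · exact h.continuousOn_left i
      · exact h.continuousOn_right i)
  exact h1

/-- A local partial frame which is too small can locally be enlarged. -/
theorem IsLocalPartialFrame.exists_option {U : Set N} (hU : IsOpen U) {x₀ : N} (hx : x₀ ∈ U)
    {e f : α → ∀ x, E x} (h : IsLocalPartialFrame Ω U e f)
    (hcard : 2 * Fintype.card α < Module.finrank ℝ F) :
    ∃ U' ⊆ U, IsOpen U' ∧ x₀ ∈ U' ∧ ∃ u w : ∀ x, E x, IsLocalPartialFrame Ω U'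
      (fun i : Option α => i.elim u e) (fun i : Option α => i.elim w f) := by
  obtain ⟨u₀, w₀, hu₀, hw₀, huw₀⟩ := (h.isPartialFrame x₀ hx).exists_orthogonal_pair
    (Ω.bilin_isAlt x₀) (Ω.bilin_nondegenerate x₀) (by rwa [finrank_fiber (F := F)])
  obtain ⟨W, hW, hxW, u, hu, huc⟩ := exists_section_through (F := F) x₀ u₀
  obtain ⟨W', hW', hxW', w, hw, hwc⟩ := exists_section_through (F := F) x₀ w₀
  let p : (∀ x, E x) → ∀ x, E x := fun w x =>
    orthogonalPart (Ω.bilin x) (fun i => e i x) (fun i => f i x) (w x)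
  have hV : IsOpen (U ∩ (W ∩ W')) := hU.inter (hW.inter hW')
  have hres : IsLocalPartialFrame Ω (U ∩ (W ∩ W')) e f :=
    ⟨fun i => (h.continuousOn_left i).mono Set.inter_subset_left,
      fun i => (h.continuousOn_right i).mono Set.inter_subset_left,
      fun x hx => h.isPartialFrame x hx.1⟩
  have hpu : ContinuousOn (fun x => (⟨x, p u x⟩ : TotalSpace F E)) (U ∩ (W ∩ W')) :=
    continuousOn_orthogonalPart hres (huc.mono fun x hx => hx.2.1)
  have hpw : ContinuousOn (fun x => (⟨x, p w x⟩ : TotalSpace F E)) (U ∩ (W ∩ W')) :=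
    continuousOn_orthogonalPart hres (hwc.mono fun x hx => hx.2.2)
  have hpp : ContinuousOn (fun x => Ω.bilin x (p u x) (p w x)) (U ∩ (W ∩ W')) :=
    Ω.continuousOn_bilin hpu hpw
  -- The projected sections are orthogonal to the given frame at every point, but their pairing is
  -- known to be `1` only at `x₀`. Where it is nonzero, the second section can be rescaled.
  let U' : Set N := (U ∩ (W ∩ W')) ∩ (fun x => Ω.bilin x (p u x) (p w x)) ⁻¹' {0}ᶜ
  have hsub : U' ⊆ U ∩ (W ∩ W') := Set.inter_subset_left
  have hne : ∀ x ∈ U', Ω.bilin x (p u x) (p w x) ≠ 0 := fun x hx => hx.2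
  -- At `x₀` the value is already orthogonal to the frame, so the projection does not move it.
  have hpu₀ : p u x₀ = u₀ := by
    simp only [p, hu]
    exact orthogonalPart_eq_self (Ω.bilin_isAlt x₀) hu₀
  have hpw₀ : p w x₀ = w₀ := by
    simp only [p, hw]
    exact orthogonalPart_eq_self (Ω.bilin_isAlt x₀) hw₀
  have horth : ∀ x ∈ U', ∀ w i, Ω.bilin x (e i x) (p w x) = 0 ∧ Ω.bilin x (f i x) (p w x) = 0 :=
    fun x hx w i => ⟨(hres.isPartialFrame x hx.1).orthogonalPart_left (Ω.bilin_isAlt x) _ i,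
      (hres.isPartialFrame x hx.1).orthogonalPart_right (Ω.bilin_isAlt x) _ i⟩
  refine ⟨U', hsub.trans Set.inter_subset_left, hpp.isOpen_inter_preimage hV isOpen_compl_singleton,
    ⟨⟨hx, hxW, hxW'⟩, ?_⟩, p u, fun x => (Ω.bilin x (p u x) (p w x))⁻¹ • p w x, ⟨?_, ?_, ?_⟩⟩
  · change Ω.bilin x₀ (p u x₀) (p w x₀) ≠ 0
    rw [hpu₀, hpw₀, huw₀]
    exact one_ne_zero
  · rintro (_ | i)
    · exact hpu.mono hsub
    · exact (hres.continuousOn_left i).mono hsub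
  · rintro (_ | i)
    · exact continuousOn_smul ((hpp.mono hsub).inv₀ hne) (hpw.mono hsub)
    · exact (hres.continuousOn_right i).mono hsub
  · intro x hx
    have h1 := (hres.isPartialFrame x hx.1).option (Ω.bilin_isAlt x) (horth x hx u)
      (w := (Ω.bilin x (p u x) (p w x))⁻¹ • p w x) (fun i => by
        rw [map_smul, map_smul, (horth x hx w i).1, (horth x hx w i).2]; simp)
      (by rw [map_smul, smul_eq_mul, inv_mul_cancel₀ (hne x hx)])
    convert! h1 using 1
    · funext i; cases i <;> rfl
    · funext i; cases i <;> rfl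

/-- A local partial frame indexed by `α` can locally be enlarged to one indexed by `α ⊕ Fin a`
as long as the rank allows. -/
theorem IsLocalPartialFrame.exists_sum_fin {U : Set N} (hU : IsOpen U) {x₀ : N} (hx : x₀ ∈ U)
    {e f : α → ∀ x, E x} (h : IsLocalPartialFrame Ω U e f) (a : ℕ)
    (hcard : 2 * (Fintype.card α + a) ≤ Module.finrank ℝ F) :
    ∃ U' ⊆ U, IsOpen U' ∧ x₀ ∈ U' ∧ ∃ e' f' : α ⊕ Fin a → ∀ x, E x,
      IsLocalPartialFrame Ω U' e' f' ∧ ∀ i, e' (Sum.inl i) = e i := by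
  induction a with
  | zero =>
    let g : α ⊕ Fin 0 → α := Sum.elim id fun i => i.elim0
    have hg : Function.Injective g := by
      rintro (i | i) (j | j) hij
      · exact congrArg Sum.inl hij
      · exact j.elim0
      · exact i.elim0
      · exact i.elim0
    exact ⟨U, subset_rfl, hU, hx, e ∘ g, f ∘ g, ⟨fun i => h.continuousOn_left _,
      fun i => h.continuousOn_right _, fun x hx => (h.isPartialFrame x hx).comp hg⟩, fun i => rfl⟩
  | succ a ih =>
    obtain ⟨U₁, hU₁, hU₁o, hx₁, e₁, f₁, h₁, he₁⟩ := ih (by omega)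
    obtain ⟨U₂, hU₂, hU₂o, hx₂, u, w, h₂⟩ := h₁.exists_option hU₁o hx₁ (by
      rw [Fintype.card_sum, Fintype.card_fin]; omega)
    -- The new pair, which has index `none`, becomes index `0` of `Fin (a + 1)`, and the earlier
    -- indices are shifted.
    let g : α ⊕ Fin (a + 1) → Option (α ⊕ Fin a) :=
      Sum.elim (fun i => some (Sum.inl i)) (Fin.cases none fun j => some (Sum.inr j))
    have hg : Function.Injective g := by
      rintro (i | i) (j | j) hij
      · simpa [g] using hij
      · induction j using Fin.cases <;> simp [g] at hij
      · induction i using Fin.cases <;> simp [g] at hij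
      · induction i using Fin.cases <;> induction j using Fin.cases <;> simp [g] at hij ⊢
        exact hij
    exact ⟨U₂, hU₂.trans hU₁, hU₂o, hx₂, _, _, ⟨fun i => h₂.continuousOn_left (g i),
      fun i => h₂.continuousOn_right (g i), fun x hx => (h₂.isPartialFrame x hx).comp hg⟩,
      fun i => he₁ i⟩

/-- Locally there are continuous adapted symplectic frames. -/
theorem exists_local_adapted_frame [FiniteDimensional ℝ F] (k m : ℕ)
    (hrank : Module.finrank ℝ F = 2 * (k + m)) {I : ∀ x, Submodule ℝ (E x)}
    {o : ∀ x, Orientation ℝ (I x) (Fin k)} (hI : IsOrientedSubbundle F I o)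
    (hiso : ∀ x, ∀ v ∈ I x, ∀ w ∈ I x, Ω.form x v w = 0) (x₀ : N) :
    ∃ U : Set N, IsOpen U ∧ x₀ ∈ U ∧ ∃ b : N → FrameBundle F E Ω.bilin (Fin k ⊕ Fin m),
      ContinuousOn b U ∧ ∀ x, (b x).base = x ∧ IsAdapted I o (b x) := by
  refine exists_section_of_local (fun x₀ => ?_) x₀
  obtain ⟨U₀, hU₀, hx₀, s, hs, hc⟩ := hI x₀
  obtain ⟨U₁, hU₁, hU₁o, hx₁, f, hf⟩ := exists_isLocalPartialFrame (Ω := Ω) hU₀ hx₀ hs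
    (by
      obtain ⟨c, hc, -⟩ := hc x₀ hx₀
      simp only [← hc]
      exact c.linearIndependent.map' (I x₀).subtype (Submodule.ker_subtype _))
    (fun x hx i j => by
      obtain ⟨c, hc, -⟩ := hc x hx
      rw [← hc, ← hc]
      exact hiso x _ (c i).2 _ (c j).2)
  obtain ⟨U, hU, hUo, hx, e', f', h, he'⟩ := hf.exists_sum_fin hU₁o hx₁ m (by
    rw [hrank, Fintype.card_fin])
  have hfd : ∀ x, FiniteDimensional ℝ (E x) := fun x => finiteDimensional_fiber (F := F) x
  have hcard : ∀ x, Module.finrank ℝ (E x) = 2 * Fintype.card (Fin k ⊕ Fin m) := fun x => by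
    rw [finrank_fiber (F := F), hrank, Fintype.card_sum, Fintype.card_fin, Fintype.card_fin]
  refine ⟨U, hUo, hx, fun x => ⟨x, (h.isPartialFrame x x.2).toFrame (Ω.bilin_isAlt x) (hcard x)⟩,
    FrameBundle.continuous_iff.2 ⟨continuous_subtype_val, fun j => ?_⟩, fun x => ⟨rfl, ?_⟩⟩
  · simp only [IsPartialFrame.toFrame_basis]
    rcases j with j | j
    · exact continuousOn_iff_continuous_domRestrict.1 (h.continuousOn_left j)
    · exact continuousOn_iff_continuous_domRestrict.1 (h.continuousOn_right j)
  -- The completion never alters the given sections of `I`, so the oriented basis supplied by the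
  -- subbundle is the one required.
  · obtain ⟨c, hc, hco⟩ := hc x (hU₁ (hU x.2))
    refine ⟨c, fun i => ?_, hco⟩
    rw [hc, IsPartialFrame.toFrame_basis, Sum.elim_inl, he']

end LocalFrames

/-! ### Adapted frames of one space: `Sp₊(k, ℓ)` and the normal frame -/

section AdaptedFrames

variable {κ ι : Type*} [Fintype κ] [DecidableEq κ] [Fintype ι] [DecidableEq ι]
  {V : Type*} [AddCommGroup V] [Module ℝ V] {B : LinearMap.BilinForm ℝ V} {I : Submodule ℝ V}

namespace SymplecticFrame

theorem act_basis_isotropic (b : SymplecticFrame (κ ⊕ ι) B) {A : Sp (κ ⊕ ι)} (hA : IsSpPlus A)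
    (j : κ) : (b.act A).basis (Sum.inl (Sum.inl j)) =
      ∑ i, A.1.toBlocks₁₁.toBlocks₁₁ i j • b.basis (Sum.inl (Sum.inl i)) := by
  have h1 : ∀ i, A.1 (Sum.inl (Sum.inr i)) (Sum.inl (Sum.inl j)) = 0 :=
    fun i => congrFun (congrFun hA.1 i) j
  have h2 : ∀ i, A.1 (Sum.inr (Sum.inl i)) (Sum.inl (Sum.inl j)) = 0 :=
    fun i => congrFun (congrFun hA.2.1 i) j
  have h3 : ∀ i, A.1 (Sum.inr (Sum.inr i)) (Sum.inl (Sum.inl j)) = 0 :=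
    fun i => congrFun (congrFun hA.2.2.1 i) j
  simp only [act_basis, Fintype.sum_sum_type, h1, h2, h3, zero_smul, Finset.sum_const_zero,
    add_zero]
  rfl

theorem repr_act (b : SymplecticFrame ι B) (A : Sp ι) (i j : ι ⊕ ι) :
    b.basis.repr ((b.act A).basis j) i = A.1 i j := by
  rw [act_basis, b.basis.repr_sum_self]

theorem exists_basis_act (b : SymplecticFrame (κ ⊕ ι) B) {A : Sp (κ ⊕ ι)} (hA : IsSpPlus A)
    {o : Orientation ℝ I κ} (h : ∃ c : Module.Basis κ ℝ I,
      (∀ i, (c i : V) = b.basis (Sum.inl (Sum.inl i))) ∧ c.orientation = o) :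
    ∃ c : Module.Basis κ ℝ I,
      (∀ i, (c i : V) = (b.act A).basis (Sum.inl (Sum.inl i))) ∧ c.orientation = o := by
  obtain ⟨c, hc, rfl⟩ := h
  have hu : IsUnit A.1.toBlocks₁₁.toBlocks₁₁.det := hA.2.2.2.ne'.isUnit
  have hb : ∀ j, (c.map (Matrix.toLinearEquiv c A.1.toBlocks₁₁.toBlocks₁₁ hu)) j =
      ∑ i, A.1.toBlocks₁₁.toBlocks₁₁ i j • c i := fun j => by
    rw [Module.Basis.map_apply]
    exact Matrix.toLin_self c c _ j
  refine ⟨c.map (Matrix.toLinearEquiv c A.1.toBlocks₁₁.toBlocks₁₁ hu), fun j => ?_, ?_⟩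
  · rw [hb, act_basis_isotropic b hA]
    simp only [Submodule.coe_sum, Submodule.coe_smul, hc]
  · rw [eq_comm, Module.Basis.orientation_eq_iff_det_pos, Module.Basis.det_apply]
    have : c.toMatrix (c.map (Matrix.toLinearEquiv c A.1.toBlocks₁₁.toBlocks₁₁ hu)) =
        A.1.toBlocks₁₁.toBlocks₁₁ := by
      ext i j
      rw [Module.Basis.toMatrix_apply, hb, c.repr_sum_self]
    rw [this]
    exact hA.2.2.2

/-- The first `k` columns of `A` are the coordinates of `c'`, which only involve the first `k`
vectors of `b`, and their upper block is the transition matrix from `c` to `c'`, of positive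
determinant. With `exists_basis_act` this shows that the adapted frames of a fibre form a single
`Sp₊(k, ℓ)`-orbit, if there are any. -/
theorem isSpPlus_of_basis (b : SymplecticFrame (κ ⊕ ι) B) {A : Sp (κ ⊕ ι)}
    {c c' : Module.Basis κ ℝ I} (hc : ∀ i, (c i : V) = b.basis (Sum.inl (Sum.inl i)))
    (hc' : ∀ i, (c' i : V) = (b.act A).basis (Sum.inl (Sum.inl i)))
    (ho : c.orientation = c'.orientation) : IsSpPlus A := by
  have hs : ∀ j, (b.act A).basis (Sum.inl (Sum.inl j)) = ∑ i : (κ ⊕ ι) ⊕ (κ ⊕ ι),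
      Sum.elim (Sum.elim (fun i => c.toMatrix c' i j) 0) 0 i • b.basis i := by
    intro j
    have h := congrArg Subtype.val (c.sum_repr (c' j))
    simp only [Submodule.coe_sum, Submodule.coe_smul, hc] at h
    rw [← hc', ← h]
    simp [Fintype.sum_sum_type, Module.Basis.toMatrix_apply]
  have h : ∀ i j, A.1 i (Sum.inl (Sum.inl j)) =
      (Sum.elim (Sum.elim (fun i => c.toMatrix c' i j) 0) 0 : (κ ⊕ ι) ⊕ (κ ⊕ ι) → ℝ) i := by
    intro i j
    rw [← b.repr_act A, hs, b.basis.repr_sum_self]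
  refine ⟨?_, ?_, ?_, ?_⟩
  · ext i j; exact h _ j
  · ext i j; exact h _ j
  · ext i j; exact h _ j
  · have : A.1.toBlocks₁₁.toBlocks₁₁ = c.toMatrix c' := by
      ext i j; exact h _ j
    rw [this, ← Module.Basis.det_apply]
    exact (Module.Basis.orientation_eq_iff_det_pos _ _).1 ho

/-- In `b.act A` the vectors with index greater than `k` have no component along `f i` for `i ≤ k`,
because those blocks of `A` vanish, and their components along `e i` for `i ≤ k` lie in `I`. Modulo
`I` only the blocks of `normalMat` remain. -/
theorem normal_act (hB : B.IsAlt) (b : SymplecticFrame (κ ⊕ ι) B) {A : Sp (κ ⊕ ι)}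
    (hA : IsSpPlus A)
    (h : ∃ c : Module.Basis κ ℝ I, ∀ i, (c i : V) = b.basis (Sum.inl (Sum.inl i)))
    (h' : ∃ c : Module.Basis κ ℝ I, ∀ i, (c i : V) = (b.act A).basis (Sum.inl (Sum.inl i))) :
    (b.act A).normal hB h' = (b.normal hB h).act hA.normalMat := by
  refine ext_basis fun j => ?_
  have mem : ∀ i : ι ⊕ ι, b.basis (Sum.map Sum.inr Sum.inr i) ∈ B.orthogonal I :=
    fun i => h.elim fun c hc => frame_mem_orthogonal b c hc i
  have e1 : ((b.normal hB h).act hA.normalMat).basis j =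
      (I.submoduleOf (B.orthogonal I)).mkQ (∑ i : ι ⊕ ι, hA.normalMat.1 i j •
        (⟨b.basis (Sum.map Sum.inr Sum.inr i), mem i⟩ : B.orthogonal I)) := by
    simp only [act_basis, normal_basis, map_sum, map_smul]
    rfl
  rw [e1, normal_basis]
  refine (Submodule.Quotient.eq _).2 ?_
  obtain ⟨c, hc⟩ := h
  obtain ⟨h1, h2, -, -⟩ := hA.blocks
  have h1' : ∀ i j, A.1 (Sum.inr (Sum.inl i)) (Sum.inl (Sum.inr j)) = 0 :=
    fun i j => congrFun (congrFun h1 i) j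
  have h2' : ∀ i j, A.1 (Sum.inr (Sum.inl i)) (Sum.inr (Sum.inr j)) = 0 :=
    fun i j => congrFun (congrFun h2 i) j
  change (b.act A).basis (Sum.map Sum.inr Sum.inr j) - ((∑ i : ι ⊕ ι, hA.normalMat.1 i j •
    (⟨b.basis (Sum.map Sum.inr Sum.inr i), mem i⟩ : B.orthogonal I) : B.orthogonal I) : V) ∈ I
  have e2 : (b.act A).basis (Sum.map Sum.inr Sum.inr j) - ((∑ i : ι ⊕ ι, hA.normalMat.1 i j •
      (⟨b.basis (Sum.map Sum.inr Sum.inr i), mem i⟩ : B.orthogonal I) : B.orthogonal I) : V) =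
      ∑ i : κ, A.1 (Sum.inl (Sum.inl i)) (Sum.map Sum.inr Sum.inr j) • (c i : V) := by
    rw [sub_eq_iff_eq_add, act_basis, Submodule.coe_sum]
    simp only [Submodule.coe_smul, Fintype.sum_sum_type, hc, Sum.map_inl, Sum.map_inr]
    rcases j with j | j
    · simp only [Sum.map_inl, h1', zero_smul, Finset.sum_const_zero, zero_add, add_assoc]
      rfl
    · simp only [Sum.map_inr, h2', zero_smul, Finset.sum_const_zero, zero_add, add_assoc]
      rfl
  rw [e2]
  exact I.sum_mem fun i _ => I.smul_mem _ (c i).2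

end SymplecticFrame

end AdaptedFrames

/-! ### The bundle of normal frames and continuity of change of frame -/

section NormalFrames

universe u v

variable {N : Type u} [TopologicalSpace N] {F : Type*} [NormedAddCommGroup F] [NormedSpace ℝ F]
  {E : N → Type v} [TopologicalSpace (TotalSpace F E)]
  [∀ x, TopologicalSpace (E x)] [∀ x, AddCommGroup (E x)] [∀ x, Module ℝ (E x)]
  [∀ x, IsTopologicalAddGroup (E x)] [∀ x, ContinuousConstSMul ℝ (E x)]
  [FiberBundle F E] [VectorBundle ℝ F E]
  {Ω : SymplecticForm F E} {κ ι : Type} [Fintype κ] [DecidableEq κ] [Fintype ι] [DecidableEq ι]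
  {I : ∀ x, Submodule ℝ (E x)} {o : ∀ x, Orientation ℝ (I x) κ} {F' : Type*}
  {X : Type*} [TopologicalSpace X]

namespace IsAdapted

theorem act {b : FrameBundle F E Ω.bilin (κ ⊕ ι)} (h : IsAdapted I o b) {A : Sp (κ ⊕ ι)}
    (hA : IsSpPlus A) : IsAdapted I o (b.act A) :=
  b.frame.exists_basis_act hA h

theorem isSpPlus {b : FrameBundle F E Ω.bilin (κ ⊕ ι)} (h : IsAdapted I o b) {A : Sp (κ ⊕ ι)}
    (h' : IsAdapted I o (b.act A)) : IsSpPlus A := by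
  obtain ⟨c, hc, ho⟩ := h
  obtain ⟨c', hc', ho'⟩ := h'
  exact b.frame.isSpPlus_of_basis hc hc' (ho.trans ho'.symm)

theorem normal_act {b : FrameBundle F E Ω.bilin (κ ⊕ ι)} (h : IsAdapted I o b)
    {A : Sp (κ ⊕ ι)} (hA : IsSpPlus A) (h' : IsAdapted I o (b.act A)) :
    h'.normal F' = (h.normal F').act hA.normalMat :=
  congrArg (FrameBundle.mk b.base) (SymplecticFrame.normal_act (Ω.bilin_isAlt b.base) b.frame hA
    (h.imp fun _ hc => hc.1) (h'.imp fun _ hc => hc.1))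

theorem normal_congr {b b' : FrameBundle F E Ω.bilin (κ ⊕ ι)} (h : IsAdapted I o b)
    (h' : IsAdapted I o b') (hb : b = b') : h.normal F' = h'.normal F' := by
  subst hb
  rfl

variable (F') in
/-- The projection `Bp₊(I, E) → Bp(N_I)` is continuous. -/
theorem continuous_normal {b : X → FrameBundle F E Ω.bilin (κ ⊕ ι)} (hb : Continuous b)
    (h : ∀ x, IsAdapted I o (b x)) : Continuous fun x => (h x).normal F' := by
  rw [FrameBundle.continuous_iff] at hb ⊢
  refine ⟨hb.1, fun j => ?_⟩
  have mem : ∀ x, (b x).frame.basis (Sum.map Sum.inr Sum.inr j) ∈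
      (Ω.bilin (b x).base).orthogonal (I (b x).base) := fun x =>
    (h x).elim fun c hc => frame_mem_orthogonal (b x).frame c hc.1 j
  have h1 : Continuous fun x =>
      (⟨⟨(b x).base, (b x).frame.basis (Sum.map Sum.inr Sum.inr j)⟩, mem x⟩ :
        {p : TotalSpace F E // p.2 ∈ (Ω.bilin p.1).orthogonal (I p.1)}) :=
    (hb.2 _).subtype_mk _
  refine (continuous_coinduced_rng.comp h1).congr fun x => ?_
  exact congrArg (TotalSpace.mk (b x).base) (SymplecticFrame.normal_basis _ _
    ((h x).imp fun _ hc => hc.1) j).symm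

end IsAdapted

theorem isQuotientMap_normalBundle (Ω : SymplecticForm F E) (I : ∀ x, Submodule ℝ (E x))
    (F' : Type*) : IsQuotientMap
      (fun p : {p : TotalSpace F E // p.2 ∈ (Ω.bilin p.1).orthogonal (I p.1)} =>
      (⟨p.1.1, (Submodule.Quotient.mk ⟨p.1.2, p.2⟩ : NormalSpace (Ω.bilin p.1.1) (I p.1.1))⟩ :
        TotalSpace F' (NormalBundle Ω I))) where
  eq_coinduced := rfl
  surjective := by
    rintro ⟨x, v⟩
    obtain ⟨w, rfl⟩ := Submodule.Quotient.mk_surjective _ v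
    exact ⟨⟨⟨x, w.1⟩, w.2⟩, rfl⟩

/-- By the quotient topology, continuity may be tested on `I^⊥` over the open set `U`, where the
function is `Ω` paired with `w`. This replaces a local trivialization of the normal bundle. -/
theorem continuousOn_normalForm {U : Set N} (hU : IsOpen U) {w : ∀ x, E x}
    (hw : ContinuousOn (fun x => (⟨x, w x⟩ : TotalSpace F E)) U)
    (hmem : ∀ x, w x ∈ (Ω.bilin x).orthogonal (I x)) :
    ContinuousOn (fun p : TotalSpace F' (NormalBundle Ω I) => normalForm Ω I p.1
      (Submodule.Quotient.mk ⟨w p.1, hmem p.1⟩ : NormalSpace (Ω.bilin p.1) (I p.1)) p.2)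
      (TotalSpace.proj ⁻¹' U) := by
  have hq := isQuotientMap_normalBundle Ω I F'
  have hp : Continuous fun p : {p : TotalSpace F E // p.2 ∈ (Ω.bilin p.1).orthogonal (I p.1)} =>
      p.1.1 := (FiberBundle.continuous_proj F E).comp continuous_subtype_val
  have hV : IsOpen (TotalSpace.proj ⁻¹' U : Set (TotalSpace F' (NormalBundle Ω I))) :=
    hq.isOpen_preimage.1 (hU.preimage hp)
  refine (hq.continuousOn_isOpen_iff hV).2 (continuousOn_iff_continuous_domRestrict.2 ?_)
  have h1 := continuousOn_iff_continuous_domRestrict.1 hw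
  have hv : Continuous fun p : ↥((fun p : {p : TotalSpace F E //
      p.2 ∈ (Ω.bilin p.1).orthogonal (I p.1)} => p.1.1) ⁻¹' U) => (⟨p.1.1.1, p.2⟩ : U) :=
    Continuous.subtype_mk (f := fun p : ↥((fun p : {p : TotalSpace F E //
      p.2 ∈ (Ω.bilin p.1).orthogonal (I p.1)} => p.1.1) ⁻¹' U) => p.1.1.1)
      (hp.comp continuous_subtype_val) fun p => p.2
  have hp2 : Continuous fun p : ↥((fun p : {p : TotalSpace F E //
      p.2 ∈ (Ω.bilin p.1).orthogonal (I p.1)} => p.1.1) ⁻¹' U) => p.1.1 :=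
    continuous_subtype_val.comp continuous_subtype_val
  exact Ω.continuous_apply (f := fun p : ↥((fun p : {p : TotalSpace F E //
    p.2 ∈ (Ω.bilin p.1).orthogonal (I p.1)} => p.1.1) ⁻¹' U) => p.1.1.1)
    (v := fun p => w p.1.1.1) (w := fun p => p.1.1.2) (h1.comp hv) hp2

/-- Continuity of the change of frame in `V`, over subsets of the base. -/
def FrameBundle.HasContinuousDiv {N : Type u} [TopologicalSpace N] (F : Type*) (V : N → Type v)
    [∀ x, AddCommGroup (V x)] [∀ x, Module ℝ (V x)] [TopologicalSpace (TotalSpace F V)]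
    (B : ∀ x, LinearMap.BilinForm ℝ (V x)) (ι : Type*) [Fintype ι] [DecidableEq ι] : Prop :=
  ∀ (U : Set N) (b : U → FrameBundle F V B ι) (A : U → Sp ι), Continuous b →
    (Continuous fun x => (b x).act (A x)) → Continuous A

/-- Continuous division is all that lifting frames to a metaplectic structure requires; isolating it
lets `exists_local_lift` apply to `E` and to `N_I` alike. -/
theorem FrameBundle.hasContinuousDiv : HasContinuousDiv F E Ω.bilin ι :=
  fun _ _ _ hb hA => FrameBundle.continuous_div hb hA

/-- The coordinates of normal frames with respect to a local adapted frame are continuous. -/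
theorem continuous_normal_coord {U : Set N} (hU : IsOpen U)
    {b : N → FrameBundle F E Ω.bilin (κ ⊕ ι)} (hb : ContinuousOn b U)
    (hbx : ∀ x, (b x).base = x ∧ IsAdapted I o (b x))
    {c : X → FrameBundle F' (NormalBundle Ω I) (normalForm Ω I) ι} (hc : Continuous c)
    (hcU : ∀ x, (c x).base ∈ U) {C : X → Sp ι}
    (hC : ∀ x, c x = ((hbx (c x).base).2.normal F').act (C x)) : Continuous C := by
  -- The frame `b x` lives in the fibre over `(b x).base`, which equals `x` only propositionally.
  -- Writing it as `⟨x, f x⟩` makes the equality of base points definitional.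
  have hs : ∀ x, ∃ f : SymplecticFrame (κ ⊕ ι) (Ω.bilin x), b x = ⟨x, f⟩ := fun x => by
    obtain ⟨h, -⟩ := hbx x
    revert h
    generalize b x = y
    rintro rfl
    exact ⟨_, rfl⟩
  choose f hf using hs
  obtain rfl : b = fun x => ⟨x, f x⟩ := funext hf
  refine FrameBundle.continuous_div_of_form
    (b := fun x => (hbx (c x).base).2.normal F') fun i j => ?_
  have hmem : ∀ x, (f x).basis (Sum.map Sum.inr Sum.inr i) ∈ (Ω.bilin x).orthogonal (I x) :=
    fun x => (hbx x).2.elim fun c hc => frame_mem_orthogonal (f x) c hc.1 i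
  have hfc : ContinuousOn (fun x => (⟨x, (f x).basis (Sum.map Sum.inr Sum.inr i)⟩ :
      TotalSpace F E)) U :=
    continuousOn_iff_continuous_domRestrict.2
      ((FrameBundle.continuous_iff.1 (continuousOn_iff_continuous_domRestrict.1 hb)).2 _)
  have h1 := continuousOn_normalForm (F' := F') hU hfc hmem
  have h2 := h1.comp_continuous ((FrameBundle.continuous_iff.1 hc).2 j) hcU
  refine h2.congr fun x => ?_
  have h3 : (⟨(c x).base, (c x).frame.basis j⟩ : TotalSpace F' (NormalBundle Ω I)) =
      ⟨(c x).base, (((hbx (c x).base).2.normal F').frame.act (C x)).basis j⟩ := by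
    have := congrArg (fun y : FrameBundle F' (NormalBundle Ω I) (normalForm Ω I) ι =>
      (⟨y.base, y.frame.basis j⟩ : TotalSpace F' (NormalBundle Ω I))) (hC x)
    exact this
  have h4 := eq_of_heq (TotalSpace.mk.inj h3).2
  have h5 := SymplecticFrame.normal_basis (Ω.bilin_isAlt (c x).base) (f (c x).base)
    ((hbx (c x).base).2.imp fun _ hc => hc.1) i
  change normalForm Ω I (c x).base _ ((c x).frame.basis j) = _
  rw [h4]
  exact congrArg (fun y => normalForm Ω I (c x).base y _) h5.symm

/-- Change of normal frame is continuous. -/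
theorem hasContinuousDiv_normal
    (hloc : ∀ x₀, ∃ U : Set N, IsOpen U ∧ x₀ ∈ U ∧ ∃ b : N → FrameBundle F E Ω.bilin (κ ⊕ ι),
      ContinuousOn b U ∧ ∀ x, (b x).base = x ∧ IsAdapted I o (b x)) :
    FrameBundle.HasContinuousDiv F' (NormalBundle Ω I) (normalForm Ω I) ι := by
  intro U c C hc hcC
  refine continuous_of_local fun x => ?_
  obtain ⟨W, hW, hxW, b, hb, hbx⟩ := hloc (c x).base
  have hcb : Continuous fun x => (c x).base := FrameBundle.continuous_base.comp hc
  -- Both the frame and its translate are compared with the normal frame of the local adapted frame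
  -- `b`. Their coordinates `A` and `A'` are continuous, and `C = A⁻¹ A'`.
  have h1 : ∀ x, ∃ A : Sp ι, c x = ((hbx (c x).base).2.normal F').act A := fun x =>
    FrameBundle.exists_act (hbx (c x).base).1
  have h2 : ∀ x, ∃ A : Sp ι, (c x).act (C x) = ((hbx (c x).base).2.normal F').act A := fun x =>
    FrameBundle.exists_act (hbx (c x).base).1
  choose A hA using h1
  choose A' hA' using h2
  refine ⟨_, hW.preimage hcb, hxW, ?_⟩
  have c1 := continuous_normal_coord (X := ↥((fun x => (c x).base) ⁻¹' W)) hW hb hbx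
    (hc.comp continuous_subtype_val) (fun x => x.2) (C := fun x => A x) (fun x => hA x)
  have c2 := continuous_normal_coord (X := ↥((fun x => (c x).base) ⁻¹' W)) hW hb hbx
    (hcC.comp continuous_subtype_val) (fun x => x.2) (C := fun x => A' x) (fun x => hA' x)
  refine (c1.inv.mul c2).congr fun x => ?_
  change (A x)⁻¹ * A' x = C x
  rw [inv_mul_eq_iff_eq_mul]
  apply FrameBundle.act_injective ((hbx (c x).base).2.normal F')
  rw [← hA' x, FrameBundle.act_mul, ← hA x]

end NormalFrames

/-! ### Lifting frames, and a criterion for equivalence -/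

section MetaplecticStructures

universe u v

variable {N : Type u} [TopologicalSpace N] {F : Type*} {V : N → Type v}
  [∀ x, AddCommGroup (V x)] [∀ x, Module ℝ (V x)] [TopologicalSpace (TotalSpace F V)]
  {B : ∀ x, LinearMap.BilinForm ℝ (V x)} {ι : Type} [Fintype ι] [DecidableEq ι]

open MulOpposite

namespace MetaplecticStructure

theorem toFrame_op_smul (P : MetaplecticStructure F V B ι) (g : Mp ι) (p : P.carrier) :
    P.toFrame (op g • p) = (P.toFrame p).act g.mat :=
  P.toFrame_smul g p

theorem continuous_proj (P : MetaplecticStructure F V B ι) :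
    Continuous fun p : P.carrier => (P.toFrame p).base :=
  P.principal.continuous

/-- Local frames lift to local sections of a metaplectic structure. -/
theorem exists_local_lift (P : MetaplecticStructure F V B ι)
    (hdiv : FrameBundle.HasContinuousDiv F V B ι) {U : Set N} (hU : IsOpen U) {x₀ : N}
    (hx : x₀ ∈ U) {b : N → FrameBundle F V B ι} (hb : ContinuousOn b U)
    (hbx : ∀ x, (b x).base = x) : ∃ U' ⊆ U, IsOpen U' ∧ x₀ ∈ U' ∧ ∃ σ : N → P.carrier,
      ContinuousOn σ U' ∧ ∀ x, P.toFrame (σ x) = b x := by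
  obtain ⟨W, hW, hxW, τ, hτ, hτc⟩ := P.principal.exists_local_section x₀
  -- The frame `b` is the frame of the section `τ` moved by a continuous `A`. A local section of
  -- `Mp(ℓ) → Sp(ℓ)` near `A x₀` lifts `A`, and acting by the lift moves `τ` to a section over `b`.
  have hA : ∀ x, ∃ A : Sp ι, b x = (P.toFrame (τ x)).act A := fun x =>
    FrameBundle.exists_act ((hτ x).trans (hbx x).symm)
  choose A hA using hA
  have hAc : ContinuousOn A (U ∩ W) := by
    rw [continuousOn_iff_continuous_domRestrict]
    refine hdiv _ (fun x => P.toFrame (τ x)) _ ?_ ?_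
    · exact P.continuous_toFrame.comp (continuousOn_iff_continuous_domRestrict.1
        (hτc.mono Set.inter_subset_right))
    · refine (continuousOn_iff_continuous_domRestrict.1 (hb.mono Set.inter_subset_left)).congr
        fun x => hA x
  obtain ⟨W', hW', hA₀, l, hl, hlc⟩ := Mp.exists_local_section (A x₀)
  refine ⟨(U ∩ W) ∩ A ⁻¹' W', fun x hx => hx.1.1, hAc.isOpen_inter_preimage (hU.inter hW) hW',
    ⟨⟨hx, hxW⟩, hA₀⟩, fun x => op (l (A x)) • τ x, ?_, fun x => ?_⟩
  · rw [continuousOn_iff_continuous_domRestrict]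
    refine P.principal.continuous_smul (X := ↥((U ∩ W) ∩ A ⁻¹' W')) (f := fun x => τ x)
      (g := fun x => l (A x)) ?_ ?_
    · exact continuousOn_iff_continuous_domRestrict.1 (hτc.mono fun x hx => hx.1.2)
    · exact continuousOn_iff_continuous_domRestrict.1
        (hlc.comp (hAc.mono Set.inter_subset_left) fun x hx => hx.2)
  · rw [toFrame_op_smul, hl, hA]

/-- Locally `p = σ(x) g(p)` with `x` the base point of `p` and `g` continuous by division, so `e p =
e(σ(x)) g(p)` is continuous by continuity of the action. -/
theorem continuous_of_local_section {P P' : MetaplecticStructure F V B ι}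
    {e : P.carrier → P'.carrier} (hs : ∀ (g : Mp ι) p, e (op g • p) = op g • e p)
    (h : ∀ x₀, ∃ U : Set N, IsOpen U ∧ x₀ ∈ U ∧ ∃ σ : N → P.carrier,
      (∀ x, (P.toFrame (σ x)).base = x) ∧ ContinuousOn σ U ∧ ContinuousOn (fun x => e (σ x)) U) :
    Continuous e := by
  refine continuous_of_local fun p => ?_
  obtain ⟨U, hU, hp, σ, hσ, hc, hec⟩ := h (P.toFrame p).base
  have hg : ∀ p, ∃ g : Mp ι, p = op g • σ (P.toFrame p).base := fun p =>
    P.principal.exists_smul (hσ _)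
  choose g hg using hg
  refine ⟨_, hU.preimage P.continuous_proj, hp, ?_⟩
  have hπ : Continuous fun q : ↥((fun p : P.carrier => (P.toFrame p).base) ⁻¹' U) =>
      (⟨(P.toFrame q.1).base, q.2⟩ : U) :=
    (P.continuous_proj.comp continuous_subtype_val).subtype_mk _
  have hgc : Continuous fun q : ↥((fun p : P.carrier => (P.toFrame p).base) ⁻¹' U) => g q :=
    P.principal.continuous_div ((continuousOn_iff_continuous_domRestrict.1 hc).comp hπ)
      continuous_subtype_val fun q => hg q
  refine (P'.principal.continuous_smul ((continuousOn_iff_continuous_domRestrict.1 hec).comp hπ)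
    hgc).congr fun q => ?_
  change op (g q) • e (σ (P.toFrame q.1).base) = e q
  rw [← hs, ← hg]

/-- An equivariant map over the frame bundle which maps local sections to continuous maps is an
equivalence. -/
theorem equiv_of_local_section {P P' : MetaplecticStructure F V B ι} {e : P.carrier → P'.carrier}
    (hf : ∀ p, P'.toFrame (e p) = P.toFrame p) (hs : ∀ (g : Mp ι) p, e (op g • p) = op g • e p)
    (h : ∀ x₀, ∃ U : Set N, IsOpen U ∧ x₀ ∈ U ∧ ∃ σ : N → P.carrier,
      (∀ x, (P.toFrame (σ x)).base = x) ∧ ContinuousOn σ U ∧ ContinuousOn (fun x => e (σ x)) U) :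
    P ≈ P' := by
  have hbij : Function.Bijective e := by
    constructor
    · intro p p' hp
      obtain ⟨g, rfl⟩ := P.principal.exists_smul (p := p) (p' := p') (by
        rw [← hf, hp, hf])
      rw [hs] at hp
      rw [P'.principal.eq_one_of_smul_eq hp.symm, op_one, one_smul]
    · intro q
      obtain ⟨U, hU, hx, σ, hσ, -⟩ := h (P'.toFrame q).base
      obtain ⟨g, hg⟩ := P'.principal.exists_smul (p := e (σ (P'.toFrame q).base)) (p' := q) (by
        rw [hf, hσ])
      exact ⟨op g • σ (P'.toFrame q).base, by rw [hs, ← hg]⟩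
  let e' := Equiv.ofBijective e hbij
  refine ⟨⟨e', continuous_of_local_section hs h, ?_⟩, hf, hs⟩
  -- The inverse is again equivariant, and it maps the local sections `e ∘ σ` to the continuous `σ`.
  refine continuous_of_local_section (fun g q => ?_) fun x₀ => ?_
  · change e'.symm (op g • q) = op g • e'.symm q
    rw [Equiv.symm_apply_eq]
    change _ = e (op g • e'.symm q)
    rw [hs]
    exact congrArg _ (e'.apply_symm_apply q).symm
  · obtain ⟨U, hU, hx, σ, hσ, hc, hec⟩ := h x₀
    refine ⟨U, hU, hx, fun x => e (σ x), fun x => by rw [hf, hσ], hec, hc.congr fun x _ => ?_⟩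
    exact e'.symm_apply_apply _

end MetaplecticStructure

end MetaplecticStructures

/-! ### The quotient `Mp₊(I, E) / Z` as a metaplectic structure -/

section Reduction

universe u v

variable {N : Type u} [TopologicalSpace N] {F : Type*} [NormedAddCommGroup F] [NormedSpace ℝ F]
  {E : N → Type v} [TopologicalSpace (TotalSpace F E)]
  [∀ x, TopologicalSpace (E x)] [∀ x, AddCommGroup (E x)] [∀ x, Module ℝ (E x)]
  [∀ x, IsTopologicalAddGroup (E x)] [∀ x, ContinuousConstSMul ℝ (E x)]
  [FiberBundle F E] [VectorBundle ℝ F E]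
  {Ω : SymplecticForm F E} {κ ι : Type} [Fintype κ] [DecidableEq κ] [Fintype ι] [DecidableEq ι]
  {I : ∀ x, Submodule ℝ (E x)} {o : ∀ x, Orientation ℝ (I x) κ}

open MulOpposite

/-- The bundle `Mp₊(I, E)`. -/
abbrev AdaptedPart (P : MetaplecticStructure F E Ω.bilin (κ ⊕ ι)) (I : ∀ x, Submodule ℝ (E x))
    (o : ∀ x, Orientation ℝ (I x) κ) : Type _ :=
  {p : P.carrier // IsAdapted I o (P.toFrame p)}

variable {P : MetaplecticStructure F E Ω.bilin (κ ⊕ ι)}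

namespace AdaptedPart

/-- The right action of `Mp₊(k, ℓ)` on `Mp₊(I, E)`. -/
def act (p : AdaptedPart P I o) (g : MpPlus κ ι) : AdaptedPart P I o :=
  ⟨op g.1 • p.1, by
    rw [P.toFrame_op_smul]
    exact p.2.act g.2⟩

theorem act_one (p : AdaptedPart P I o) : p.act 1 = p :=
  Subtype.ext (one_smul _ _)

theorem act_mul (p : AdaptedPart P I o) (g g' : MpPlus κ ι) :
    p.act (g * g') = (p.act g).act g' :=
  Subtype.ext (mul_smul (op g'.1) (op g.1) p.1)

theorem act_injective (p : AdaptedPart P I o) {g g' : MpPlus κ ι} (h : p.act g = p.act g') :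
    g = g' :=
  Subtype.ext (P.principal.smul_left_cancel (congrArg Subtype.val h))

theorem exists_act {p p' : AdaptedPart P I o} (h : (P.toFrame p.1).base = (P.toFrame p'.1).base) :
    ∃ g : MpPlus κ ι, p' = p.act g := by
  obtain ⟨g, hg⟩ := P.principal.exists_smul h
  have hf := P.toFrame_op_smul g p.1
  rw [← hg] at hf
  exact ⟨⟨g, p.2.isSpPlus (hf ▸ p'.2)⟩, Subtype.ext hg⟩

theorem normal_act (p : AdaptedPart P I o) (g : MpPlus κ ι) (F' : Type*) :
    (p.act g).2.normal F' = (p.2.normal F').act (normalHom g).mat :=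
  ((p.act g).2.normal_congr (p.2.act g.2) (P.toFrame_op_smul g.1 p.1)).trans
    (p.2.normal_act g.2 _)

end AdaptedPart

/-- The orbits of the kernel of `Mp₊(k, ℓ) → Mp(ℓ - k)` on `Mp₊(I, E)`. -/
def reductionSetoid (P : MetaplecticStructure F E Ω.bilin (κ ⊕ ι)) (I : ∀ x, Submodule ℝ (E x))
    (o : ∀ x, Orientation ℝ (I x) κ) : Setoid (AdaptedPart P I o) where
  r p p' := ∃ g : MpPlus κ ι, normalHom g = 1 ∧ p' = p.act g
  iseqv :=
    { refl := fun p => ⟨1, map_one _, p.act_one.symm⟩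
      symm := by
        rintro p _ ⟨g, hg, rfl⟩
        exact ⟨g⁻¹, by rw [map_inv, hg, inv_one],
          by rw [← AdaptedPart.act_mul, mul_inv_cancel, AdaptedPart.act_one]⟩
      trans := by
        rintro p _ _ ⟨g, hg, rfl⟩ ⟨g', hg', rfl⟩
        exact ⟨g * g', by rw [map_mul, hg, hg', one_mul], (p.act_mul g g').symm⟩ }

/-- The quotient `Mp₊(I, E) / Z`. -/
def ReductionCarrier (P : MetaplecticStructure F E Ω.bilin (κ ⊕ ι)) (I : ∀ x, Submodule ℝ (E x))
    (o : ∀ x, Orientation ℝ (I x) κ) : Type _ := Quotient (reductionSetoid P I o)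

instance : TopologicalSpace (ReductionCarrier P I o) :=
  inferInstanceAs (TopologicalSpace (Quotient (reductionSetoid P I o)))

namespace ReductionCarrier

/-- The projection to the quotient. -/
def mk (p : AdaptedPart P I o) : ReductionCarrier P I o := Quotient.mk _ p

theorem isQuotientMap_mk : IsQuotientMap (mk : AdaptedPart P I o → ReductionCarrier P I o) :=
  isQuotientMap_quotient_mk'

theorem mk_eq_mk {p p' : AdaptedPart P I o} :
    mk p = mk p' ↔ ∃ g : MpPlus κ ι, normalHom g = 1 ∧ p' = p.act g :=
  Quotient.eq (r := reductionSetoid P I o)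

theorem mk_surjective : Function.Surjective (mk : AdaptedPart P I o → _) :=
  isQuotientMap_mk.surjective

theorem mk_act_congr (p : AdaptedPart P I o) {g g' : MpPlus κ ι} (h : normalHom g = normalHom g') :
    mk (p.act g) = mk (p.act g') :=
  mk_eq_mk.2 ⟨g⁻¹ * g', by rw [map_mul, map_inv, h, inv_mul_cancel],
    by rw [← AdaptedPart.act_mul, mul_inv_cancel_left]⟩

/-- An element acts through a lift to `Mp₊(k, ℓ)`. Two lifts differ by the kernel `Z`, so `mpEmbed`
could be replaced by any other lift; the action axioms follow from this independence, stated in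
`op_smul_mk`. -/
instance : SMul (Mp ι)ᵐᵒᵖ (ReductionCarrier P I o) where
  smul h := Quotient.map (fun p => p.act (mpEmbed κ h.unop)) (by
    rintro p _ ⟨g, hg, rfl⟩
    refine mk_eq_mk.1 ?_
    rw [← AdaptedPart.act_mul]
    exact mk_act_congr p (by rw [map_mul, hg, one_mul]))

theorem op_smul_mk (g : MpPlus κ ι) (p : AdaptedPart P I o) :
    op (normalHom g) • mk p = mk (p.act g) :=
  mk_act_congr p (normalHom_mpEmbed _)

instance : MulAction (Mp ι)ᵐᵒᵖ (ReductionCarrier P I o) where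
  one_smul q := by
    obtain ⟨p, rfl⟩ := mk_surjective q
    have h := op_smul_mk 1 p
    rwa [map_one, op_one, p.act_one] at h
  mul_smul h h' q := by
    obtain ⟨p, rfl⟩ := mk_surjective q
    have e : ∀ h : (Mp ι)ᵐᵒᵖ, h = op (normalHom (mpEmbed κ h.unop)) := fun h => by
      rw [normalHom_mpEmbed, op_unop]
    rw [e h, e h', ← op_mul, ← map_mul, op_smul_mk, op_smul_mk, op_smul_mk, p.act_mul]

/-- The projection to the bundle of symplectic frames of the normal bundle. -/
def toFrame (F' : Type*) (q : ReductionCarrier P I o) :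
    FrameBundle F' (NormalBundle Ω I) (normalForm Ω I) ι :=
  Quotient.lift (s := reductionSetoid P I o) (fun p => p.2.normal F') (by
    rintro p _ ⟨g, hg, rfl⟩
    rw [p.normal_act, hg, Mp.one_mat, FrameBundle.act_one]) q

theorem toFrame_mk (F' : Type*) (p : AdaptedPart P I o) : (mk p).toFrame F' = p.2.normal F' := rfl

theorem continuous_toFrame (F' : Type*) :
    Continuous (toFrame F' : ReductionCarrier P I o → _) :=
  isQuotientMap_mk.continuous_iff.2 <| IsAdapted.continuous_normal F'
    (P.continuous_toFrame.comp continuous_subtype_val) fun p => p.2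

theorem toFrame_smul (F' : Type*) (h : Mp ι) (q : ReductionCarrier P I o) :
    (op h • q).toFrame F' = (q.toFrame F').act h.mat := by
  obtain ⟨p, rfl⟩ := mk_surjective q
  rw [← normalHom_mpEmbed (κ := κ) h, op_smul_mk, toFrame_mk, p.normal_act, toFrame_mk]

/-- A local adapted frame lifts to a section of `P`, which takes values in `Mp₊(I, E)` and descends
to the quotient. Division by the descended section is the image under `normalHom` of division in
`P`. -/
theorem isPrincipalBundle (F' : Type*)
    (hloc : ∀ x₀, ∃ U : Set N, IsOpen U ∧ x₀ ∈ U ∧ ∃ b : N → FrameBundle F E Ω.bilin (κ ⊕ ι),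
      ContinuousOn b U ∧ ∀ x, (b x).base = x ∧ IsAdapted I o (b x)) :
    IsPrincipalBundle (Mp ι) fun q : ReductionCarrier P I o => (q.toFrame F').base := by
  have hproj : Continuous fun q : ReductionCarrier P I o => (q.toFrame F').base :=
    FrameBundle.continuous_base.comp (continuous_toFrame F')
  refine IsPrincipalBundle.of_local_sections hproj
    (fun h q => by rw [toFrame_smul, FrameBundle.act_base]) (fun h q hq => ?_) fun x₀ => ?_
  · obtain ⟨p, rfl⟩ := mk_surjective q
    rw [← normalHom_mpEmbed (κ := κ) h, op_smul_mk] at hq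
    obtain ⟨g, hg, hp⟩ := mk_eq_mk.1 hq
    have h1 : mpEmbed κ h * g = 1 := by
      apply p.act_injective
      rw [p.act_mul, ← hp, p.act_one]
    have h2 := congrArg normalHom h1
    rwa [map_mul, hg, mul_one, map_one, normalHom_mpEmbed] at h2
  · obtain ⟨U, hU, hx, b, hb, hbx⟩ := hloc x₀
    obtain ⟨W, hWU, hW, hxW, σ, hσ, hσb⟩ := P.exists_local_lift FrameBundle.hasContinuousDiv hU hx
      hb fun x => (hbx x).1
    let s : N → AdaptedPart P I o := fun x => ⟨σ x, by rw [hσb]; exact (hbx x).2⟩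
    have hs : ∀ x, (P.toFrame (s x).1).base = x := fun x => by rw [hσb, (hbx x).1]
    have hsx : ∀ x, ((mk (s x)).toFrame F').base = x := hs
    have hg : ∀ p : AdaptedPart P I o, ∃ g : MpPlus κ ι, p = (s (P.toFrame p.1).base).act g :=
      fun p => AdaptedPart.exists_act (hs _)
    choose g hg using hg
    have hd : ∀ q : ReductionCarrier P I o, ∃ h : Mp ι,
        q = op h • mk (s (q.toFrame F').base) := fun q => by
      obtain ⟨p, rfl⟩ := mk_surjective q
      refine ⟨normalHom (g p), ?_⟩
      rw [op_smul_mk]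
      exact congrArg mk (hg p)
    choose d hd using hd
    have hdg : ∀ p, d (mk p) = normalHom (g p) := fun p => by
      have h1 := hd (mk p)
      rw [← normalHom_mpEmbed (κ := κ) (d (mk p)), op_smul_mk] at h1
      obtain ⟨z, hz, hp⟩ := mk_eq_mk.1 h1
      have h2 : g p * z = mpEmbed κ (d (mk p)) := by
        apply (s (P.toFrame p.1).base).act_injective
        rw [AdaptedPart.act_mul, ← hg]
        exact hp.symm
      rw [← normalHom_mpEmbed (κ := κ) (d (mk p)), ← h2, map_mul, hz, mul_one]
    refine ⟨W, hW, hxW, fun x => mk (s x), d, hsx, hd, ?_, ?_⟩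
    -- Over the open set `W`, continuity of `d` can be tested before passing to the quotient, where
    -- it is `normalHom` of the continuous division in `P`.
    · rw [isQuotientMap_mk.continuousOn_isOpen_iff (hW.preimage hproj)]
      have hfun : d ∘ mk = fun p => normalHom (g p) := funext hdg
      rw [hfun, continuousOn_iff_continuous_domRestrict]
      refine continuous_normalHom.comp (f := fun p : ↥(mk ⁻¹' ((fun q : ReductionCarrier P I o =>
        (q.toFrame F').base) ⁻¹' W)) => g p) (Continuous.subtype_mk ?_ _)
      have h1 : Continuous fun p : ↥(mk ⁻¹' ((fun q : ReductionCarrier P I o =>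
          (q.toFrame F').base) ⁻¹' W)) => (⟨(P.toFrame p.1.1).base, p.2⟩ : W) :=
        Continuous.subtype_mk (P.continuous_proj.comp
          (continuous_subtype_val.comp continuous_subtype_val)) _
      exact P.principal.continuous_div ((continuousOn_iff_continuous_domRestrict.1 hσ).comp h1)
        (continuous_subtype_val.comp continuous_subtype_val)
        fun p => congrArg Subtype.val (hg p.1)
    · have h1 : Continuous fun q : W × Mp ι => op (mpEmbed κ q.2).1 • σ q.1 :=
        P.principal.continuous_smul (f := fun q : W × Mp ι => σ q.1)
          (g := fun q : W × Mp ι => (mpEmbed κ q.2).1)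
          ((continuousOn_iff_continuous_domRestrict.1 hσ).comp continuous_fst)
          (continuous_subtype_val.comp (continuous_mpEmbed.comp continuous_snd))
      exact isQuotientMap_mk.continuous.comp (h1.subtype_mk fun q =>
        ((s q.1).act (mpEmbed κ q.2)).2)

end ReductionCarrier

/-- The metaplectic structure `Mp₊(I, E) / Z` of the normal bundle. -/
def MetaplecticStructure.reduction (P : MetaplecticStructure F E Ω.bilin (κ ⊕ ι)) (F' : Type*)
    (hloc : ∀ x₀, ∃ U : Set N, IsOpen U ∧ x₀ ∈ U ∧ ∃ b : N → FrameBundle F E Ω.bilin (κ ⊕ ι),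
      ContinuousOn b U ∧ ∀ x, (b x).base = x ∧ IsAdapted I o (b x)) :
    MetaplecticStructure F' (NormalBundle Ω I) (normalForm Ω I) ι where
  carrier := ReductionCarrier P I o
  toFrame := ReductionCarrier.toFrame F'
  continuous_toFrame := ReductionCarrier.continuous_toFrame F'
  toFrame_smul := ReductionCarrier.toFrame_smul F'
  principal := ReductionCarrier.isPrincipalBundle F' hloc

theorem isNormalReduction_iff {F' : Type*}
    {Q : MetaplecticStructure F' (NormalBundle Ω I) (normalForm Ω I) ι} :
    IsNormalReduction I o P Q ↔ ∃ R : AdaptedPart P I o → Q.carrier, IsQuotientMap R ∧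
      (∀ p, Q.toFrame (R p) = p.2.normal F') ∧
      (∀ p (g : MpPlus κ ι), R (p.act g) = op (normalHom g) • R p) ∧
      ∀ p p', R p = R p' ↔ ∃ g : MpPlus κ ι, normalHom g = 1 ∧ p' = p.act g := by
  refine exists_congr fun R => and_congr_right fun _ => and_congr_right fun _ => and_congr ?_ ?_
  · constructor
    · exact fun h p g => h p (p.act g) g.1 g.2 rfl
    · intro h p p' g hg hp
      rw [show p' = AdaptedPart.act p ⟨g, hg⟩ from Subtype.ext hp]
      exact h p ⟨g, hg⟩
  · refine forall_congr' fun p => forall_congr' fun p' => iff_congr Iff.rfl ?_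
    constructor
    · rintro ⟨g, hg, h1, hp⟩
      exact ⟨⟨g, hg⟩, h1, Subtype.ext hp⟩
    · rintro ⟨g, h1, hp⟩
      exact ⟨g.1, g.2, h1, congrArg Subtype.val hp⟩

theorem MetaplecticStructure.isNormalReduction_reduction (F' : Type*)
    (hloc : ∀ x₀, ∃ U : Set N, IsOpen U ∧ x₀ ∈ U ∧ ∃ b : N → FrameBundle F E Ω.bilin (κ ⊕ ι),
      ContinuousOn b U ∧ ∀ x, (b x).base = x ∧ IsAdapted I o (b x)) :
    IsNormalReduction I o P (P.reduction F' hloc) :=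
  isNormalReduction_iff.2 ⟨ReductionCarrier.mk, ReductionCarrier.isQuotientMap_mk, fun _ => rfl,
    fun p g => (ReductionCarrier.op_smul_mk g p).symm, fun _ _ => ReductionCarrier.mk_eq_mk⟩

end Reduction

/-! ### The reduction relation depends only on classes and is single valued -/

section Comparison

/-- Two quotient maps with the same fibres have homeomorphic targets. -/
theorem exists_homeomorph_of_isQuotientMap {X Y Z : Type*} [TopologicalSpace X]
    [TopologicalSpace Y] [TopologicalSpace Z] {f : X → Y} {g : X → Z} (hf : IsQuotientMap f)
    (hg : IsQuotientMap g) (h : ∀ x x', f x = f x' ↔ g x = g x') :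
    ∃ e : Y ≃ₜ Z, ∀ x, e (f x) = g x := by
  have h1 : ∀ x, g (Function.surjInv hf.surjective (f x)) = g x := fun x =>
    (h _ _).1 (Function.surjInv_eq hf.surjective (f x))
  have h2 : ∀ x, f (Function.surjInv hg.surjective (g x)) = f x := fun x =>
    (h _ _).2 (Function.surjInv_eq hg.surjective (g x))
  refine ⟨⟨⟨fun y => g (Function.surjInv hf.surjective y),
    fun z => f (Function.surjInv hg.surjective z), fun y => ?_, fun z => ?_⟩, ?_, ?_⟩, h1⟩
  · obtain ⟨x, rfl⟩ := hf.surjective y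
    exact (congrArg (fun z => f (Function.surjInv hg.surjective z)) (h1 x)).trans (h2 x)
  · obtain ⟨x, rfl⟩ := hg.surjective z
    exact (congrArg (fun y => g (Function.surjInv hf.surjective y)) (h2 x)).trans (h1 x)
  · exact hf.continuous_iff.2 (hg.continuous.congr fun x => (h1 x).symm)
  · exact hg.continuous_iff.2 (hf.continuous.congr fun x => (h2 x).symm)

universe u v

variable {N : Type u} [TopologicalSpace N] {F : Type*} [NormedAddCommGroup F] [NormedSpace ℝ F]
  {E : N → Type v} [TopologicalSpace (TotalSpace F E)]
  [∀ x, TopologicalSpace (E x)] [∀ x, AddCommGroup (E x)] [∀ x, Module ℝ (E x)]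
  [∀ x, IsTopologicalAddGroup (E x)] [∀ x, ContinuousConstSMul ℝ (E x)]
  [FiberBundle F E] [VectorBundle ℝ F E]
  {Ω : SymplecticForm F E} {κ ι : Type} [Fintype κ] [DecidableEq κ] [Fintype ι] [DecidableEq ι]
  {I : ∀ x, Submodule ℝ (E x)} {o : ∀ x, Orientation ℝ (I x) κ}
  {P P' : MetaplecticStructure F E Ω.bilin (κ ⊕ ι)} {F' : Type*}
  {Q Q' : MetaplecticStructure F' (NormalBundle Ω I) (normalForm Ω I) ι}

open MulOpposite

theorem IsNormalReduction.congr_right (h : IsNormalReduction I o P Q) (hQ : Q ≈ Q') :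
    IsNormalReduction I o P Q' := by
  rw [isNormalReduction_iff] at h ⊢
  obtain ⟨R, h1, h2, h3, h4⟩ := h
  obtain ⟨e, he, hes⟩ := hQ
  exact ⟨e ∘ R, e.isQuotientMap.comp h1, fun p => (he _).trans (h2 p),
    fun p g => (congrArg e (h3 p g)).trans (hes _ _), fun p p' => e.injective.eq_iff.trans (h4 p p')⟩

theorem IsNormalReduction.congr_left (h : IsNormalReduction I o P Q) (hP : P ≈ P') :
    IsNormalReduction I o P' Q := by
  rw [isNormalReduction_iff] at h ⊢
  obtain ⟨R, h1, h2, h3, h4⟩ := h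
  obtain ⟨e, he, hes⟩ := Setoid.symm hP
  let ε : AdaptedPart P' I o ≃ₜ AdaptedPart P I o := e.subtype fun p => by rw [he]
  have hε : ∀ p g, ε (p.act g) = (ε p).act g := fun p g => Subtype.ext (hes g.1 p.1)
  refine ⟨R ∘ ε, h1.comp ε.isQuotientMap, fun p => ?_, fun p g => ?_, fun p p' => ?_⟩
  · exact (h2 _).trans (IsAdapted.normal_congr _ _ (he p.1))
  · rw [Function.comp_apply, hε, h3]
    rfl
  · refine (h4 _ _).trans (exists_congr fun g => and_congr_right fun _ => ?_)
    rw [← hε, ε.injective.eq_iff]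

/-- The reduction of a metaplectic structure is unique up to equivalence. -/
theorem IsNormalReduction.unique_right (h : IsNormalReduction I o P Q)
    (h' : IsNormalReduction I o P Q') : Q ≈ Q' := by
  rw [isNormalReduction_iff] at h h'
  obtain ⟨R, h1, h2, h3, h4⟩ := h
  obtain ⟨R', h1', h2', h3', h4'⟩ := h'
  obtain ⟨e, he⟩ := exists_homeomorph_of_isQuotientMap h1 h1'
    fun p p' => (h4 p p').trans (h4' p p').symm
  refine ⟨e, fun q => ?_, fun g q => ?_⟩
  · obtain ⟨p, rfl⟩ := h1.surjective q
    rw [he, h2, h2']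
  · obtain ⟨p, rfl⟩ := h1.surjective q
    -- Every element of `Mp(ℓ - k)` is in the image of `normalHom`, so equivariance under `Mp₊(k,
    -- ℓ)` suffices.
    rw [← normalHom_mpEmbed (κ := κ) g, ← h3, he, he, h3']

end Comparison

/-! ### The inverse construction by extension of the structure group -/

section Associated

universe u v

variable {N : Type u} [TopologicalSpace N] {F : Type*} [NormedAddCommGroup F] [NormedSpace ℝ F]
  {E : N → Type v} [TopologicalSpace (TotalSpace F E)]
  [∀ x, TopologicalSpace (E x)] [∀ x, AddCommGroup (E x)] [∀ x, Module ℝ (E x)]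
  [∀ x, IsTopologicalAddGroup (E x)] [∀ x, ContinuousConstSMul ℝ (E x)]
  [FiberBundle F E] [VectorBundle ℝ F E]
  {Ω : SymplecticForm F E} {κ ι : Type} [Fintype κ] [DecidableEq κ] [Fintype ι] [DecidableEq ι]
  {I : ∀ x, Submodule ℝ (E x)} {o : ∀ x, Orientation ℝ (I x) κ} {F' : Type*}

open MulOpposite

/-- The fibre product of `Bp₊(I, E)` and a metaplectic structure of the normal bundle over the
bundle of symplectic frames of the normal bundle. -/
abbrev AdaptedLift (Q : MetaplecticStructure F' (NormalBundle Ω I) (normalForm Ω I) ι)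
    (o : ∀ x, Orientation ℝ (I x) κ) : Type _ :=
  {m : FrameBundle F E Ω.bilin (κ ⊕ ι) × Q.carrier //
    ∃ h : IsAdapted I o m.1, h.normal F' = Q.toFrame m.2}

variable {Q : MetaplecticStructure F' (NormalBundle Ω I) (normalForm Ω I) ι}
  {X : Type*} [TopologicalSpace X]

namespace AdaptedLift

/-- The right action of `Mp₊(k, ℓ)`. -/
def act (m : AdaptedLift Q o) (k : MpPlus κ ι) : AdaptedLift Q o :=
  ⟨(m.1.1.act k.1.mat, op (normalHom k) • m.1.2), by
    obtain ⟨h, hm⟩ := m.2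
    refine ⟨h.act k.2, ?_⟩
    rw [Q.toFrame_op_smul, ← hm]
    exact h.normal_act k.2 _⟩

theorem act_one (m : AdaptedLift Q o) : m.act 1 = m := by
  refine Subtype.ext (Prod.ext (FrameBundle.act_one _) ?_)
  change op (normalHom 1) • m.1.2 = m.1.2
  rw [map_one, op_one, one_smul]

theorem act_mul (m : AdaptedLift Q o) (k k' : MpPlus κ ι) :
    m.act (k * k') = (m.act k).act k' := by
  refine Subtype.ext (Prod.ext (FrameBundle.act_mul _ _ _) ?_)
  change op (normalHom (k * k')) • m.1.2 = op (normalHom k') • op (normalHom k) • m.1.2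
  rw [map_mul, op_mul, mul_smul]

theorem act_injective (m : AdaptedLift Q o) {k k' : MpPlus κ ι} (h : m.act k = m.act k') :
    k = k' :=
  normalHom_ext (m.1.1.act_injective (congrArg (fun m => m.1.1) h))
    (Q.principal.smul_left_cancel (congrArg (fun m => m.1.2) h))

theorem base_eq (m : AdaptedLift Q o) : (Q.toFrame m.1.2).base = m.1.1.base := by
  obtain ⟨h, hm⟩ := m.2
  rw [← hm]
  rfl

/-- The adapted frames differ by some `A` in `Sp₊(k, ℓ)` and the points of `Q` by some `g` in `Mp(ℓ
- k)`. Both induce the same change of normal frame, so `A` and `g` agree in `Sp(ℓ - k)` and come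
from one element of `Mp₊(k, ℓ)`. -/
theorem exists_act {m m' : AdaptedLift Q o} (h : m.1.1.base = m'.1.1.base) :
    ∃ k : MpPlus κ ι, m' = m.act k := by
  obtain ⟨A, hA⟩ := FrameBundle.exists_act h
  obtain ⟨g, hg⟩ := Q.principal.exists_smul (p := m.1.2) (p' := m'.1.2) (by
    rw [m.base_eq, m'.base_eq, h])
  obtain ⟨hm, hmn⟩ := m.2
  obtain ⟨hm', hmn'⟩ := m'.2
  have hA' : IsSpPlus A := hm.isSpPlus (hA ▸ hm')
  have hgm : g.mat = hA'.normalMat := by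
    apply FrameBundle.act_injective (Q.toFrame m.1.2)
    rw [← Q.toFrame_op_smul, ← hg, ← hmn', ← hmn, ← hm.normal_act hA' (hm.act hA')]
    exact hm'.normal_congr _ hA
  obtain ⟨k, hk, hkn⟩ := MpPlus.exists_of hA' g hgm
  refine ⟨k, Subtype.ext (Prod.ext ?_ ?_)⟩
  · exact hA.trans (by rw [← hk]; rfl)
  · exact hg.trans (by rw [← hkn]; rfl)

theorem continuous_act {f : X → AdaptedLift Q o} {k : X → MpPlus κ ι} (hf : Continuous f)
    (hk : Continuous k) : Continuous fun x => (f x).act (k x) :=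
  ((FrameBundle.continuous_act (continuous_fst.comp (continuous_subtype_val.comp hf))
    (Mp.continuous_mat.comp (continuous_subtype_val.comp hk))).prodMk
    (Q.principal.continuous_smul (continuous_snd.comp (continuous_subtype_val.comp hf))
      (continuous_normalHom.comp hk))).subtype_mk fun x => ((f x).act (k x)).2

theorem continuous_div {f f' : X → AdaptedLift Q o} {k : X → MpPlus κ ι} (hf : Continuous f)
    (hf' : Continuous f') (h : ∀ x, f' x = (f x).act (k x)) : Continuous k := by
  refine MpPlus.continuous_of ?_ ?_
  · refine FrameBundle.continuous_div (b := fun x => (f x).1.1)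
      (continuous_fst.comp (continuous_subtype_val.comp hf)) ?_
    exact (continuous_fst.comp (continuous_subtype_val.comp hf')).congr
      fun x => congrArg (fun m : AdaptedLift Q o => m.1.1) (h x)
  · exact Q.principal.continuous_div (continuous_snd.comp (continuous_subtype_val.comp hf))
      (continuous_snd.comp (continuous_subtype_val.comp hf'))
      fun x => congrArg (fun m : AdaptedLift Q o => m.1.2) (h x)

theorem continuous_base : Continuous fun m : AdaptedLift Q o => m.1.1.base :=
  FrameBundle.continuous_base.comp (continuous_fst.comp continuous_subtype_val)

/-- Pair a local adapted frame with a lift to `Q` of its normal frame. The lift exists because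
division of normal frames is continuous. -/
theorem exists_local_section (Q : MetaplecticStructure F' (NormalBundle Ω I) (normalForm Ω I) ι)
    (hloc : ∀ x₀, ∃ U : Set N, IsOpen U ∧ x₀ ∈ U ∧ ∃ b : N → FrameBundle F E Ω.bilin (κ ⊕ ι),
      ContinuousOn b U ∧ ∀ x, (b x).base = x ∧ IsAdapted I o (b x)) (x₀ : N) :
    ∃ W : Set N, IsOpen W ∧ x₀ ∈ W ∧ ∃ s : N → AdaptedLift Q o,
      ContinuousOn s W ∧ ∀ x, (s x).1.1.base = x := by
  obtain ⟨U, hU, hx, b, hb, hbx⟩ := hloc x₀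
  have hbU := continuousOn_iff_continuous_domRestrict.1 hb
  obtain ⟨W, hWU, hW, hxW, τ, hτ, hτb⟩ := Q.exists_local_lift (hasContinuousDiv_normal hloc) hU hx
    (b := fun x => (hbx x).2.normal F')
    (continuousOn_iff_continuous_domRestrict.2
      (IsAdapted.continuous_normal F' hbU fun x => (hbx x).2)) fun x => (hbx x).1
  refine ⟨W, hW, hxW, fun x => ⟨(b x, τ x), (hbx x).2, (hτb x).symm⟩, ?_, fun x => (hbx x).1⟩
  rw [continuousOn_iff_continuous_domRestrict]
  exact ((continuousOn_iff_continuous_domRestrict.1 (hb.mono hWU)).prodMk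
    (continuousOn_iff_continuous_domRestrict.1 hτ)).subtype_mk _

/-- A continuous surjection is a quotient map as soon as it has local continuous sections. These are
obtained by translating a section over the base with `mpEmbed` of the division in `Q`. -/
theorem isQuotientMap_snd
    (hloc : ∀ x₀, ∃ U : Set N, IsOpen U ∧ x₀ ∈ U ∧ ∃ b : N → FrameBundle F E Ω.bilin (κ ⊕ ι),
      ContinuousOn b U ∧ ∀ x, (b x).base = x ∧ IsAdapted I o (b x)) :
    IsQuotientMap fun m : AdaptedLift Q o => m.1.2 := by
  have hsec : ∀ q : Q.carrier, ∃ V : Set Q.carrier, IsOpen V ∧ q ∈ V ∧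
      ∃ t : Q.carrier → AdaptedLift Q o, ContinuousOn t V ∧ ∀ q, (t q).1.2 = q := by
    intro q₀
    obtain ⟨W, hW, hxW, s, hs, hsx⟩ := exists_local_section Q hloc (Q.toFrame q₀).base
    have hh : ∀ q : Q.carrier, ∃ h : Mp ι, q = op h • (s (Q.toFrame q).base).1.2 := fun q =>
      Q.principal.exists_smul (by rw [base_eq, hsx])
    choose h hh using hh
    refine ⟨_, hW.preimage Q.continuous_proj, hxW,
      fun q => (s (Q.toFrame q).base).act (mpEmbed κ (h q)), ?_, fun q => ?_⟩
    · rw [continuousOn_iff_continuous_domRestrict]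
      have h1 : Continuous fun q : ↥((fun p : Q.carrier => (Q.toFrame p).base) ⁻¹' W) =>
          s (Q.toFrame q).base :=
        (continuousOn_iff_continuous_domRestrict.1 hs).comp
          ((Q.continuous_proj.comp continuous_subtype_val).subtype_mk fun q => q.2)
      have h2 : Continuous fun q : ↥((fun p : Q.carrier => (Q.toFrame p).base) ⁻¹' W) => h q :=
        Q.principal.continuous_div (continuous_snd.comp (continuous_subtype_val.comp h1))
          continuous_subtype_val fun q => hh q
      exact continuous_act h1 (continuous_mpEmbed.comp h2)
    · change op (normalHom (mpEmbed κ (h q))) • (s (Q.toFrame q).base).1.2 = q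
      rw [normalHom_mpEmbed, ← hh]
  have hc : Continuous fun m : AdaptedLift Q o => m.1.2 :=
    continuous_snd.comp continuous_subtype_val
  refine ⟨isCoinducing_iff.2 fun S => ⟨fun h => ?_, fun h => h.preimage hc⟩, fun q => ?_⟩
  · refine isOpen_iff_mem_nhds.2 fun q hq => ?_
    obtain ⟨V, hV, hqV, t, htc, ht⟩ := hsec q
    have := htc.isOpen_inter_preimage hV h
    refine Filter.mem_of_superset (this.mem_nhds ⟨hqV, ?_⟩) fun q' hq' => ?_
    · change (t q).1.2 ∈ S
      rwa [ht]
    · have h' : (t q').1.2 ∈ S := hq'.2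
      rwa [ht] at h'
  · obtain ⟨V, -, -, t, -, ht⟩ := hsec q
    exact ⟨t q, ht q⟩

end AdaptedLift

/-- The equivalence relation defining the associated bundle. -/
def associatedSetoid (Q : MetaplecticStructure F' (NormalBundle Ω I) (normalForm Ω I) ι)
    (o : ∀ x, Orientation ℝ (I x) κ) : Setoid (AdaptedLift Q o × Mp (κ ⊕ ι)) where
  r a b := ∃ k : MpPlus κ ι, b.1 = a.1.act k ∧ a.2 = k.1 * b.2
  iseqv :=
    { refl := fun a => ⟨1, a.1.act_one.symm, (one_mul _).symm⟩
      symm := by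
        rintro ⟨m, g⟩ ⟨m', g'⟩ ⟨k, hm, hg⟩
        obtain rfl : m' = m.act k := hm
        obtain rfl : g = k.1 * g' := hg
        exact ⟨k⁻¹, by rw [← AdaptedLift.act_mul, mul_inv_cancel, AdaptedLift.act_one],
          (inv_mul_cancel_left _ _).symm⟩
      trans := by
        rintro ⟨m, g⟩ ⟨m', g'⟩ ⟨m'', g''⟩ ⟨k, hm, hg⟩ ⟨k', hm', hg'⟩
        obtain rfl : m' = m.act k := hm
        obtain rfl : g = k.1 * g' := hg
        obtain rfl : m'' = (m.act k).act k' := hm'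
        obtain rfl : g' = k'.1 * g'' := hg'
        exact ⟨k * k', (m.act_mul k k').symm, (mul_assoc _ _ _).symm⟩ }

/-- The bundle associated to the inclusion of `Mp₊(k, ℓ)` in `Mp(ℓ)`. -/
def AssociatedCarrier (Q : MetaplecticStructure F' (NormalBundle Ω I) (normalForm Ω I) ι)
    (o : ∀ x, Orientation ℝ (I x) κ) : Type _ := Quotient (associatedSetoid Q o)

instance : TopologicalSpace (AssociatedCarrier Q o) :=
  inferInstanceAs (TopologicalSpace (Quotient (associatedSetoid Q o)))

namespace AssociatedCarrier

/-- The class of a pair. -/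
def mk (m : AdaptedLift Q o) (g : Mp (κ ⊕ ι)) : AssociatedCarrier Q o := Quotient.mk _ (m, g)

theorem isQuotientMap_mk : IsQuotientMap
    fun a : AdaptedLift Q o × Mp (κ ⊕ ι) => (mk a.1 a.2 : AssociatedCarrier Q o) :=
  isQuotientMap_quotient_mk'

theorem mk_eq_mk {m m' : AdaptedLift Q o} {g g' : Mp (κ ⊕ ι)} :
    mk m g = mk m' g' ↔ ∃ k : MpPlus κ ι, m' = m.act k ∧ g = k.1 * g' :=
  Quotient.eq (r := associatedSetoid Q o)

theorem exists_mk (q : AssociatedCarrier Q o) : ∃ m g, mk m g = q :=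
  (isQuotientMap_mk.surjective q).elim fun a ha => ⟨a.1, a.2, ha⟩

theorem mk_act (m : AdaptedLift Q o) (k : MpPlus κ ι) (g : Mp (κ ⊕ ι)) :
    mk (m.act k) g = mk m (k.1 * g) :=
  (mk_eq_mk.2 ⟨k, rfl, rfl⟩).symm

theorem mk_right_injective (m : AdaptedLift Q o) : Function.Injective (mk m) := by
  intro g g' h
  obtain ⟨k, hk, rfl⟩ := mk_eq_mk.1 h
  obtain rfl : 1 = k := m.act_injective (m.act_one.trans hk)
  exact one_mul _

/-- Used for `g = 1`: the fibre product embeds in the associated bundle as the set of classes `[m,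
1]`. -/
theorem mk_left_injective (g : Mp (κ ⊕ ι)) :
    Function.Injective fun m : AdaptedLift Q o => mk m g := by
  intro m m' h
  obtain ⟨k, rfl, hk⟩ := mk_eq_mk.1 h
  obtain rfl : k = 1 := Subtype.ext (right_eq_mul.1 hk)
  exact m.act_one.symm

instance : SMul (Mp (κ ⊕ ι))ᵐᵒᵖ (AssociatedCarrier Q o) where
  smul h := Quotient.map (fun a => (a.1, a.2 * h.unop)) (by
    rintro ⟨m, g⟩ ⟨m', g'⟩ ⟨k, hm, hg⟩
    obtain rfl : m' = m.act k := hm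
    obtain rfl : g = k.1 * g' := hg
    exact ⟨k, rfl, mul_assoc _ _ _⟩)

theorem op_smul_mk (m : AdaptedLift Q o) (g h : Mp (κ ⊕ ι)) : op h • mk m g = mk m (g * h) := rfl

instance : MulAction (Mp (κ ⊕ ι))ᵐᵒᵖ (AssociatedCarrier Q o) where
  one_smul q := by
    obtain ⟨m, g, rfl⟩ := exists_mk q
    exact congrArg (mk m) (mul_one g)
  mul_smul h h' q := by
    obtain ⟨m, g, rfl⟩ := exists_mk q
    exact congrArg (mk m) (mul_assoc g h'.unop h.unop).symm

/-- The projection to the bundle of symplectic frames. -/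
def toFrame (q : AssociatedCarrier Q o) : FrameBundle F E Ω.bilin (κ ⊕ ι) :=
  Quotient.lift (s := associatedSetoid Q o) (fun a => a.1.1.1.act a.2.mat) (by
    rintro ⟨m, g⟩ ⟨m', g'⟩ ⟨k, hm, hg⟩
    obtain rfl : m' = m.act k := hm
    obtain rfl : g = k.1 * g' := hg
    exact FrameBundle.act_mul _ _ _) q

theorem continuous_toFrame : Continuous (toFrame : AssociatedCarrier Q o → _) :=
  isQuotientMap_mk.continuous_iff.2 <| FrameBundle.continuous_act
    (continuous_fst.comp (continuous_subtype_val.comp continuous_fst))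
    (Mp.continuous_mat.comp continuous_snd)

theorem toFrame_smul (h : Mp (κ ⊕ ι)) (q : AssociatedCarrier Q o) :
    (op h • q).toFrame = q.toFrame.act h.mat := by
  obtain ⟨m, g, rfl⟩ := exists_mk q
  exact FrameBundle.act_mul _ _ _

theorem continuous_mk : Continuous fun a : AdaptedLift Q o × Mp (κ ⊕ ι) =>
    (mk a.1 a.2 : AssociatedCarrier Q o) :=
  isQuotientMap_mk.continuous

/-- If `m = s(x) k(m)` for a local section `s` of the fibre product and `x` the base point, then
`[m, g] = [s(x), 1] · (k(m) g)`. The classes `[s(x), 1]` are thus a local section with division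
`k(m) g`. -/
theorem isPrincipalBundle (Q : MetaplecticStructure F' (NormalBundle Ω I) (normalForm Ω I) ι)
    (hloc : ∀ x₀, ∃ U : Set N, IsOpen U ∧ x₀ ∈ U ∧ ∃ b : N → FrameBundle F E Ω.bilin (κ ⊕ ι),
      ContinuousOn b U ∧ ∀ x, (b x).base = x ∧ IsAdapted I o (b x)) :
    IsPrincipalBundle (Mp (κ ⊕ ι)) fun q : AssociatedCarrier Q o => q.toFrame.base := by
  have hproj : Continuous fun q : AssociatedCarrier Q o => q.toFrame.base :=
    FrameBundle.continuous_base.comp continuous_toFrame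
  refine IsPrincipalBundle.of_local_sections hproj
    (fun h q => by rw [toFrame_smul, FrameBundle.act_base]) (fun h q hq => ?_) fun x₀ => ?_
  · obtain ⟨m, g, rfl⟩ := exists_mk q
    exact mul_eq_left.1 (mk_right_injective m hq)
  · obtain ⟨W, hW, hxW, s, hs, hsx⟩ := AdaptedLift.exists_local_section Q hloc x₀
    have hk : ∀ m : AdaptedLift Q o, ∃ k : MpPlus κ ι, m = (s m.1.1.base).act k := fun m =>
      AdaptedLift.exists_act (hsx _)
    choose k hk using hk
    have hmk : ∀ m g, mk m g = op ((k m).1 * g) • mk (s (mk m g).toFrame.base) 1 := fun m g => by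
      rw [op_smul_mk, one_mul, ← mk_act]
      exact congrArg (fun m => mk m g) (hk m)
    have hd : ∀ q : AssociatedCarrier Q o, ∃ h : Mp (κ ⊕ ι), q = op h • mk (s q.toFrame.base) 1 :=
      fun q => by
        obtain ⟨m, g, rfl⟩ := exists_mk q
        exact ⟨_, hmk m g⟩
    choose d hd using hd
    have hdk : ∀ m g, d (mk m g) = (k m).1 * g := fun m g => by
      have h := (hd (mk m g)).symm.trans (hmk m g)
      rw [op_smul_mk, op_smul_mk, one_mul, one_mul] at h
      exact mk_right_injective _ h
    refine ⟨W, hW, hxW, fun x => mk (s x) 1, d, hsx, hd, ?_, ?_⟩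
    · rw [isQuotientMap_mk.continuousOn_isOpen_iff (hW.preimage hproj),
        continuousOn_iff_continuous_domRestrict]
      let T := ↥((fun a : AdaptedLift Q o × Mp (κ ⊕ ι) => (mk a.1 a.2 : AssociatedCarrier Q o)) ⁻¹'
        ((fun q : AssociatedCarrier Q o => q.toFrame.base) ⁻¹' W))
      have hm : Continuous fun a : T => a.1.1 := continuous_fst.comp continuous_subtype_val
      have h1 : Continuous fun a : T => s a.1.1.1.1.base :=
        (continuousOn_iff_continuous_domRestrict.1 hs).comp
          ((AdaptedLift.continuous_base.comp hm).subtype_mk fun a => a.2)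
      have h2 : Continuous fun a : T => k a.1.1 :=
        AdaptedLift.continuous_div h1 hm fun a => hk a.1.1
      exact ((continuous_subtype_val.comp h2).mul
        (continuous_snd.comp continuous_subtype_val)).congr fun a => (hdk a.1.1 a.1.2).symm
    · have h1 : Continuous fun q : W × Mp (κ ⊕ ι) => mk (s q.1) q.2 :=
        continuous_mk.comp (((continuousOn_iff_continuous_domRestrict.1 hs).comp
          continuous_fst).prodMk continuous_snd)
      refine h1.congr fun q => ?_
      rw [op_smul_mk, one_mul]

end AssociatedCarrier

/-- The metaplectic structure with reduction `Q`. -/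
def MetaplecticStructure.associated
    (Q : MetaplecticStructure F' (NormalBundle Ω I) (normalForm Ω I) ι)
    (hloc : ∀ x₀, ∃ U : Set N, IsOpen U ∧ x₀ ∈ U ∧ ∃ b : N → FrameBundle F E Ω.bilin (κ ⊕ ι),
      ContinuousOn b U ∧ ∀ x, (b x).base = x ∧ IsAdapted I o (b x)) :
    MetaplecticStructure F E Ω.bilin (κ ⊕ ι) where
  carrier := AssociatedCarrier Q o
  toFrame := AssociatedCarrier.toFrame
  continuous_toFrame := AssociatedCarrier.continuous_toFrame
  toFrame_smul := AssociatedCarrier.toFrame_smul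
  principal := AssociatedCarrier.isPrincipalBundle Q hloc

/-- The part of the associated bundle over `Bp₊(I, E)` is a copy of the fibre product, embedded by
`J : m ↦ [m, 1]`. The quotient map to `Q` is the second projection of the fibre product. -/
theorem MetaplecticStructure.isNormalReduction_associated
    (Q : MetaplecticStructure F' (NormalBundle Ω I) (normalForm Ω I) ι)
    (hloc : ∀ x₀, ∃ U : Set N, IsOpen U ∧ x₀ ∈ U ∧ ∃ b : N → FrameBundle F E Ω.bilin (κ ⊕ ι),
      ContinuousOn b U ∧ ∀ x, (b x).base = x ∧ IsAdapted I o (b x)) :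
    IsNormalReduction I o (Q.associated hloc) Q := by
  set P := Q.associated hloc with hP
  have hmkP : ∀ m : AdaptedLift Q o, P.toFrame (AssociatedCarrier.mk m 1) = m.1.1 := fun m =>
    FrameBundle.act_one _
  let J : AdaptedLift Q o → AdaptedPart P I o := fun m =>
    ⟨AssociatedCarrier.mk m 1, by rw [hmkP]; exact m.2.1⟩
  have hJc : Continuous J :=
    (AssociatedCarrier.continuous_mk.comp (continuous_id.prodMk continuous_const)).subtype_mk _
  have hJact : ∀ m k, J (m.act k) = (J m).act k := fun m k =>
    Subtype.ext ((AssociatedCarrier.mk_act m k 1).trans (by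
      change _ = AssociatedCarrier.mk m (1 * k.1)
      rw [one_mul, mul_one]))
  have hJinj : Function.Injective J := fun m m' h =>
    AssociatedCarrier.mk_left_injective 1 (congrArg Subtype.val h)
  -- If the frame of `[m, g]` is adapted, then `g` lies in `Mp₊(k, ℓ)` and `[m, g] = [m g, 1]`.
  have hJsurj : ∀ p : AdaptedPart P I o, ∃ m, p = J m := by
    rintro ⟨p, hp⟩
    obtain ⟨m, g, rfl⟩ := AssociatedCarrier.exists_mk p
    have hg : IsSpPlus g.mat := m.2.1.isSpPlus hp
    refine ⟨m.act ⟨g, hg⟩, Subtype.ext ?_⟩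
    change _ = AssociatedCarrier.mk _ _
    rw [AssociatedCarrier.mk_act, mul_one]
  choose L hL using hJsurj
  have hLJ : ∀ m, L (J m) = m := fun m => hJinj (hL _).symm
  have hLact : ∀ p k, L (p.act k) = (L p).act k := fun p k =>
    hJinj (by rw [← hL, hJact, ← hL])
  have hbase : ∀ p, P.toFrame p.1 = (L p).1.1 := fun p =>
    (congrArg (fun p : AdaptedPart P I o => P.toFrame p.1) (hL p)).trans (hmkP _)
  -- Locally `L p` is a section `s` moved by `k(p)`, and `k(p)` is continuous because it is also the
  -- division of `p` by `J ∘ s` in the principal bundle `P`.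
  have hLc : Continuous L := by
    refine continuous_of_local fun p₀ => ?_
    obtain ⟨W, hW, hxW, s, hs, hsx⟩ :=
      AdaptedLift.exists_local_section Q hloc (P.toFrame p₀.1).base
    have hk : ∀ p : AdaptedPart P I o, ∃ k : MpPlus κ ι,
        L p = (s (P.toFrame p.1).base).act k := fun p =>
      AdaptedLift.exists_act (by rw [hsx, hbase])
    choose k hk using hk
    have hproj : Continuous fun p : AdaptedPart P I o => (P.toFrame p.1).base :=
      P.continuous_proj.comp continuous_subtype_val
    refine ⟨_, hW.preimage hproj, hxW, ?_⟩
    let T := ↥((fun p : AdaptedPart P I o => (P.toFrame p.1).base) ⁻¹' W)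
    have h1 : Continuous fun p : T => s (P.toFrame p.1.1).base :=
      (continuousOn_iff_continuous_domRestrict.1 hs).comp
        ((hproj.comp continuous_subtype_val).subtype_mk fun p => p.2)
    have h2 : Continuous fun p : T => k p.1 := by
      refine Continuous.subtype_mk (f := fun p : T => (k p.1).1) ?_ _
      refine P.principal.continuous_div
        (f := fun p : T => (J (s (P.toFrame p.1.1).base)).1) (f' := fun p : T => p.1.1)
        (continuous_subtype_val.comp (hJc.comp h1))
        (continuous_subtype_val.comp continuous_subtype_val) fun p => ?_
      have : p.1 = (J (s (P.toFrame p.1.1).base)).act (k p.1) := by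
        rw [← hJact, ← hk, ← hL]
      exact congrArg Subtype.val this
    exact (AdaptedLift.continuous_act h1 h2).congr fun p => (hk p.1).symm
  have hRc : Continuous fun p => (L p).1.2 :=
    continuous_snd.comp (continuous_subtype_val.comp hLc)
  refine isNormalReduction_iff.2 ⟨fun p => (L p).1.2, ?_, fun p => ?_, fun p k => ?_,
    fun p p' => ⟨fun h => ?_, ?_⟩⟩
  · refine IsQuotientMap.of_comp hJc hRc ?_
    convert AdaptedLift.isQuotientMap_snd (Q := Q) hloc using 1
    exact funext fun m => by rw [Function.comp_apply, hLJ]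
  · obtain ⟨h, hm⟩ := (L p).2
    exact hm.symm.trans (h.normal_congr _ (hbase p).symm)
  · exact congrArg (fun m : AdaptedLift Q o => m.1.2) (hLact p k)
  -- Points with equal image in `Q` lie over the same base point, so they differ by some `k`; since
  -- `normalHom k` fixes a point of `Q`, it is trivial.
  · replace h : (L p).1.2 = (L p').1.2 := h
    have hb : (L p).1.1.base = (L p').1.1.base := by
      rw [← AdaptedLift.base_eq, ← AdaptedLift.base_eq, h]
    obtain ⟨k, hk⟩ := AdaptedLift.exists_act hb
    have h' : (L p).1.2 = op (normalHom k) • (L p).1.2 :=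
      h.trans (congrArg (fun m : AdaptedLift Q o => m.1.2) hk)
    exact ⟨k, Q.principal.eq_one_of_smul_eq h'.symm, by rw [hL p', hk, hJact, ← hL]⟩
  · rintro ⟨k, hk, rfl⟩
    refine Eq.trans ?_ (congrArg (fun m : AdaptedLift Q o => m.1.2) (hLact p k)).symm
    change _ = op (normalHom k) • (L p).1.2
    rw [hk, op_one, one_smul]

/-- A metaplectic structure is determined by its reduction. -/
theorem IsNormalReduction.associated_equiv {P : MetaplecticStructure F E Ω.bilin (κ ⊕ ι)}
    (hR : IsNormalReduction I o P Q)
    (hloc : ∀ x₀, ∃ U : Set N, IsOpen U ∧ x₀ ∈ U ∧ ∃ b : N → FrameBundle F E Ω.bilin (κ ⊕ ι),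
      ContinuousOn b U ∧ ∀ x, (b x).base = x ∧ IsAdapted I o (b x)) :
    Q.associated hloc ≈ P := by
  obtain ⟨R, h1, h2, h3, h4⟩ := isNormalReduction_iff.1 hR
  -- This and `hex` say that `Mp₊(I, E)` is the fibre product of `Bp₊(I, E)` and `Q`. Uniqueness: an
  -- element of the kernel `Z` that fixes a frame has matrix `1` and trivial normal part, so it is
  -- `1`.
  have huniq : ∀ p p' : AdaptedPart P I o, P.toFrame p.1 = P.toFrame p'.1 → R p = R p' →
      p = p' := by
    intro p p' hf hr
    obtain ⟨k, hk, rfl⟩ := (h4 p p').1 hr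
    have hmat : k.1.mat = (1 : MpPlus κ ι).1.mat := by
      apply FrameBundle.act_injective (P.toFrame p.1)
      rw [← P.toFrame_op_smul]
      exact hf.symm.trans (FrameBundle.act_one _).symm
    rw [normalHom_ext hmat (hk.trans (map_one _).symm), AdaptedPart.act_one]
  have hex : ∀ m : AdaptedLift Q o, ∃ p : AdaptedPart P I o,
      P.toFrame p.1 = m.1.1 ∧ R p = m.1.2 := by
    rintro ⟨⟨b, q⟩, hb, hm⟩
    obtain ⟨p, rfl⟩ := h1.surjective q
    rw [h2] at hm
    -- A preimage of `q` under `R` has the right normal frame, so `A` acts trivially on normal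
    -- frames. Its lift with trivial normal part corrects the frame without moving the image in `Q`.
    obtain ⟨A, hA⟩ := FrameBundle.exists_act (b := P.toFrame p.1) (b' := b)
      (congrArg FrameBundle.base hm).symm
    have hA' : IsSpPlus A := p.2.isSpPlus (hA ▸ hb)
    have hA1 : hA'.normalMat = 1 := by
      apply FrameBundle.act_injective (p.2.normal F')
      rw [← p.2.normal_act hA' (p.2.act hA'), FrameBundle.act_one, ← hm]
      exact IsAdapted.normal_congr _ _ hA.symm
    obtain ⟨k, hk, hkn⟩ := MpPlus.exists_of hA' 1 hA1.symm
    refine ⟨AdaptedPart.act p k, ?_, ?_⟩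
    · exact (P.toFrame_op_smul k.1 p.1).trans (by rw [hk, ← hA])
    · rw [h3, hkn, op_one, one_smul]
  choose p hpf hpR using hex
  have hpact : ∀ m k, p (m.act k) = AdaptedPart.act (p m) k := fun m k =>
    huniq _ _ ((hpf _).trans ((P.toFrame_op_smul k.1 (p m).1).trans (by rw [hpf]; rfl)).symm)
      ((hpR _).trans ((h3 _ _).trans (by rw [hpR]; rfl)).symm)
  let e : AssociatedCarrier Q o → P.carrier :=
    Quotient.lift (s := associatedSetoid Q o) (fun a => op a.2 • (p a.1).1) (by
      rintro ⟨m, g⟩ ⟨m', g'⟩ ⟨k, hm, hg⟩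
      obtain rfl : m' = m.act k := hm
      obtain rfl : g = k.1 * g' := hg
      change op (k.1 * g') • (p m).1 = op g' • (p (m.act k)).1
      rw [hpact, op_mul, mul_smul]
      rfl)
  have he : ∀ m g, e (AssociatedCarrier.mk m g) = op g • (p m).1 := fun _ _ => rfl
  refine MetaplecticStructure.equiv_of_local_section (P := Q.associated hloc) (e := e)
    (fun a => ?_) (fun g a => ?_) fun x₀ => ?_
  · obtain ⟨m, g, rfl⟩ := AssociatedCarrier.exists_mk a
    rw [he, P.toFrame_op_smul, hpf]
    rfl
  · obtain ⟨m, g', rfl⟩ := AssociatedCarrier.exists_mk a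
    change e (AssociatedCarrier.mk m (g' * g)) = _
    rw [he, he, op_mul, mul_smul]
  · obtain ⟨U, hU, hx, b, hb, hbx⟩ := hloc x₀
    obtain ⟨W, hWU, hW, hxW, σ, hσ, hσb⟩ := P.exists_local_lift FrameBundle.hasContinuousDiv hU hx
      hb fun x => (hbx x).1
    let t : N → AdaptedPart P I o := fun x => ⟨σ x, by rw [hσb]; exact (hbx x).2⟩
    let s : N → AdaptedLift Q o := fun x => ⟨(P.toFrame (σ x), R (t x)), (t x).2, (h2 (t x)).symm⟩
    -- Along this section the chosen point `p` is the section `t` coming from `P`, so no continuity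
    -- of the choice `p` has to be proved.
    have hps : ∀ x, p (s x) = t x := fun x => huniq _ _ (hpf _) (hpR _)
    refine ⟨W, hW, hxW, fun x => AssociatedCarrier.mk (s x) 1, fun x => ?_, ?_, ?_⟩
    · exact (congrArg FrameBundle.base (hσb x)).trans (hbx x).1
    · rw [continuousOn_iff_continuous_domRestrict] at hσ
      refine continuousOn_iff_continuous_domRestrict.2 ?_
      exact AssociatedCarrier.continuous_mk.comp ((((P.continuous_toFrame.comp hσ).prodMk
        (h1.continuous.comp (hσ.subtype_mk _))).subtype_mk _).prodMk continuous_const)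
    · refine hσ.congr fun x _ => ?_
      change e (AssociatedCarrier.mk (s x) 1) = σ x
      rw [he, hps, op_one, one_smul]

end Associated

end Metaplectic

end

theorem mainTheorem6 {N : Type*} [TopologicalSpace N]
    {F : Type*} [NormedAddCommGroup F] [NormedSpace ℝ F] [FiniteDimensional ℝ F]
    {E : N → Type*} [TopologicalSpace (TotalSpace F E)]
    [∀ x, TopologicalSpace (E x)] [∀ x, AddCommGroup (E x)] [∀ x, Module ℝ (E x)]
    [∀ x, IsTopologicalAddGroup (E x)] [∀ x, ContinuousConstSMul ℝ (E x)]
    [FiberBundle F E] [VectorBundle ℝ F E]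
    (k m : ℕ) (hrank : Module.finrank ℝ F = 2 * (k + m))
    (Ω : Metaplectic.SymplecticForm F E)
    (I : ∀ x, Submodule ℝ (E x)) (o : ∀ x, Orientation ℝ (I x) (Fin k))
    (hI : Metaplectic.IsOrientedSubbundle F I o)
    (hiso : ∀ x, ∀ v ∈ I x, ∀ w ∈ I x, Ω.form x v w = 0) :
    ∃ Φ : Metaplectic.MetaplecticClass F E Ω.bilin (Fin k ⊕ Fin m) ≃
        Metaplectic.MetaplecticClass (Fin m ⊕ Fin m → ℝ) (Metaplectic.NormalBundle Ω I)
          (Metaplectic.normalForm Ω I) (Fin m),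
      ∀ (P : Metaplectic.MetaplecticStructure F E Ω.bilin (Fin k ⊕ Fin m))
        (Q : Metaplectic.MetaplecticStructure (Fin m ⊕ Fin m → ℝ)
          (Metaplectic.NormalBundle Ω I) (Metaplectic.normalForm Ω I) (Fin m)),
        Φ ⟦P⟧ = ⟦Q⟧ ↔ Metaplectic.IsNormalReduction I o P Q := by
  have hloc := Metaplectic.exists_local_adapted_frame k m hrank hI hiso
  let f : Metaplectic.MetaplecticClass F E Ω.bilin (Fin k ⊕ Fin m) →
      Metaplectic.MetaplecticClass (Fin m ⊕ Fin m → ℝ) (Metaplectic.NormalBundle Ω I)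
        (Metaplectic.normalForm Ω I) (Fin m) :=
    Quotient.map (fun P => P.reduction _ hloc) fun P P' h =>
      ((P.isNormalReduction_reduction _ hloc).congr_left h).unique_right
        (P'.isNormalReduction_reduction _ hloc)
  -- The reduction relation is the graph of `f`: it is invariant under equivalence of `Q`, and two
  -- reductions of the same `P` are equivalent.
  have hf : ∀ P Q, f ⟦P⟧ = ⟦Q⟧ ↔ Metaplectic.IsNormalReduction I o P Q := fun P Q =>
    Quotient.eq.trans ⟨(P.isNormalReduction_reduction _ hloc).congr_right,
      (P.isNormalReduction_reduction _ hloc).unique_right⟩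
  refine ⟨Equiv.ofBijective f ⟨?_, ?_⟩, hf⟩
  -- Structures with a common reduction `Q` are both equivalent to `Q.associated`.
  · rintro ⟨P⟩ ⟨P'⟩ h
    obtain ⟨Q, hQ⟩ := Quotient.exists_rep (f ⟦P⟧)
    have h1 := (hf P Q).1 hQ.symm
    have h2 := (hf P' Q).1 (h.symm.trans hQ.symm)
    exact Quotient.sound
      (Setoid.trans (Setoid.symm (h1.associated_equiv hloc)) (h2.associated_equiv hloc))
  · rintro ⟨Q⟩
    exact ⟨⟦Q.associated hloc⟧, (hf _ _).2 (Q.isNormalReduction_associated hloc)⟩
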